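/- **Model.** A host CPU and $P\ge 1$ PIM modules compute in bulk-synchronous rounds. In each round the CPU sends tasks to the modules, each module processes its tasks using only its own local memory, and the CPU gathers the replies. The *communication* of a module in a round is the number of words sent to it and received from it. Its *work* is the number of its steps, where receiving a task, searching one node, and sending back one entry of a node count one step each. The *CPU-side memory footprint* is the number of words occupied by the variables of the CPU program together with the task and reply buffers. **PIM-tree.** Let $B\ge 2$ be an integer and put $L=\max(1,\log_B P)$, $H_1=\max(1,\lceil\log_B\log_B P\rceil)$ (read as $1$ if $P=1$) and $H_2=\max(1,\lceil\log_B P\rceil-H_1)$. Let $D$ be a finite set of keys with values. Every key goes up each next level of a skip list with probability $1/B$, independently; a sentinel $-\infty$ goes up all levels. At level $t=1,\dots,H_1+H_2$ there is a chunk for each key $p$ going up at least $t$ levels (its pivot); it holds the keys that go up at least $t-1$ levels, from $p$ up to (not including) the next pivot, each with a pointer to the node of level $t-1$ of which it is the pivot (for $t=1$: to its data node). Every chunk and every data node is stored in a PIM module chosen uniformly at random, all choices being independent. Levels $1,\dots,H_1$ form L1, levels $H_1+1,\dots,H_1+H_2$ form L2; with every L2 chunk a copy of its search subtree within L2 (its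 shadow subtree) is stored. The keys going up $H_1+H_2$ levels are stored in a B+-tree of fanout $B$ (L3), with $h_3$ levels of nodes, which is replicated in all modules. **Algorithm.** For a batch of $S$ query keys (repetitions allowed): (1) distribute the queries evenly over the modules and search L3. (2) While the busiest module would receive more than $3$ times the average number of queries for L2, and some L2 chunk has more than $BH_2$ queries: in one round, pull all such chunks to the CPU and advance their queries by one level there. (3) In one round, send every query that is still in L2 to the module hosting its chunk, which searches through L2 in the shadow subtree. (4) In each of $H_1$ rounds, pull the L1 chunks that have more than $B$ queries and advance their queries on the CPU; send every other query to the module hosting its chunk, which returns the next pointer. Finally, in one round, retrieve every data node that is reached, once. **Theorem.** (i) There is an absolute constant $A_0$ such that, for every PIM-tree and every batch, the algorithm always returns for each query key $q$ the stored pair with the largest key $\le q$ (or reports that there is none), and uses at most $A_0L$ communication rounds (that is, $O(\log_B P)$ rounds for $P\ge B$). (ii) For every $a>0$ there is a constant $A$, depending only on $a$, such that the following holds for all $P\geq 1$, $B\ge 2$, all key sets $D$ with values and all batches of size $S\ge a\,P\ln P\cdot B\cdot L$ (that is, $S=\Omega(P\log P\cdot B\cdot\log_BP)$), the keys and the batch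 being fixed independently of the random choices, and for every $c\ge1$. With probability at least $1-P^{-c}$, all of the following hold simultaneously: * *Communication:* the total communication over all rounds and modules is at most $A\,c\,S\,(1+\log_B L)$, i.e. $O(\log_B\log_BP)$ per operation (up to an additive constant, for $P\geq B$). * *Load balance:* in every round, every module has communication at most $A\,c\,C/P$ and work at most $A\,c\,W/P$, where the budgets $C$ and $W$ of the round are: $C=S$, $W=S\,h_3$ for (1); $C=W=S/H_2$ for each round of (2); $C=S$, $W=S\,H_2$ for (3); $C=W=S$ for each round of (4), including the final one. * *Memory:* the CPU-side memory footprint is at most $A\,c\,S$ at all times. -/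

import Mathlib

namespace PimTree

/-! ### The Processing-in-Memory model

A host CPU and `P` PIM modules compute in bulk-synchronous rounds. In a round the host sends a
buffer of tasks to every module, every module runs its tasks on its own local memory, and the host
gathers the replies. The modules do not talk to each other. -/

/-- The program of a PIM module: the reply to a task, as a function of the local memory of that
module only, with the number of steps it takes; and the lengths of tasks and replies in words. -/
structure ModuleCode (Mem Task Reply : Type*) where
  reply : Mem → Task → Reply
  steps : Mem → Task → ℕ
  taskWords : Task → ℕ
  replyWords : Reply → ℕ

/-- The host program, with CPU-side variables in `σ`. `calls s` are the tasks (each with the module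
it is sent to) of the next round, or `none` when the program has finished; `receive` computes the
new variables from the old ones and the replies to the tasks of this round; `words s` is the
number of words that the variables occupy. -/
structure HostCode (P : ℕ) (Task Reply σ : Type*) where
  init : σ
  calls : σ → Option (Multiset (Fin P × Task))
  receive : σ → (Fin P × Task → Option Reply) → σ
  words : σ → ℕ

section Execution

variable {P : ℕ} {Mem Task Reply σ : Type*} [DecidableEq Task]

/-- What the host gathers in a round: the replies to the tasks it has sent, and nothing else. -/
def gather (C : ModuleCode Mem Task Reply) (mem : Fin P → Mem)
    (cs : Multiset (Fin P × Task)) : Fin P × Task → Option Reply :=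
  fun c => if c ∈ cs then some (C.reply (mem c.1) c.2) else none

/-- The CPU-side variables after `k` rounds (the local memories are not modified by a query). -/
def stateAfter (H : HostCode P Task Reply σ) (C : ModuleCode Mem Task Reply)
    (mem : Fin P → Mem) : ℕ → σ
  | 0 => H.init
  | k + 1 =>
    match H.calls (stateAfter H C mem k) with
    | none => stateAfter H C mem k
    | some cs => H.receive (stateAfter H C mem k) (gather C mem cs)

/-- The tasks sent in round `k` (rounds are numbered from `0`). -/
def callsAt (H : HostCode P Task Reply σ) (C : ModuleCode Mem Task Reply)
    (mem : Fin P → Mem) (k : ℕ) : Multiset (Fin P × Task) :=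
  (H.calls (stateAfter H C mem k)).getD 0

/-- The communication of module `m` in round `k`: the words sent to it and received from it. -/
def comm (H : HostCode P Task Reply σ) (C : ModuleCode Mem Task Reply)
    (mem : Fin P → Mem) (k : ℕ) (m : Fin P) : ℕ :=
  (((callsAt H C mem k).filter (fun c => c.1 = m)).map
    (fun c => C.taskWords c.2 + C.replyWords (C.reply (mem m) c.2))).sum

/-- The work of module `m` in round `k`. -/
def work (H : HostCode P Task Reply σ) (C : ModuleCode Mem Task Reply)
    (mem : Fin P → Mem) (k : ℕ) (m : Fin P) : ℕ :=
  (((callsAt H C mem k).filter (fun c => c.1 = m)).map (fun c => C.steps (mem m) c.2)).sum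

/-- The words of CPU-side memory in use in round `k`: the variables of the host program and the
task and reply buffers of all modules. -/
def footprint (H : HostCode P Task Reply σ) (C : ModuleCode Mem Task Reply)
    (mem : Fin P → Mem) (k : ℕ) : ℕ :=
  H.words (stateAfter H C mem k) + ∑ m, comm H C mem k m

/-- The execution consists of exactly `R` rounds. -/
def HaltsAfter (H : HostCode P Task Reply σ) (C : ModuleCode Mem Task Reply)
    (mem : Fin P → Mem) (R : ℕ) : Prop :=
  (∀ k < R, H.calls (stateAfter H C mem k) ≠ none) ∧ H.calls (stateAfter H C mem R) = none

end Execution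

/-! ### B+-trees -/

/-- Trees of height `h` all of whose leaves are at the same depth. An inner node is a list of
separators with subtrees, a leaf a list of keys with their entries. -/
def BPTree (κ α : Type*) : ℕ → Type _
  | 0 => List (κ × α)
  | h + 1 => List (κ × BPTree κ α h)

/-- Search inside one node: the entry of the last key that is at most `q`. -/
def lookup {κ α : Type*} [LinearOrder κ] (q : κ) (l : List (κ × α)) : Option α :=
  ((l.filter (fun e => e.1 ≤ q)).getLast?).map Prod.snd

namespace BPTree

variable {κ α : Type*}

/-- All entries at the leaves, from left to right. -/
def leaves : (h : ℕ) → BPTree κ α h → List (κ × α)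
  | 0, (l : List (κ × α)) => l
  | h + 1, (l : List (κ × BPTree κ α h)) => l.flatMap (fun c => leaves h c.2)

/-- Every node has between `lo` and `hi` children (leaves: entries). -/
def Filled (lo hi : ℕ) : (h : ℕ) → BPTree κ α h → Prop
  | 0, (l : List (κ × α)) => lo ≤ l.length ∧ l.length ≤ hi
  | h + 1, (l : List (κ × BPTree κ α h)) =>
    lo ≤ l.length ∧ l.length ≤ hi ∧ ∀ c ∈ l, Filled lo hi h c.2

/-- Every separator is the first key below it. -/
def Separated : (h : ℕ) → BPTree κ α h → Prop
  | 0, _ => True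
  | h + 1, (l : List (κ × BPTree κ α h)) =>
    ∀ c ∈ l, (leaves h c.2).head?.map Prod.fst = some c.1 ∧ Separated h c.2

/-- The occupancy rule of a B+-tree of fanout `B`: at most `B` children everywhere, at least
`⌈B / 2⌉` outside the root, and at least two at a root that is not a leaf. -/
def Occupancy (B : ℕ) : (h : ℕ) → BPTree κ α h → Prop
  | 0, (l : List (κ × α)) => l.length ≤ B
  | h + 1, (l : List (κ × BPTree κ α h)) =>
    2 ≤ l.length ∧ l.length ≤ B ∧ ∀ c ∈ l, Filled ((B + 1) / 2) B h c.2

/-- Search from the root down to a leaf; it visits `h + 1` nodes. -/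
def search [LinearOrder κ] (q : κ) : (h : ℕ) → BPTree κ α h → Option α
  | 0, (l : List (κ × α)) => lookup q l
  | h + 1, (l : List (κ × BPTree κ α h)) => (lookup q l).bind (search q h)

end BPTree

/-! ### The PIM-tree -/

/-- The number of L1 levels, `log_B log_B P` rounded up, and at least one. -/
def l1Height (B P : ℕ) : ℕ := max 1 (Nat.clog B (Nat.clog B P))

/-- The number of L2 levels, `log_B P - log_B log_B P` up to rounding, and at least one. -/
def l2Height (B P : ℕ) : ℕ := max 1 (Nat.clog B P - l1Height B P)

/-- The number of levels of L1 and L2 together. -/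
def height (B P : ℕ) : ℕ := l1Height B P + l2Height B P

/-- The stored keys and the sentinel `-∞`. -/
def slots {K : Type*} [LinearOrder K] (D : Finset K) : Finset (WithBot K) :=
  insert ⊥ (D.image WithBot.some)

abbrev Slot {K : Type*} [LinearOrder K] (D : Finset K) : Type _ := {x // x ∈ slots D}

/-- The random choices of the PIM-tree on the key set `D`, all of them independent and uniform:
for every key, a sequence of `B`-sided dice that decide how high it goes in the skip list, and for
every possible node, given by its level and its pivot, the PIM module that hosts it. -/
abbrev Sample {K : Type*} [LinearOrder K] (D : Finset K) (P B : ℕ) : Type _ :=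
  (Slot D → Fin (height B P) → Fin B) × (Fin (height B P + 1) → Slot D → Fin P)

/-- Probability under the uniform distribution on a finite sample space. -/
noncomputable def prob {Ω : Type*} (E : Set Ω) : ℝ := (E.ncard : ℝ) / (Nat.card Ω : ℝ)

/-- The name of a node: its level and its pivot. Level `0` consists of the data nodes, the levels
`1, …, l1Height` form L1 and the next `l2Height` levels form L2. -/
abbrev Addr {K : Type*} [LinearOrder K] (D : Finset K) (P B : ℕ) : Type _ :=
  Fin (height B P + 1) × Slot D

/-- A PIM pointer: the PIM ID of the host of a node and the address of the node. -/
abbrev Ptr {K : Type*} [LinearOrder K] (D : Finset K) (P B : ℕ) : Type _ :=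
  Fin P × Addr D P B

instance {K : Type*} [LinearOrder K] (D : Finset K) (P B : ℕ) : DecidableEq (Ptr D P B) :=
  inferInstance

/-- A chunk: keys in increasing order, with pointers to nodes of the level below. -/
abbrev Chunk {K : Type*} [LinearOrder K] (D : Finset K) (P B : ℕ) : Type _ :=
  List (WithBot K × Ptr D P B)

/-- L3: a B+-tree with pointers to L2 nodes. -/
abbrev L3Tree {K : Type*} [LinearOrder K] (D : Finset K) (P B : ℕ) : Type _ :=
  (h : ℕ) × BPTree (WithBot K) (Ptr D P B) h

section Tree

variable {K V : Type*} [LinearOrder K] {D : Finset K} {P B : ℕ}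

def botSlot (D : Finset K) : Slot D := ⟨⊥, Finset.mem_insert_self _ _⟩

/-- The key `x` goes up at least `t` levels: its first `t` dice all show `0`, each of which has
probability `1 / B`. The sentinel goes all the way up. -/
def Reaches (ω : Sample D P B) (t : ℕ) (x : Slot D) : Prop :=
  x.1 = ⊥ ∨ ∀ i : Fin (height B P), i.1 < t → (ω.1 x i).1 = 0

instance (ω : Sample D P B) (t : ℕ) (x : Slot D) : Decidable (Reaches ω t x) := by
  unfold Reaches; infer_instance

def pointer (ω : Sample D P B) (a : Addr D P B) : Ptr D P B := (ω.2 a.1 a.2, a)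

/-- There is a chunk of level `t ≥ 1` for every key that goes up at least `t` levels. -/
def IsChunk (ω : Sample D P B) (a : Addr D P B) : Prop := 1 ≤ a.1.1 ∧ Reaches ω a.1.1 a.2

instance (ω : Sample D P B) (a : Addr D P B) : Decidable (IsChunk ω a) := by
  unfold IsChunk; infer_instance

/-- The key `x` lies in the range of the chunk `a`, which extends from its pivot to the next pivot
of the same level (exclusive). -/
def InRange (ω : Sample D P B) (a : Addr D P B) (x : Slot D) : Prop :=
  a.2 ≤ x ∧ ∀ y : Slot D, a.2 < y → y ≤ x → ¬ Reaches ω a.1.1 y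

instance (ω : Sample D P B) (a : Addr D P B) (x : Slot D) : Decidable (InRange ω a x) := by
  unfold InRange; infer_instance

/-- The node of the level below with pivot `x`. -/
def below (a : Addr D P B) (x : Slot D) : Addr D P B :=
  (⟨a.1.1 - 1, lt_of_le_of_lt (Nat.sub_le _ _) a.1.2⟩, x)

/-- The contents of the chunk `a` of level `t`: the keys in its range that go up at least `t - 1`
levels, each with the pointer to the node below of which it is the pivot. -/
def chunk (ω : Sample D P B) (a : Addr D P B) : Chunk D P B :=
  ((Finset.univ.filter (fun x : Slot D => Reaches ω (a.1.1 - 1) x ∧ InRange ω a x)).sort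
    (· ≤ ·)).map (fun x => (x.1, pointer ω (below a x)))

/-- The tree `T` is a B+-tree of fanout `B` on the keys that go up all the levels of L1 and L2,
with pointers to the topmost chunks of L2. -/
def IsL3 (ω : Sample D P B) (T : L3Tree D P B) : Prop :=
  BPTree.leaves T.1 T.2 =
      ((Finset.univ.filter (fun x : Slot D => Reaches ω (height B P) x)).sort (· ≤ ·)).map
        (fun x => (x.1, pointer ω (Fin.last _, x))) ∧
    BPTree.Separated T.1 T.2 ∧ BPTree.Occupancy B T.1 T.2

/-- The local memory of a PIM module: a replica of L3, the L1 and L2 chunks hosted by the module,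
the shadow subtrees of the hosted L2 chunks (`shadow r v` is the copy of the chunk `v` stored with
the chunk `r`), and the hosted data nodes. -/
structure LocalMem (V : Type*) {K : Type*} [LinearOrder K] (D : Finset K) (P B : ℕ) where
  l3 : L3Tree D P B
  chunk : Addr D P B → Option (Chunk D P B)
  shadow : Addr D P B → Addr D P B → Option (Chunk D P B)
  data : Addr D P B → Option (Option (K × V))

/-- The address belongs to L2. -/
def InL2 (a : Addr D P B) : Prop := l1Height B P < a.1.1

instance (a : Addr D P B) : Decidable (InL2 a) := by unfold InL2; infer_instance

/-- The local memories of the PIM-tree with values `val`. The shadow subtree of an L2 chunk `r`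
holds copies of all L2 chunks in the search subtree of `r`. The data node of the sentinel is
empty. -/
def memory (val : K → V) (ω : Sample D P B) (T : L3Tree D P B) (m : Fin P) :
    LocalMem V D P B where
  l3 := T
  chunk a := if IsChunk ω a ∧ ω.2 a.1 a.2 = m then some (chunk ω a) else none
  shadow r v :=
    if IsChunk ω r ∧ ω.2 r.1 r.2 = m ∧ InL2 r ∧
        IsChunk ω v ∧ InL2 v ∧ v.1 ≤ r.1 ∧ InRange ω r v.2 then
      some (chunk ω v)
    else none
  data a :=
    if a.1.1 = 0 ∧ ω.2 a.1 a.2 = m then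
      some (WithBot.recBotCoe (C := fun _ => Option (K × V)) none
        (fun x => some (x, val x)) a.2.1)
    else none

end Tree

/-! ### The program of the PIM modules -/

section Module

variable {K V : Type*} [LinearOrder K] {D : Finset K} {P B : ℕ}

/-- The tasks of a PIM module: search a key in L3; search a key in one hosted chunk (Push);
return a hosted chunk (Pull); search a key in the shadow subtree of a hosted L2 chunk; return a
hosted data node. -/
inductive Task {K : Type*} [LinearOrder K] (D : Finset K) (P B : ℕ) where
  | searchL3 (q : K)
  | push (q : K) (a : Addr D P B)
  | pull (a : Addr D P B)
  | searchL2 (q : K) (a : Addr D P B)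
  | fetch (a : Addr D P B)
  deriving DecidableEq

inductive Reply (V : Type*) {K : Type*} [LinearOrder K] (D : Finset K) (P B : ℕ) where
  | ptr (p : Ptr D P B)
  | chunk (c : Chunk D P B)
  | data (d : Option (K × V))
  | fail

/-- Follow pointers through local copies of chunks, as long as there are copies (at most `fuel`
of them); the result is the last pointer and the number of chunks visited. -/
def walk (copies : Addr D P B → Option (Chunk D P B)) (q : K) :
    ℕ → Ptr D P B → Ptr D P B × ℕ
  | 0, p => (p, 0)
  | fuel + 1, p =>
    match (copies p.2).bind (lookup (q : WithBot K)) with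
    | none => (p, 0)
    | some p' => ((walk copies q fuel p').1, (walk copies q fuel p').2 + 1)

/-- Send a pointer back, if there is one. -/
def Reply.ofPtr : Option (Ptr D P B) → Reply V D P B
  | some p => .ptr p
  | none => .fail

/-- One step is counted for receiving a task, for searching one node, and for every entry of a
chunk that is sent back. A key, a value, a PIM ID and a task code are one word each, an address is
two words (level and pivot). -/
def moduleCode (V : Type*) (D : Finset K) (P B : ℕ) :
    ModuleCode (Fin P × LocalMem V D P B) (Task D P B) (Reply V D P B) where
  reply M t := match t with
    | .searchL3 q => .ofPtr (BPTree.search (q : WithBot K) M.2.l3.1 M.2.l3.2)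
    | .push q a => .ofPtr ((M.2.chunk a).bind (lookup (q : WithBot K)))
    | .pull a => ((M.2.chunk a).map Reply.chunk).getD .fail
    | .searchL2 q a => .ptr (walk (M.2.shadow a) q (height B P) (M.1, a)).1
    | .fetch a => ((M.2.data a).map Reply.data).getD .fail
  steps M t := match t with
    | .searchL3 _ => 1 + (M.2.l3.1 + 1)
    | .push _ _ => 2
    | .pull a => 1 + ((M.2.chunk a).map List.length).getD 0
    | .searchL2 q a => 1 + (walk (M.2.shadow a) q (height B P) (M.1, a)).2
    | .fetch _ => 2
  taskWords t := match t with
    | .searchL3 _ => 2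
    | .push _ _ => 4
    | .pull _ => 3
    | .searchL2 _ _ => 4
    | .fetch _ => 3
  replyWords r := match r with
    | .ptr _ => 3
    | .chunk c => 1 + 4 * c.length
    | .data _ => 2
    | .fail => 1

end Module

/-! ### The batch Predecessor algorithm on the host -/

section Host

variable {K V : Type*} [LinearOrder K] {D : Finset K} {P B S : ℕ}

/-- The CPU-side variables: the current pointer of every query, with the stage of the algorithm
(`l1 r cur`: `r` rounds of the traversal of L1 are done), and finally the results. -/
inductive HostState (V : Type*) {K : Type*} [LinearOrder K] (D : Finset K) (P B S : ℕ) where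
  | start
  | l2 (cur : Fin S → Ptr D P B)
  | l1 (r : ℕ) (cur : Fin S → Ptr D P B)
  | data (cur : Fin S → Ptr D P B)
  | done (out : Fin S → Option (K × V))

/-- The nodes with more than `θ` queries. -/
def hot (θ : ℕ) (cur : Fin S → Ptr D P B) : Finset (Ptr D P B) :=
  (Finset.univ.image cur).filter
    (fun p => θ < (Finset.univ.filter (fun i => cur i = p)).card)

/-- The L2 nodes with more than `K = B * l2Height` queries. -/
def hotL2 (cur : Fin S → Ptr D P B) : Finset (Ptr D P B) :=
  (hot (B * l2Height B P) cur).filter (fun p => InL2 p.2)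

/-- The number of queries that would be sent to module `m` for L2. -/
def load (cur : Fin S → Ptr D P B) (m : Fin P) : ℕ :=
  (Finset.univ.filter (fun i => InL2 (cur i).2 ∧ (cur i).1 = m)).card

/-- The condition for another Pull round in L2: the busiest module would get more than three times
the average load, and there is something to pull. -/
def Pulling (cur : Fin S → Ptr D P B) : Prop :=
  (∃ m, 3 * ∑ j, load cur j < P * load cur m) ∧ (hotL2 cur).Nonempty

instance (cur : Fin S → Ptr D P B) : Decidable (Pulling cur) := by
  unfold Pulling; infer_instance

def pullCall (p : Ptr D P B) : Fin P × Task D P B := (p.1, .pull p.2)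

/-- The pointer that comes back for a pushed query (the default `p` is never used). -/
def ptrOr (p : Ptr D P B) : Option (Reply V D P B) → Ptr D P B
  | some (.ptr p') => p'
  | _ => p

/-- The next pointer for a query, found on the CPU side in a pulled chunk (the default `p` is
never used). -/
def cpuStep (q : K) (p : Ptr D P B) : Option (Reply V D P B) → Ptr D P B
  | some (.chunk c) => (lookup (q : WithBot K) c).getD p
  | _ => p

/-- The retrieved data (the default `none` is never used for other replies). -/
def dataOf : Option (Reply V D P B) → Option (K × V)
  | some (.data d) => d
  | _ => none

/-- The tasks of the next round.
* L3: distribute the queries evenly over the modules and search L3.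
* L2, Pull round: pull all L2 nodes with more than `B * l2Height` queries. This is repeated as long
  as the load is not balanced.
* L2, Push round: push every query to the host of its L2 node, to be searched through L2 using the
  shadow subtree.
* L1, Push-Pull round with threshold `B`, `l1Height` times: pull the nodes with more than `B`
  queries, push the other queries.
* Data nodes: retrieve each of them once. -/
def predCalls [NeZero P] (Q : Fin S → K) :
    HostState V D P B S → Option (Multiset (Fin P × Task D P B))
  | .start => some (Finset.univ.val.map (fun i : Fin S => (Fin.ofNat P i.1, .searchL3 (Q i))))
  | .l2 cur =>
    if Pulling cur then some ((hotL2 cur).val.map pullCall)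
    else some ((Finset.univ.filter (fun i => InL2 (cur i).2)).val.map
      (fun i => ((cur i).1, .searchL2 (Q i) (cur i).2)))
  | .l1 _ cur =>
    some ((hot B cur).val.map pullCall +
      (Finset.univ.filter (fun i : Fin S => cur i ∉ hot B cur)).val.map
        (fun i => ((cur i).1, .push (Q i) (cur i).2)))
  | .data cur => some ((Finset.univ.image cur).val.map (fun p => (p.1, .fetch p.2)))
  | .done _ => none

/-- What the host does with the replies: one step of pointer chasing (several for a search in L3
or in a shadow subtree) for the queries that take part in the round. -/
def predReceive [NeZero P] (Q : Fin S → K) (s : HostState V D P B S)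
    (ans : Fin P × Task D P B → Option (Reply V D P B)) : HostState V D P B S :=
  match s with
  | .start =>
    .l2 (fun i => ptrOr (0, (0, botSlot D)) (ans (Fin.ofNat P i.1, .searchL3 (Q i))))
  | .l2 cur =>
    if Pulling cur then
      .l2 (fun i =>
        if cur i ∈ hotL2 cur then cpuStep (Q i) (cur i) (ans (pullCall (cur i))) else cur i)
    else
      .l1 0 (fun i =>
        if InL2 (cur i).2 then ptrOr (cur i) (ans ((cur i).1, .searchL2 (Q i) (cur i).2))
        else cur i)
  | .l1 r cur =>
    let cur' : Fin S → Ptr D P B := fun i =>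
      if cur i ∈ hot B cur then cpuStep (Q i) (cur i) (ans (pullCall (cur i)))
      else ptrOr (cur i) (ans ((cur i).1, .push (Q i) (cur i).2))
    if r + 1 < l1Height B P then .l1 (r + 1) cur' else .data cur'
  | .data cur => .done (fun i => dataOf (ans ((cur i).1, .fetch (cur i).2)))
  | .done out => .done out

/-- The size of the CPU-side variables: a stage code and a counter, the query keys, the pointers
(three words each), a table with the number of queries at every current node, the loads of the
modules, and the results. -/
def predWords : HostState V D P B S → ℕ
  | .start => 2 + S
  | .l2 cur => 2 + S + 3 * S + 4 * (Finset.univ.image cur).card + P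
  | .l1 _ cur => 2 + S + 3 * S + 4 * (Finset.univ.image cur).card
  | .data cur => 2 + S + 3 * S + 4 * (Finset.univ.image cur).card
  | .done _ => 2 + S + 2 * S

/-- The batch Predecessor algorithm for the query keys `Q 0, …, Q (S - 1)`. -/
def predecessor [NeZero P] (V : Type*) (D : Finset K) (B : ℕ) (Q : Fin S → K) :
    HostCode P (Task D P B) (Reply V D P B) (HostState V D P B S) where
  init := .start
  calls := predCalls Q
  receive := predReceive Q
  words := predWords

/-- The local memories of all modules. Each module also knows its own PIM ID. -/
def pimMemory (val : K → V) (ω : Sample D P B) (T : L3Tree D P B) :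
    Fin P → Fin P × LocalMem V D P B :=
  fun m => (m, memory val ω T m)

/-- `r` is the correct answer to the query `q`: the stored pair with the largest key that is at
most `q`, or `none` if there is no such key. -/
def IsPredecessor (D : Finset K) (val : K → V) (q : K) : Option (K × V) → Prop
  | none => ∀ x ∈ D, q < x
  | some (x, v) => x ∈ D ∧ x ≤ q ∧ (∀ y ∈ D, y ≤ q → y ≤ x) ∧ v = val x

/-- The total communication, over all modules, allotted to a round that starts in state `s`:
`S / l2Height` for a Pull round in L2, and `S` for every other round. -/
noncomputable def commBudget (s : HostState V D P B S) : ℝ :=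
  match s with
  | .l2 cur => if Pulling cur then (S : ℝ) / l2Height B P else S
  | _ => S

/-- The total work, over all modules, allotted to a round that starts in state `s`, when L3 has
`h3` levels of nodes: one unit per query and level in the traversal of L3 and in the Push round of
L2, `S / l2Height` for a Pull round in L2, and `S` for every other round. -/
noncomputable def workBudget (h3 : ℕ) (s : HostState V D P B S) : ℝ :=
  match s with
  | .start => (S : ℝ) * h3
  | .l2 cur => if Pulling cur then (S : ℝ) / l2Height B P else (S : ℝ) * l2Height B P
  | _ => S

end Host

/-- Load balance of the first `R` rounds of an execution with constant `κ`: in every round, every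
module gets at most `κ` times a `1 / P` share of the communication and of the work of the round. -/
def LoadBalanced {P : ℕ} {Mem Task Reply σ : Type*} [DecidableEq Task]
    (H : HostCode P Task Reply σ) (C : ModuleCode Mem Task Reply) (mem : Fin P → Mem)
    (commB workB : σ → ℝ) (R : ℕ) (κ : ℝ) : Prop :=
  ∀ k < R, ∀ m : Fin P,
    (comm H C mem k m : ℝ) ≤ κ * (commB (stateAfter H C mem k) / P) ∧
      (work H C mem k m : ℝ) ≤ κ * (workB (stateAfter H C mem k) / P)

/-- `max (1, log_B P)`. -/
noncomputable def logBP (B P : ℕ) : ℝ := max 1 (Real.logb B P)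

end PimTree

/-!
The execution of the algorithm is explicit. The node of level `t` on the search path of a key `q`
has as its pivot the largest slot `≤ q` that goes up `t` levels (`pos`), and each kind of search
(in L3, in a chunk, in a shadow subtree) leads from one node of this path to another. In particular
the nodes that are pulled in a round of L2 are all on the same level (`level_of_mem_hotL2`), so
there are at most `l2Height` such rounds; this gives correctness and the number of rounds.

The loads are balanced by two facts.

* Pushed queries and data nodes. The set of current nodes and their numbers of queries depend only
  on the dice, so that, given the dice, the nodes are balls with weights `≤ θ` and total weight
  `≤ S` in independent uniform bins. An exponential moment bounds the load of a module by
  `O(c S / P)`, since `S / (θ P) = Ω(log P)` (`prob_hostedWeight_le`).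
* Pulled chunks. Which chunks have more than `θ` queries depends on the dice that also decide their
  lengths, and long chunks are more likely to be chosen. Therefore every `θ`-th query in sorted
  order is marked: there are at most `S / θ` marks, they do not depend on the random choices, and
  every chunk with more than `θ` queries contains one (`exists_marks`). The length of a marked gap
  is covered by the part above its first mark and the part below its last mark. Both parts are
  explored one key at a time, from the left and from the right, and a potential is used: an
  exponential in the count so far, which does not grow on average, except for a factor
  `1 + 2 / P` at each mark, since a new gap is hosted by the given module with probability `1 / P`
  (`sum_pow_fwdCount_le`, `sum_pow_bwdCount_le`). This bounds the exponential moment, at scale `B`,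
  of the total length of pulled chunks in a module by `(1 + 2 / P) ^ (S / θ)`
  (`prob_pulledLength_le`).

There are at most `P ^ 6` events of these kinds, and each of them fails with probability at most
`P ^ (-7 c)` (`prob_balanced_ge`). The bounds for the memory and the total communication follow from
the load balance by summation.
-/

namespace PimTree

/-! ### Searching in sorted lists and in B+-trees -/

section Lookup

variable {κ α : Type*} [LinearOrder κ]

theorem lookup_append (q : κ) (l₁ l₂ : List (κ × α)) :
    lookup q (l₁ ++ l₂) = (lookup q l₂).or (lookup q l₁) := by
  simp only [lookup, List.filter_append, List.getLast?_append]
  cases (l₂.filter (fun e => e.1 ≤ q)).getLast? <;> simp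

theorem lookup_eq_none_of_forall_lt {q : κ} {l : List (κ × α)} (h : ∀ e ∈ l, q < e.1) :
    lookup q l = none := by
  have : l.filter (fun e => e.1 ≤ q) = [] := by
    rw [List.filter_eq_nil_iff]
    intro e he
    simpa using h e he
  simp [lookup, this]

theorem lookup_eq_some {q : κ} {l : List (κ × α)}
    (hl : l.Pairwise (fun e f => e.1 < f.1)) {k : κ} {v : α} (hm : (k, v) ∈ l) (hk : k ≤ q)
    (hmax : ∀ e ∈ l, e.1 ≤ q → e.1 ≤ k) : lookup q l = some v := by
  obtain ⟨l₁, l₂, rfl⟩ := List.append_of_mem hm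
  have h2 : lookup q l₂ = none := by
    apply lookup_eq_none_of_forall_lt
    intro e he
    have h3 : k < e.1 := by
      have := (List.pairwise_append.1 hl).2.1
      exact (List.pairwise_cons.1 this).1 e he
    by_contra hq
    exact absurd (hmax e (by simp [he]) (not_lt.1 hq)) (not_le.2 h3)
  have h1 : lookup q [(k, v)] = some v := by simp [lookup, hk]
  rw [← List.singleton_append, lookup_append, lookup_append, h2, h1]
  simp

/-- Searching a B+-tree is the same as searching the list of all entries at its leaves. -/
theorem BPTree.search_eq_lookup (q : κ) : ∀ (h : ℕ) (T : BPTree κ α h),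
    (leaves h T).Pairwise (fun e f => e.1 < f.1) → Separated h T →
      search q h T = lookup q (leaves h T)
  | 0, _, _, _ => rfl
  | h + 1, (l : List (κ × BPTree κ α h)), hl, hs => by
    change (l.flatMap (fun c => leaves h c.2)).Pairwise _ at hl
    change ∀ c ∈ l, (leaves h c.2).head?.map Prod.fst = some c.1 ∧ Separated h c.2 at hs
    change (lookup q l).bind (search q h) = lookup q (l.flatMap (fun c => leaves h c.2))
    induction l using List.reverseRecOn with
    | nil => rfl
    | append_singleton l c ih =>
      rw [List.flatMap_append, List.pairwise_append] at hl
      obtain ⟨hl1, hl2, -⟩ := hl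
      have ihl := ih hl1 (fun c hc => hs c (by simp [hc]))
      obtain ⟨hc, hcs⟩ := hs c (by simp)
      simp only [List.flatMap_cons, List.flatMap_nil, List.append_nil] at hl2
      have hsc := search_eq_lookup q h c.2 hl2 hcs
      rw [lookup_append, List.flatMap_append, lookup_append]
      simp only [List.flatMap_cons, List.flatMap_nil, List.append_nil]
      obtain ⟨e, r, hr⟩ : ∃ e r, leaves h c.2 = e :: r := by
        cases hcc : leaves h c.2 with
        | nil => simp [hcc] at hc
        | cons e r => exact ⟨e, r, rfl⟩
      have hec : e.1 = c.1 := by simpa [hr] using hc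
      by_cases hq : c.1 ≤ q
      · have h1 : lookup q [c] = some c.2 := by simp [lookup, hq]
        rw [h1, Option.some_or, Option.bind_some, hsc, hr]
        have h2 : ∃ v, lookup q (e :: r) = some v := by
          rw [← Option.isSome_iff_exists]
          simp only [lookup, Option.isSome_map, List.getLast?_isSome]
          rw [List.filter_cons_of_pos (by simpa [hec] using hq)]
          simp
        obtain ⟨v, hv⟩ := h2
        simp [hv]
      · have h1 : lookup q [c] = none := by
          apply lookup_eq_none_of_forall_lt; simpa using hq
        have h2 : lookup q (leaves h c.2) = none := by
          apply lookup_eq_none_of_forall_lt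
          intro f hf
          rw [hr] at hf hl2
          rw [not_le, ← hec] at hq
          rcases List.mem_cons.1 hf with rfl | hf
          · exact hq
          · exact hq.trans ((List.pairwise_cons.1 hl2).1 f hf)
        rw [h1, h2, Option.none_or, Option.none_or, ihl]

end Lookup

/-! ### The search path of a key -/

section Path

variable {K V : Type*} [LinearOrder K] {D : Finset K} {P B S : ℕ}

theorem lookup_sort {α : Type*} {s : Finset (Slot D)} {g : Slot D → α} {q : WithBot K}
    {x : Slot D} (hx : x ∈ s) (hq : x.1 ≤ q) (hmax : ∀ y ∈ s, y.1 ≤ q → y ≤ x) :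
    lookup q ((s.sort (· ≤ ·)).map (fun x => (x.1, g x))) = some (g x) := by
  refine lookup_eq_some (k := x.1) ?_ ?_ hq ?_
  · rw [List.pairwise_map]
    exact (Finset.sortedLT_sort s).pairwise
  · exact List.mem_map.2 ⟨x, by simpa using hx, rfl⟩
  · intro e he
    obtain ⟨y, hy, rfl⟩ := List.mem_map.1 he
    exact fun h => hmax y (by simpa using hy) h

theorem botSlot_le (x : Slot D) : botSlot D ≤ x := by
  change (⊥ : WithBot K) ≤ x.1
  exact bot_le

theorem reaches_botSlot (ω : Sample D P B) (t : ℕ) : Reaches ω t (botSlot D) := Or.inl rfl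

theorem Reaches.mono {ω : Sample D P B} {s t : ℕ} (h : s ≤ t) {x : Slot D}
    (hx : Reaches ω t x) : Reaches ω s x :=
  hx.imp id (fun H i hi => H i (hi.trans_le h))

theorem reaches_zero (ω : Sample D P B) (x : Slot D) : Reaches ω 0 x :=
  Or.inr (fun _ hi => absurd hi (Nat.not_lt_zero _))

/-- The pivot of the chunk of level `t` whose range contains the key `q`: the largest slot
`≤ q` that goes up at least `t` levels. It depends only on the dice. -/
def pos (ω : Sample D P B) (t : ℕ) (q : K) : Slot D :=
  (Finset.univ.filter (fun x : Slot D => Reaches ω t x ∧ x.1 ≤ (q : WithBot K))).max'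
    ⟨botSlot D, by simpa using ⟨reaches_botSlot ω t, bot_le⟩⟩

theorem pos_spec (ω : Sample D P B) (t : ℕ) (q : K) :
    Reaches ω t (pos ω t q) ∧ (pos ω t q).1 ≤ (q : WithBot K) := by
  have := Finset.max'_mem
    (Finset.univ.filter (fun x : Slot D => Reaches ω t x ∧ x.1 ≤ (q : WithBot K)))
    ⟨botSlot D, by simpa using ⟨reaches_botSlot ω t, bot_le⟩⟩
  exact (Finset.mem_filter.1 this).2

theorem pos_reaches (ω : Sample D P B) (t : ℕ) (q : K) : Reaches ω t (pos ω t q) :=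
  (pos_spec ω t q).1

theorem pos_le (ω : Sample D P B) (t : ℕ) (q : K) : (pos ω t q).1 ≤ (q : WithBot K) :=
  (pos_spec ω t q).2

theorem le_pos {ω : Sample D P B} {t : ℕ} {q : K} {x : Slot D} (h : Reaches ω t x)
    (hq : x.1 ≤ (q : WithBot K)) : x ≤ pos ω t q :=
  Finset.le_max' _ _ (by simpa using ⟨h, hq⟩)

theorem pos_antitone {ω : Sample D P B} {s t : ℕ} (h : s ≤ t) (q : K) :
    pos ω t q ≤ pos ω s q :=
  le_pos ((pos_reaches ω t q).mono h) (pos_le ω t q)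

theorem pos_monotone (ω : Sample D P B) (t : ℕ) {q q' : K} (h : q ≤ q') :
    pos ω t q ≤ pos ω t q' :=
  le_pos (pos_reaches ω t q) ((pos_le ω t q).trans (WithBot.coe_le_coe.2 h))

theorem pointer_inj {ω : Sample D P B} {a b : Addr D P B} :
    pointer ω a = pointer ω b ↔ a = b :=
  ⟨fun h => congrArg Prod.snd h, fun h => h ▸ rfl⟩

/-- The pointer to the node of level `t` on the search path of the key `q`. -/
def cursor (ω : Sample D P B) (t : Fin (height B P + 1)) (q : K) : Ptr D P B :=
  pointer ω (t, pos ω t q)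

theorem cursor_snd (ω : Sample D P B) (t : Fin (height B P + 1)) (q : K) :
    (cursor ω t q).2 = (t, pos ω t q) := rfl

theorem cursor_inj {ω : Sample D P B} {s t : Fin (height B P + 1)} {q q' : K} :
    cursor ω s q = cursor ω t q' ↔ s = t ∧ pos ω s q = pos ω t q' := by
  rw [cursor, cursor, pointer_inj, Prod.mk.injEq]

/-- The level below. -/
def down (t : Fin (height B P + 1)) : Fin (height B P + 1) :=
  ⟨t.1 - 1, lt_of_le_of_lt (Nat.sub_le _ _) t.2⟩

theorem inRange_pos (ω : Sample D P B) {s : ℕ} {t : Fin (height B P + 1)} (h : s ≤ t.1) (q : K) :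
    InRange ω (t, pos ω t q) (pos ω s q) :=
  ⟨pos_antitone h q, fun _ hy hy' hr =>
    absurd (le_pos hr (le_trans (Subtype.coe_le_coe.2 hy') (pos_le ω s q))) (not_le.2 hy)⟩

theorem isChunk_pos (ω : Sample D P B) {t : Fin (height B P + 1)} (h : 1 ≤ t.1) (q : K) :
    IsChunk ω (t, pos ω t q) := ⟨h, pos_reaches ω t q⟩

/-- Searching the chunk of level `t` on the search path leads to the next node of the path. -/
theorem lookup_chunk (ω : Sample D P B) (t : Fin (height B P + 1)) (q : K) :
    lookup (q : WithBot K) (chunk ω (t, pos ω t q)) = some (cursor ω (down t) q) := by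
  refine lookup_sort (g := fun x => pointer ω (below (t, pos ω t q) x))
    (x := pos ω (t.1 - 1) q) ?_ (pos_le _ _ _) ?_
  · simpa using ⟨pos_reaches ω (t.1 - 1) q, inRange_pos ω (Nat.sub_le _ _) q⟩
  · intro y hy hq
    exact le_pos (Finset.mem_filter.1 hy).2.1 hq

theorem search_l3 {ω : Sample D P B} {T : L3Tree D P B} (hT : IsL3 ω T) (q : K) :
    BPTree.search (q : WithBot K) T.1 T.2 = some (cursor ω (Fin.last _) q) := by
  obtain ⟨h1, h2, -⟩ := hT
  rw [BPTree.search_eq_lookup _ _ _ _ h2, h1]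
  · refine lookup_sort (g := fun x => pointer ω (Fin.last _, x)) (x := pos ω (height B P) q) ?_
      (pos_le _ _ _) ?_
    · simpa using pos_reaches ω (height B P) q
    · intro y hy hq
      exact le_pos (Finset.mem_filter.1 hy).2 hq
  · rw [h1, List.pairwise_map]
    exact (Finset.sortedLT_sort _).pairwise

theorem memory_chunk (val : K → V) (ω : Sample D P B) (T : L3Tree D P B)
    {t : Fin (height B P + 1)} (h : 1 ≤ t.1) (q : K) :
    (memory val ω T (cursor ω t q).1).chunk (t, pos ω t q) = some (chunk ω (t, pos ω t q)) := by
  simp [memory, isChunk_pos ω h q, cursor, pointer]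

theorem one_le_l1Height : 1 ≤ l1Height B P := le_max_left _ _

theorem one_le_l2Height : 1 ≤ l2Height B P := le_max_left _ _

/-- The search of the shadow subtree of a chunk on the search path ends at the node of the path
on the highest level of L1. -/
theorem walk_shadow (val : K → V) (ω : Sample D P B) (T : L3Tree D P B) (q : K)
    {t : Fin (height B P + 1)} (ht : l1Height B P < t.1) :
    ∀ (fuel : ℕ) (s : Fin (height B P + 1)), s ≤ t → l1Height B P ≤ s.1 →
      s.1 - l1Height B P ≤ fuel →
      walk ((memory val ω T (cursor ω t q).1).shadow (t, pos ω t q)) q fuel (cursor ω s q) =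
        (cursor ω ⟨l1Height B P, ht.trans t.2⟩ q, s.1 - l1Height B P)
  | 0, s, _, hs, hf => by
    have : s = ⟨l1Height B P, ht.trans t.2⟩ := Fin.ext (by simp; omega)
    subst this
    simp [walk]
  | fuel + 1, s, hst, hs, hf => by
    by_cases h : s.1 = l1Height B P
    · have : s = ⟨l1Height B P, ht.trans t.2⟩ := Fin.ext h
      subst this
      simp [walk, memory, cursor_snd, InL2]
    · have h1 : l1Height B P < s.1 := lt_of_le_of_ne hs (Ne.symm h)
      have h0 : 1 ≤ s.1 := by omega
      have h2 : ((memory val ω T (cursor ω t q).1).shadow (t, pos ω t q) (cursor ω s q).2) =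
          some (chunk ω (s, pos ω s q)) := by
        have hc := isChunk_pos ω h0 q
        have hc' := isChunk_pos ω (t := t) (by omega) q
        have hr := inRange_pos ω (s := s.1) (t := t) hst q
        simp [memory, hc, hc', InL2, h1, ht, hst, hr, cursor, pointer]
      have hd : (down s).1 = s.1 - 1 := rfl
      have ih := walk_shadow val ω T q ht fuel (down s)
        (le_trans (Fin.le_def.2 (by omega)) hst) (by omega) (by omega)
      rw [walk, h2, Option.bind_some, lookup_chunk]
      simp only [ih]
      rw [hd]
      congr 1
      omega

end Path
/-! ### The execution of the batch algorithm -/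

section Execution

variable {K V : Type*} [LinearOrder K] {D : Finset K} {P B S : ℕ}

theorem card_cursor_eq {ω : Sample D P B} {Q : Fin S → K} (lev : Fin S → Fin (height B P + 1))
    (i : Fin S) :
    (Finset.univ.filter (fun j => cursor ω (lev j) (Q j) = cursor ω (lev i) (Q i))).card =
      (Finset.univ.filter (fun j => lev j = lev i ∧ pos ω (lev j) (Q j) = pos ω (lev i) (Q i))).card
    := by
  simp only [cursor_inj]

theorem mem_hot_cursor {ω : Sample D P B} {Q : Fin S → K} {lev : Fin S → Fin (height B P + 1)}
    {θ : ℕ} {i : Fin S} :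
    cursor ω (lev i) (Q i) ∈ hot θ (fun j => cursor ω (lev j) (Q j)) ↔
      θ < (Finset.univ.filter
        (fun j => lev j = lev i ∧ pos ω (lev j) (Q j) = pos ω (lev i) (Q i))).card := by
  rw [← card_cursor_eq, hot, Finset.mem_filter]
  simp

/-- The level of the query `i` after `k` Pull rounds in L2. Whether a node is pulled is expressed
by the number of queries at its name, so that the levels depend only on the dice. -/
def pullLevel (ω : Sample D P B) (Q : Fin S → K) : ℕ → Fin S → Fin (height B P + 1)
  | 0, _ => Fin.last _
  | k + 1, i =>
    if B * l2Height B P < (Finset.univ.filter (fun j =>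
          pullLevel ω Q k j = pullLevel ω Q k i ∧
            pos ω (pullLevel ω Q k j) (Q j) = pos ω (pullLevel ω Q k i) (Q i))).card ∧
        l1Height B P < (pullLevel ω Q k i).1 then
      down (pullLevel ω Q k i)
    else pullLevel ω Q k i

/-- The pointers of the queries after `k` Pull rounds in L2. -/
def pullState (ω : Sample D P B) (Q : Fin S → K) (k : ℕ) : Fin S → Ptr D P B :=
  fun i => cursor ω (pullLevel ω Q k i) (Q i)

theorem mem_hotL2_pullState {ω : Sample D P B} {Q : Fin S → K} {k : ℕ} {i : Fin S} :
    pullState ω Q k i ∈ hotL2 (pullState ω Q k) ↔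
      B * l2Height B P < (Finset.univ.filter (fun j =>
          pullLevel ω Q k j = pullLevel ω Q k i ∧
            pos ω (pullLevel ω Q k j) (Q j) = pos ω (pullLevel ω Q k i) (Q i))).card ∧
        l1Height B P < (pullLevel ω Q k i).1 := by
  rw [hotL2, Finset.mem_filter]
  exact and_congr mem_hot_cursor Iff.rfl

theorem pullLevel_succ (ω : Sample D P B) (Q : Fin S → K) (k : ℕ) (i : Fin S) :
    pullLevel ω Q (k + 1) i = if pullState ω Q k i ∈ hotL2 (pullState ω Q k) then
      down (pullLevel ω Q k i) else pullLevel ω Q k i := by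
  simp only [mem_hotL2_pullState]
  rfl

/-- After `k` Pull rounds, a query is `k` levels below the top, or it stays at a node of a higher
level with few queries. -/
theorem pullLevel_spec (ω : Sample D P B) (Q : Fin S → K) {k : ℕ} (hk : k ≤ l2Height B P)
    (i : Fin S) :
    (pullLevel ω Q k i).1 + k = height B P ∨
      (height B P < (pullLevel ω Q k i).1 + k ∧
        pullState ω Q k i ∉ hotL2 (pullState ω Q k)) := by
  induction k generalizing i with
  | zero => left; rfl
  | succ k ih =>
    have ih := ih (by omega)
    have hh : height B P = l1Height B P + l2Height B P := rfl
    by_cases hi : pullState ω Q k i ∈ hotL2 (pullState ω Q k)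
    · left
      rw [pullLevel_succ, if_pos hi]
      have h1 := (ih i).resolve_right (fun h => h.2 hi)
      have h2 := (mem_hotL2_pullState.1 hi).2
      simp only [down]
      omega
    · right
      have e : pullLevel ω Q (k + 1) i = pullLevel ω Q k i := by rw [pullLevel_succ, if_neg hi]
      have hle : height B P ≤ (pullLevel ω Q k i).1 + k := by
        rcases ih i with h | h <;> omega
      refine ⟨by rw [e]; omega, ?_⟩
      rw [mem_hotL2_pullState] at hi ⊢
      rw [e]
      rintro ⟨h1, h2⟩
      refine hi ⟨h1.trans_le (Finset.card_le_card ?_), h2⟩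
      intro j hj
      simp only [Finset.mem_filter, Finset.mem_univ, true_and] at hj ⊢
      -- a query that has just moved is now on a lower level than the query `i`
      have hj' : pullLevel ω Q (k + 1) j = pullLevel ω Q k j := by
        rw [pullLevel_succ]
        split_ifs with hjh
        · exfalso
          have h3 := (ih j).resolve_right (fun h => h.2 hjh)
          have h4 := (mem_hotL2_pullState.1 hjh).2
          have h5 := hj.1
          rw [pullLevel_succ, if_pos hjh] at h5
          have h6 := congrArg Fin.val h5
          simp only [down] at h6
          omega
        · rfl
      rwa [hj'] at hj

/-- The nodes pulled in a round are all on the same level. -/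
theorem level_of_mem_hotL2 {ω : Sample D P B} {Q : Fin S → K} {k : ℕ} (hk : k ≤ l2Height B P)
    {p : Ptr D P B} (hp : p ∈ hotL2 (pullState ω Q k)) :
    ∃ i, p = pullState ω Q k i ∧ (pullLevel ω Q k i).1 + k = height B P := by
  have h1 := (Finset.mem_filter.1 (Finset.mem_filter.1 hp).1).1
  obtain ⟨i, -, rfl⟩ := Finset.mem_image.1 h1
  exact ⟨i, rfl, (pullLevel_spec ω Q hk i).resolve_right (fun h => h.2 hp)⟩

theorem l1Height_le_pullLevel (ω : Sample D P B) (Q : Fin S → K) {k : ℕ}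
    (hk : k ≤ l2Height B P) (i : Fin S) : l1Height B P ≤ (pullLevel ω Q k i).1 := by
  have hh : height B P = l1Height B P + l2Height B P := rfl
  rcases pullLevel_spec ω Q hk i with h | h <;> omega

theorem hotL2_pullState_l2Height (ω : Sample D P B) (Q : Fin S → K) :
    hotL2 (pullState ω Q (l2Height B P)) = ∅ := by
  rw [Finset.eq_empty_iff_forall_notMem]
  intro p hp
  obtain ⟨i, rfl, hi⟩ := level_of_mem_hotL2 le_rfl hp
  have h := (mem_hotL2_pullState.1 hp).2
  have hh : height B P = l1Height B P + l2Height B P := rfl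
  omega

theorem not_pulling_l2Height (ω : Sample D P B) (Q : Fin S → K) :
    ¬ Pulling (pullState ω Q (l2Height B P)) := fun h => by
  have := h.2
  rw [hotL2_pullState_l2Height] at this
  exact Finset.not_nonempty_empty this

theorem exists_pullRounds (ω : Sample D P B) (Q : Fin S → K) :
    ∃ k, ¬ Pulling (pullState ω Q k) := ⟨_, not_pulling_l2Height ω Q⟩

/-- The number of Pull rounds in L2. -/
def pullRounds (ω : Sample D P B) (Q : Fin S → K) : ℕ := Nat.find (exists_pullRounds ω Q)

theorem pullRounds_le (ω : Sample D P B) (Q : Fin S → K) : pullRounds ω Q ≤ l2Height B P :=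
  Nat.find_min' _ (not_pulling_l2Height ω Q)

theorem not_pulling_pullRounds (ω : Sample D P B) (Q : Fin S → K) :
    ¬ Pulling (pullState ω Q (pullRounds ω Q)) := Nat.find_spec (exists_pullRounds ω Q)

theorem pulling_of_lt {ω : Sample D P B} {Q : Fin S → K} {k : ℕ} (h : k < pullRounds ω Q) :
    Pulling (pullState ω Q k) := not_not.1 (Nat.find_min (exists_pullRounds ω Q) h)

/-- The pointers of the queries when all of them are on the level `t` of L1 (or at the data
nodes, for `t = 0`). -/
def levelState (ω : Sample D P B) (Q : Fin S → K) (t : Fin (height B P + 1)) :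
    Fin S → Ptr D P B := fun i => cursor ω t (Q i)

/-- The level of L1 (or `0`) that is `r` levels below its top. -/
def l1Level (B P r : ℕ) : Fin (height B P + 1) :=
  ⟨l1Height B P - r, by unfold height; omega⟩

/-- The pair stored in the data node of a slot. -/
def entry (val : K → V) (x : Slot D) : Option (K × V) :=
  WithBot.recBotCoe (C := fun _ => Option (K × V)) none (fun x => some (x, val x)) x.1

theorem isPredecessor_entry (val : K → V) (ω : Sample D P B) (q : K) :
    IsPredecessor D val q (entry val (pos ω 0 q)) := by
  have h1 := pos_le ω 0 q
  have h2 : ∀ y ∈ D, y ≤ q → (y : WithBot K) ≤ (pos ω 0 q).1 := by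
    intro y hy hq
    have : (y : WithBot K) ∈ slots D :=
      Finset.mem_insert_of_mem (Finset.mem_image_of_mem _ hy)
    exact Subtype.coe_le_coe.2
      (le_pos (x := ⟨y, this⟩) (reaches_zero ω _) (WithBot.coe_le_coe.2 hq))
  have h3 := (pos ω 0 q).2
  unfold entry
  revert h1 h2 h3
  generalize (pos ω 0 q).1 = p
  intro h1 h2 h3
  induction p using WithBot.recBotCoe with
  | bot =>
    intro y hy
    by_contra hq
    exact absurd (h2 y hy (not_lt.1 hq)) (by simp)
  | coe x =>
    refine ⟨?_, WithBot.coe_le_coe.1 h1, fun y hy hq => WithBot.coe_le_coe.1 (h2 y hy hq), rfl⟩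
    rcases Finset.mem_insert.1 h3 with h | h
    · exact absurd h (by simp)
    · obtain ⟨y, hy, hyx⟩ := Finset.mem_image.1 h
      have : y = x := WithBot.coe_injective hyx
      exact this ▸ hy

theorem stateAfter_succ {H : HostCode P (Task D P B) (Reply V D P B) (HostState V D P B S)}
    {C : ModuleCode (Fin P × LocalMem V D P B) (Task D P B) (Reply V D P B)}
    {mem : Fin P → Fin P × LocalMem V D P B} {k : ℕ}
    (h : H.calls (stateAfter H C mem k) ≠ none) :
    stateAfter H C mem (k + 1) = H.receive (stateAfter H C mem k)
      (gather C mem ((H.calls (stateAfter H C mem k)).getD 0)) := by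
  rw [stateAfter]
  split
  · next h' => exact absurd h' h
  · next cs h' => rw [h']; rfl

section Steps

variable (val : K → V) (ω : Sample D P B) (T : L3Tree D P B) (Q : Fin S → K)

/-- The reply to the task of pulling a chunk on a search path. -/
theorem reply_pull {t : Fin (height B P + 1)} (ht : 1 ≤ t.1) (q : K) :
    (moduleCode V D P B).reply (pimMemory val ω T (cursor ω t q).1) (.pull (cursor ω t q).2) =
      .chunk (chunk ω (t, pos ω t q)) := by
  simp [moduleCode, pimMemory, cursor_snd, memory_chunk val ω T ht]

theorem reply_push {t : Fin (height B P + 1)} (ht : 1 ≤ t.1) (q : K) :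
    (moduleCode V D P B).reply (pimMemory val ω T (cursor ω t q).1) (.push q (cursor ω t q).2) =
      .ptr (cursor ω (down t) q) := by
  simp [moduleCode, pimMemory, cursor_snd, memory_chunk val ω T ht, lookup_chunk, Reply.ofPtr]

theorem walk_cursor {t : Fin (height B P + 1)} (ht : l1Height B P < t.1) (q : K) :
    walk ((memory val ω T (cursor ω t q).1).shadow (t, pos ω t q)) q (height B P)
        ((cursor ω t q).1, (t, pos ω t q)) =
      (cursor ω (l1Level B P 0) q, t.1 - l1Height B P) :=
  walk_shadow val ω T q ht (height B P) t le_rfl ht.le (by omega)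

theorem reply_searchL2 {t : Fin (height B P + 1)} (ht : l1Height B P < t.1) (q : K) :
    (moduleCode V D P B).reply (pimMemory val ω T (cursor ω t q).1)
      (.searchL2 q (cursor ω t q).2) = .ptr (cursor ω (l1Level B P 0) q) := by
  simp only [moduleCode, pimMemory, cursor_snd]
  rw [walk_cursor val ω T ht]

variable [NeZero P]

theorem receive_start (hT : IsL3 ω T) :
    predReceive Q .start (gather (moduleCode V D P B) (pimMemory val ω T)
        ((predCalls (V := V) (D := D) (B := B) Q .start).getD 0)) = .l2 (pullState ω Q 0) := by
  simp only [predReceive, HostState.l2.injEq]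
  funext i
  rw [gather, if_pos (by simpa [predCalls] using ⟨i, rfl, rfl⟩)]
  simp only [moduleCode, pimMemory, memory, search_l3 hT]
  rfl

theorem receive_pull {k : ℕ} (h : Pulling (pullState ω Q k)) :
    predReceive Q (.l2 (pullState ω Q k)) (gather (moduleCode V D P B) (pimMemory val ω T)
        ((predCalls (V := V) Q (.l2 (pullState ω Q k))).getD 0)) =
      .l2 (pullState ω Q (k + 1)) := by
  simp only [predReceive, if_pos h, HostState.l2.injEq, predCalls]
  funext i
  rw [show pullState ω Q (k + 1) i = cursor ω (pullLevel ω Q (k + 1) i) (Q i) from rfl,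
    pullLevel_succ]
  split_ifs with hi
  · have hm : pullCall (pullState ω Q k i) ∈ (hotL2 (pullState ω Q k)).val.map pullCall :=
      Multiset.mem_map_of_mem _ hi
    rw [gather, Option.getD_some, if_pos hm]
    have h1 := (mem_hotL2_pullState.1 hi).2
    have := reply_pull val ω T (t := pullLevel ω Q k i) (by omega) (Q i)
    simp only [pullCall, pullState] at this ⊢
    rw [this]
    simp [cpuStep, lookup_chunk]
  · rfl

theorem receive_pushL2 {k : ℕ} (hk : k ≤ l2Height B P) (h : ¬ Pulling (pullState ω Q k)) :
    predReceive Q (.l2 (pullState ω Q k)) (gather (moduleCode V D P B) (pimMemory val ω T)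
        ((predCalls (V := V) Q (.l2 (pullState ω Q k))).getD 0)) =
      .l1 0 (levelState ω Q (l1Level B P 0)) := by
  simp only [predReceive, if_neg h, HostState.l1.injEq, predCalls, true_and]
  funext i
  split_ifs with hi
  · rw [gather, if_pos (by simpa using ⟨i, hi, rfl, rfl, rfl⟩)]
    have := reply_searchL2 val ω T (t := pullLevel ω Q k i) hi (Q i)
    simp only [pullState] at this ⊢
    rw [this]
    rfl
  · have h1 := l1Height_le_pullLevel ω Q hk i
    have h2 : ¬ l1Height B P < (pullLevel ω Q k i).1 := hi
    have : pullLevel ω Q k i = l1Level B P 0 := Fin.ext (by simp only [l1Level]; omega)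
    simp only [pullState, levelState, this]

theorem receive_l1 {r : ℕ} (hr : r < l1Height B P) :
    predReceive Q (.l1 r (levelState ω Q (l1Level B P r)))
      (gather (moduleCode V D P B) (pimMemory val ω T)
        ((predCalls (V := V) Q (.l1 r (levelState ω Q (l1Level B P r)))).getD 0)) =
      if r + 1 < l1Height B P then .l1 (r + 1) (levelState ω Q (l1Level B P (r + 1)))
      else .data (levelState ω Q (l1Level B P (l1Height B P))) := by
  have h1 : 1 ≤ (l1Level B P r).1 := by simp only [l1Level]; omega
  have hd : down (l1Level B P r) = l1Level B P (r + 1) :=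
    Fin.ext (by simp only [down, l1Level]; omega)
  have key : (fun i => if levelState ω Q (l1Level B P r) i ∈ hot B (levelState ω Q (l1Level B P r))
      then cpuStep (Q i) (levelState ω Q (l1Level B P r) i)
        (gather (moduleCode V D P B) (pimMemory val ω T)
          ((predCalls (V := V) Q (.l1 r (levelState ω Q (l1Level B P r)))).getD 0)
          (pullCall (levelState ω Q (l1Level B P r) i)))
      else ptrOr (levelState ω Q (l1Level B P r) i)
        (gather (moduleCode V D P B) (pimMemory val ω T)
          ((predCalls (V := V) Q (.l1 r (levelState ω Q (l1Level B P r)))).getD 0)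
          ((levelState ω Q (l1Level B P r) i).1,
            .push (Q i) (levelState ω Q (l1Level B P r) i).2))) =
      levelState ω Q (l1Level B P (r + 1)) := by
    funext i
    split_ifs with hi
    · rw [gather, if_pos (by
        simp only [predCalls, Option.getD_some, Multiset.mem_add]
        exact Or.inl (Multiset.mem_map_of_mem _ hi))]
      have := reply_pull val ω T h1 (Q i)
      simp only [pullCall, levelState] at this ⊢
      rw [this]
      simp [cpuStep, lookup_chunk, hd]
    · rw [gather, if_pos (by
        simp only [predCalls, Option.getD_some, Multiset.mem_add]
        exact Or.inr (Multiset.mem_map.2 ⟨i, by simpa using hi, rfl⟩))]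
      have := reply_push val ω T h1 (Q i)
      simp only [levelState] at this ⊢
      rw [this, hd]
      rfl
  simp only [predReceive, key]
  split_ifs with h
  · rfl
  · rw [show r + 1 = l1Height B P by omega]

theorem receive_data :
    predReceive Q (.data (levelState ω Q (l1Level B P (l1Height B P))))
      (gather (moduleCode V D P B) (pimMemory val ω T)
        ((predCalls (V := V) Q
          (.data (levelState ω Q (l1Level B P (l1Height B P))))).getD 0)) =
      .done (fun i => entry val (pos ω 0 (Q i))) := by
  simp only [predReceive, HostState.done.injEq, predCalls]
  funext i
  rw [gather, if_pos (by simpa using ⟨i, rfl, rfl⟩)]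
  simp [dataOf, moduleCode, pimMemory, memory, levelState, cursor, pointer, l1Level, entry]

end Steps

section Trace

variable [NeZero P] (val : K → V) (ω : Sample D P B) {T : L3Tree D P B} (Q : Fin S → K)

variable (hT : IsL3 ω T)
include hT

theorem stateAfter_l2 {k : ℕ} (hk : k ≤ pullRounds ω Q) :
    stateAfter (predecessor V D B Q) (moduleCode V D P B) (pimMemory val ω T) (1 + k) =
      .l2 (pullState ω Q k) := by
  induction k with
  | zero =>
    rw [add_zero, ← Nat.zero_add 1, stateAfter_succ (by simp [stateAfter, predecessor, predCalls])]
    exact receive_start val ω T Q hT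
  | succ k ih =>
    have ih := ih (by omega)
    rw [← add_assoc, stateAfter_succ, ih]
    · exact receive_pull val ω T Q (pulling_of_lt hk)
    · rw [ih]
      simp only [predecessor, predCalls]
      split_ifs <;> simp

theorem stateAfter_l1 {r : ℕ} (hr : r < l1Height B P) :
    stateAfter (predecessor V D B Q) (moduleCode V D P B) (pimMemory val ω T)
      (2 + pullRounds ω Q + r) = .l1 r (levelState ω Q (l1Level B P r)) := by
  induction r with
  | zero =>
    have ih := stateAfter_l2 val ω Q hT le_rfl
    rw [show 2 + pullRounds ω Q + 0 = (1 + pullRounds ω Q) + 1 by ring, stateAfter_succ, ih]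
    · exact receive_pushL2 val ω T Q (pullRounds_le ω Q) (not_pulling_pullRounds ω Q)
    · rw [ih]
      simp only [predecessor, predCalls]
      split_ifs <;> simp
  | succ r ih =>
    have ih := ih (by omega)
    rw [← add_assoc, stateAfter_succ, ih]
    · refine (receive_l1 val ω T Q (by omega)).trans ?_
      rw [if_pos hr]
    · rw [ih]
      simp [predecessor, predCalls]

theorem stateAfter_data :
    stateAfter (predecessor V D B Q) (moduleCode V D P B) (pimMemory val ω T)
      (2 + pullRounds ω Q + l1Height B P) =
        .data (levelState ω Q (l1Level B P (l1Height B P))) := by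
  obtain ⟨r, hr⟩ : ∃ r, l1Height B P = r + 1 :=
    ⟨l1Height B P - 1, by have := @one_le_l1Height P B; omega⟩
  have ih := stateAfter_l1 val ω Q hT (r := r) (by omega)
  rw [show 2 + pullRounds ω Q + l1Height B P = (2 + pullRounds ω Q + r) + 1 by omega,
    stateAfter_succ, ih]
  · refine (receive_l1 val ω T Q (by omega)).trans ?_
    rw [if_neg (by omega)]
  · rw [ih]
    simp [predecessor, predCalls]

theorem stateAfter_done :
    stateAfter (predecessor V D B Q) (moduleCode V D P B) (pimMemory val ω T)
      (3 + pullRounds ω Q + l1Height B P) = .done (fun i => entry val (pos ω 0 (Q i))) := by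
  have ih := stateAfter_data val ω Q hT
  rw [show 3 + pullRounds ω Q + l1Height B P = (2 + pullRounds ω Q + l1Height B P) + 1 by ring,
    stateAfter_succ, ih]
  · exact receive_data val ω T Q
  · rw [ih]
    simp [predecessor, predCalls]

/-- A property holds in every round if it holds in each kind of round. -/
theorem forall_round {p : ℕ → HostState V D P B S → Prop}
    (h0 : p 0 .start) (h1 : ∀ k < pullRounds ω Q, p (1 + k) (.l2 (pullState ω Q k)))
    (h2 : p (1 + pullRounds ω Q) (.l2 (pullState ω Q (pullRounds ω Q))))
    (h3 : ∀ r < l1Height B P,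
      p (2 + pullRounds ω Q + r) (.l1 r (levelState ω Q (l1Level B P r))))
    (h4 : p (2 + pullRounds ω Q + l1Height B P)
      (.data (levelState ω Q (l1Level B P (l1Height B P)))))
    {k : ℕ} (hk : k < 3 + pullRounds ω Q + l1Height B P) :
    p k (stateAfter (predecessor V D B Q) (moduleCode V D P B) (pimMemory val ω T) k) := by
  rcases Nat.eq_zero_or_pos k with rfl | hk0
  · exact h0
  rcases lt_or_ge k (1 + pullRounds ω Q) with h | h
  · obtain ⟨j, rfl⟩ := Nat.exists_eq_add_of_le (show 1 ≤ k from hk0)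
    rw [stateAfter_l2 val ω Q hT (by omega)]
    exact h1 j (by omega)
  rcases Nat.eq_or_lt_of_le h with rfl | h
  · rw [stateAfter_l2 val ω Q hT le_rfl]
    exact h2
  obtain ⟨r, rfl⟩ := Nat.exists_eq_add_of_le (show 2 + pullRounds ω Q ≤ k by omega)
  rcases Nat.lt_or_ge r (l1Height B P) with hr | hr
  · rw [stateAfter_l1 val ω Q hT hr]
    exact h3 r hr
  · obtain rfl : r = l1Height B P := by omega
    rw [stateAfter_data val ω Q hT]
    exact h4

theorem haltsAfter :
    HaltsAfter (predecessor V D B Q) (moduleCode V D P B) (pimMemory val ω T)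
      (3 + pullRounds ω Q + l1Height B P) := by
  refine ⟨fun k hk => ?_, by rw [stateAfter_done val ω Q hT]; rfl⟩
  refine forall_round val ω Q hT (p := fun _ s => (predecessor V D B Q).calls s ≠ none)
    ?_ ?_ ?_ ?_ ?_ hk
  · simp [predecessor, predCalls]
  · intro k _
    simp only [predecessor, predCalls]
    split_ifs <;> simp
  · simp only [predecessor, predCalls]
    split_ifs <;> simp
  · simp [predecessor, predCalls]
  · simp [predecessor, predCalls]

end Trace

end Execution

/-! ### Bounds for the heights -/

section Heights

variable {B P : ℕ}

theorem one_le_logBP : 1 ≤ logBP B P := le_max_left _ _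

theorem clog_le_logb (hB : 2 ≤ B) {n : ℕ} (hn : 1 ≤ n) :
    (Nat.clog B n : ℝ) ≤ Real.logb B n + 1 := by
  have hB' : (1 : ℝ) < B := by exact_mod_cast hB
  rcases Nat.eq_or_lt_of_le hn with rfl | hn
  · simp
  have h := Nat.pow_pred_clog_lt_self (by omega : 1 < B) hn
  have h0 : 0 < Nat.clog B n := Nat.clog_pos (by omega) hn
  have h1 : ((Nat.clog B n - 1 : ℕ) : ℝ) ≤ Real.logb B n := by
    rw [Real.le_logb_iff_rpow_le hB' (by positivity), Real.rpow_natCast]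
    exact_mod_cast h.le
  rw [Nat.cast_sub h0] at h1
  push_cast at h1
  linarith

theorem clog_le_two_mul_logBP (hB : 2 ≤ B) (hP : 1 ≤ P) : (Nat.clog B P : ℝ) ≤ 2 * logBP B P := by
  have h1 := clog_le_logb hB hP
  have h2 : Real.logb B P ≤ logBP B P := le_max_right _ _
  have h3 := @one_le_logBP B P
  linarith

theorem clog_le_self (hB : 2 ≤ B) (n : ℕ) : Nat.clog B n ≤ n :=
  Nat.clog_le_of_le_pow (Nat.lt_pow_self (by omega)).le

theorem l1Height_le_max (hB : 2 ≤ B) : l1Height B P ≤ max 1 (Nat.clog B P) :=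
  max_le_max le_rfl (clog_le_self hB _)

theorem l2Height_le_max : l2Height B P ≤ max 1 (Nat.clog B P) :=
  max_le_max le_rfl (Nat.sub_le _ _)

theorem max_clog_le (hB : 2 ≤ B) (hP : 1 ≤ P) :
    ((max 1 (Nat.clog B P) : ℕ) : ℝ) ≤ 2 * logBP B P := by
  rw [Nat.cast_max, Nat.cast_one]
  exact max_le (by linarith [@one_le_logBP B P]) (clog_le_two_mul_logBP hB hP)

theorem l1Height_le (hB : 2 ≤ B) (hP : 1 ≤ P) : (l1Height B P : ℝ) ≤ 2 * logBP B P :=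
  le_trans (by exact_mod_cast l1Height_le_max hB) (max_clog_le hB hP)

theorem l2Height_le (hB : 2 ≤ B) (hP : 1 ≤ P) : (l2Height B P : ℝ) ≤ 2 * logBP B P :=
  le_trans (by exact_mod_cast l2Height_le_max) (max_clog_le hB hP)

theorem logb_logBP_nonneg (hB : 2 ≤ B) : 0 ≤ Real.logb B (logBP B P) :=
  Real.logb_nonneg (by exact_mod_cast hB) one_le_logBP

/-- L1 has `O(1 + log_B log_B P)` levels. -/
theorem l1Height_le_logb (hB : 2 ≤ B) (hP : 1 ≤ P) :
    (l1Height B P : ℝ) ≤ 2 + Real.logb B (logBP B P) := by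
  have hB' : (1 : ℝ) < B := by exact_mod_cast hB
  have h0 := @logb_logBP_nonneg B P hB
  rw [l1Height, Nat.cast_max, Nat.cast_one]
  refine max_le (by linarith) ?_
  rcases Nat.eq_zero_or_pos (Nat.clog B P) with h | h
  · rw [h]; simp; linarith
  have h1 := clog_le_logb hB h
  have h2 : Real.logb B (Nat.clog B P) ≤ Real.logb B (2 * logBP B P) :=
    Real.logb_le_logb_of_le hB' (by exact_mod_cast h) (clog_le_two_mul_logBP hB hP)
  have h3 := @one_le_logBP B P
  rw [Real.logb_mul (by norm_num) (by linarith)] at h2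
  have h4 : Real.logb B 2 ≤ 1 := by
    rw [← Real.logb_self_eq_one hB']
    exact Real.logb_le_logb_of_le hB' (by norm_num) (by exact_mod_cast hB)
  linarith

end Heights
/-! ### Uniform probability on finite sample spaces -/

section Prob

variable {Ω Θ : Type*}

theorem prob_nonneg (E : Set Ω) : 0 ≤ prob E := by unfold prob; positivity

theorem prob_union_le (E F : Set Ω) : prob (E ∪ F) ≤ prob E + prob F := by
  unfold prob
  rw [← add_div]
  gcongr
  exact_mod_cast Set.ncard_union_le _ _

theorem prob_biUnion_le {ι : Type*} (s : Finset ι) (E : ι → Set Ω) :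
    prob (⋃ i ∈ s, E i) ≤ ∑ i ∈ s, prob (E i) := by
  classical
  induction s using Finset.induction_on with
  | empty => simp [prob]
  | insert a s ha ih =>
    rw [Finset.sum_insert ha, Finset.set_biUnion_insert]
    exact (prob_union_le _ _).trans (add_le_add_right ih _)

variable [Fintype Ω]

theorem prob_mono {E F : Set Ω} (h : E ⊆ F) : prob E ≤ prob F := by
  unfold prob
  gcongr
  exact Set.toFinite _

theorem one_sub_prob_compl_le [Nonempty Ω] (E : Set Ω) : 1 - prob Eᶜ ≤ prob E := by
  have h := Set.ncard_add_ncard_compl E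
  have h0 : (0 : ℝ) < Nat.card Ω := by exact_mod_cast Nat.card_pos
  unfold prob
  rw [sub_le_iff_le_add, ← add_div, le_div_iff₀ h0, one_mul]
  exact_mod_cast h.ge

/-- Markov's inequality. -/
theorem prob_le_of_sum_le [Nonempty Ω] {E : Set Ω} {f : Ω → ℝ} (hf : ∀ ω, 0 ≤ f ω) {c C : ℝ}
    (hc : 0 < c) (hE : ∀ ω ∈ E, c ≤ f ω) (hC : ∑ ω, f ω ≤ C * Fintype.card Ω) :
    prob E ≤ C / c := by
  classical
  have h0 : (0 : ℝ) < Fintype.card Ω := by exact_mod_cast Fintype.card_pos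
  rw [prob, Nat.card_eq_fintype_card, div_le_div_iff₀ h0 hc]
  refine le_trans ?_ hC
  rw [Set.ncard_eq_toFinset_card' E, ← nsmul_eq_mul]
  calc E.toFinset.card • c ≤ ∑ ω ∈ E.toFinset, f ω :=
        Finset.card_nsmul_le_sum _ _ _ (fun ω hω => hE ω (by simpa using hω))
    _ ≤ ∑ ω, f ω := Finset.sum_le_sum_of_subset_of_nonneg (Finset.subset_univ _)
        (fun ω _ _ => hf ω)

variable [Fintype Θ]

/-- Redrawing a coordinate `old : Ω → Θ` of a uniform sample (`T` overwrites the coordinate)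
leaves the distribution uniform. -/
theorem sum_resample (T : Ω → Θ → Ω) (old : Ω → Θ) (h1 : ∀ ω θ, T (T ω θ) (old ω) = ω)
    (h2 : ∀ ω θ, old (T ω θ) = θ) (g : Ω → ℝ) :
    ∑ ω, ∑ θ, g (T ω θ) = Fintype.card Θ * ∑ ω, g ω := by
  have hi : Function.Involutive (fun a : Ω × Θ => (T a.1 a.2, old a.1)) := by
    rintro ⟨ω, θ⟩
    simp [h1, h2]
  have h := Equiv.sum_comp hi.toPerm (fun a : Ω × Θ => g a.1)
  rw [← Fintype.sum_prod_type' (fun ω θ => g (T ω θ))]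
  refine h.trans ?_
  rw [Fintype.sum_prod_type]
  simp [Finset.mul_sum]

theorem sum_le_of_resample [Nonempty Θ] (T : Ω → Θ → Ω) (old : Ω → Θ)
    (h1 : ∀ ω θ, T (T ω θ) (old ω) = ω) (h2 : ∀ ω θ, old (T ω θ) = θ) {g f : Ω → ℝ}
    (hg : ∀ ω, ∑ θ, g (T ω θ) ≤ Fintype.card Θ * f ω) : ∑ ω, g ω ≤ ∑ ω, f ω := by
  have h0 : (0 : ℝ) < Fintype.card Θ := by exact_mod_cast Fintype.card_pos
  refine le_of_mul_le_mul_left ?_ h0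
  rw [← sum_resample T old h1 h2, Finset.mul_sum]
  exact Finset.sum_le_sum (fun ω _ => hg ω)

theorem sum_update_le {ι β : Type*} [Fintype ι] [DecidableEq ι] [Fintype β] [Nonempty β] (x : ι)
    {g f : (ι → β) → ℝ}
    (hg : ∀ ω, ∑ a, g (Function.update ω x a) ≤ Fintype.card β * f ω) : ∑ ω, g ω ≤ ∑ ω, f ω :=
  sum_le_of_resample (fun ω a => Function.update ω x a) (fun ω => ω x) (by simp) (by simp) hg

theorem sum_fin_ite_eq {P : ℕ} (m : Fin P) (u v : ℝ) :
    ∑ a : Fin P, (if a = m then u else v) = P * v + (u - v) := by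
  have : ∀ a : Fin P, (if a = m then u else v) = v + if a = m then u - v else 0 := by
    intro a; split_ifs <;> ring
  simp [this, Finset.sum_add_distrib]

theorem sum_fin_ite_val_eq_zero {B : ℕ} (hB : 1 ≤ B) (u v : ℝ) :
    ∑ a : Fin B, (if a.1 = 0 then u else v) = B * v + (u - v) := by
  rw [← sum_fin_ite_eq (⟨0, hB⟩ : Fin B) u v]
  simp only [Fin.ext_iff]

end Prob

/-! ### Weighted balls in bins -/

section Balls

variable {ι : Type*} [Fintype ι] [DecidableEq ι] {P : ℕ}

/-- The exponential moment of the load of bin `m` when balls of weight at most `θ` are put into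
uniform random bins. -/
theorem sum_exp_load_le [NeZero P] (m : Fin P) (w : ι → ℕ) {θ : ℕ} (hθ : 1 ≤ θ)
    (hw : ∀ v, w v ≤ θ) :
    ∑ h : ι → Fin P, Real.exp ((∑ v, if h v = m then (w v : ℝ) else 0) / θ) ≤
      Real.exp (2 * (∑ v, (w v : ℝ)) / (θ * P)) * Fintype.card (ι → Fin P) := by
  have hP : (0 : ℝ) < P := by exact_mod_cast Nat.pos_of_ne_zero (NeZero.ne P)
  have hθ' : (0 : ℝ) < θ := by exact_mod_cast hθ
  have e1 : ∀ h : ι → Fin P, Real.exp ((∑ v, if h v = m then (w v : ℝ) else 0) / θ) =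
      ∏ v, (if h v = m then Real.exp (w v / θ) else 1) := by
    intro h
    rw [Finset.sum_div, Real.exp_sum]
    refine Finset.prod_congr rfl (fun v _ => ?_)
    split_ifs <;> simp
  simp only [e1]
  have e2 := Finset.prod_univ_sum (fun _ : ι => (Finset.univ : Finset (Fin P)))
    (fun v a => if a = m then Real.exp (w v / θ) else (1 : ℝ))
  rw [Fintype.piFinset_univ] at e2
  rw [← e2]
  calc ∏ v, ∑ a : Fin P, (if a = m then Real.exp (w v / θ) else (1 : ℝ))
      ≤ ∏ v, (Real.exp (2 * w v / (θ * P)) * P) := by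
        refine Finset.prod_le_prod (fun v _ => Finset.sum_nonneg (fun a _ => by
          split_ifs <;> positivity)) (fun v _ => ?_)
        rw [sum_fin_ite_eq, mul_one]
        have h1 : (w v : ℝ) / θ ≤ 1 := by
          rw [div_le_one hθ']; exact_mod_cast hw v
        have h0 : 0 ≤ (w v : ℝ) / θ := by positivity
        have h2 := (abs_le.1 (Real.abs_exp_sub_one_le (x := (w v : ℝ) / θ)
          (by rwa [abs_of_nonneg h0]))).2
        rw [abs_of_nonneg h0] at h2
        have h3 := Real.add_one_le_exp (2 * (w v : ℝ) / (θ * P))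
        calc (P : ℝ) + (Real.exp (w v / θ) - 1) ≤ P + 2 * (w v / θ) := by linarith
          _ = (2 * (w v : ℝ) / (θ * P) + 1) * P := by field_simp; ring
          _ ≤ _ := mul_le_mul_of_nonneg_right h3 hP.le
    _ = _ := by
        rw [Finset.prod_mul_distrib, ← Real.exp_sum, Finset.mul_sum, Finset.sum_div]
        simp

end Balls

/-! ### Random gaps hosted by a module -/

section Gaps

variable {ι : Type*} {B P : ℕ}

/-- The pivot of the last gap of a decreasing list, where an element is a pivot if its die shows
`0`. The first gap has the pivot `b`, which is below the list. -/
def lastPivot (b : ι) (d : ι → Fin B) : List ι → ι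
  | [] => b
  | x :: l => if (d x).1 = 0 then x else lastPivot b d l

/-- The last gap of a decreasing list contains an element of the set `M` of marks. -/
def Marked (b : ι) (M : Finset ι) (d : ι → Fin B) : List ι → Prop
  | [] => b ∈ M
  | x :: l => x ∈ M ∨ ((d x).1 ≠ 0 ∧ Marked b M d l)

/-- The last gap of a decreasing list contains a mark and is hosted by `m`. -/
def Active (b : ι) (M : Finset ι) (m : Fin P) (d : ι → Fin B) (h : ι → Fin P)
    (l : List ι) : Prop := Marked b M d l ∧ h (lastPivot b d l) = m

open Classical in
/-- The number of elements of a decreasing list (with `b` below it) that are not below the first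
mark in their gap, if the gap is hosted by `m`. -/
noncomputable def fwdCount (b : ι) (M : Finset ι) (m : Fin P) (d : ι → Fin B) (h : ι → Fin P) :
    List ι → ℕ
  | [] => if Active b M m d h [] then 1 else 0
  | x :: l => fwdCount b M m d h l + if Active b M m d h (x :: l) then 1 else 0

open Classical in
/-- The number of elements in the first gap of an increasing list, whose pivot has not been found
yet, that are not above the last mark in this gap, after the element `x` is added below a list
with `c` such elements. -/
noncomputable def addPending (M : Finset ι) (x : ι) (c : ℕ) : ℕ :=
  if x ∈ M ∨ 0 < c then c + 1 else 0

/-- The number of elements below the first pivot of an increasing list, and not above the last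
mark that is below the first pivot. -/
noncomputable def pending (M : Finset ι) (d : ι → Fin B) : List ι → ℕ
  | [] => 0
  | x :: l => if (d x).1 = 0 then 0 else addPending M x (pending M d l)

/-- The number of elements of an increasing list that are not above the last mark in their gap, if
the pivot of the gap is in the list and is hosted by `m`. -/
noncomputable def bwdCount (M : Finset ι) (m : Fin P) (d : ι → Fin B) (h : ι → Fin P) :
    List ι → ℕ
  | [] => 0
  | x :: l => bwdCount M m d h l +
      if (d x).1 = 0 ∧ h x = m then addPending M x (pending M d l) else 0

/-- The base of the exponential moments of lengths of gaps, which are of the order of `B`. -/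
noncomputable def expBase (B : ℕ) : ℝ := 1 + 1 / (2 * B)

theorem one_le_expBase : 1 ≤ expBase B := by
  unfold expBase
  have : (0 : ℝ) ≤ 1 / (2 * B) := by positivity
  linarith

/-- The factor that a mark contributes to an exponential moment. -/
noncomputable def markFactor (M : Finset ι) (P : ℕ) (x : ι) : ℝ :=
  open Classical in if x ∈ M then 1 + 2 / (P : ℝ) else 1

theorem one_le_markFactor (M : Finset ι) (x : ι) : 1 ≤ markFactor M P x := by
  unfold markFactor
  split_ifs
  · have : (0 : ℝ) ≤ 2 / P := by positivity
    linarith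
  · exact le_rfl

theorem prod_markFactor_le (M : Finset ι) {l : List ι} (hl : l.Nodup) :
    (l.map (markFactor M P)).prod ≤ (1 + 2 / (P : ℝ)) ^ M.card := by
  classical
  rw [← List.prod_toFinset _ hl]
  have h0 : (0 : ℝ) ≤ 2 / P := by positivity
  unfold markFactor
  rw [← Finset.prod_filter, Finset.prod_const]
  refine pow_le_pow_right₀ (by linarith) (Finset.card_le_card ?_)
  exact fun x hx => (Finset.mem_filter.1 hx).2

section Forward

variable {b : ι} {M : Finset ι} {m : Fin P} {d d' : ι → Fin B} {h h' : ι → Fin P}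

theorem lastPivot_congr : ∀ {l : List ι}, (∀ x ∈ l, d x = d' x) →
    lastPivot b d l = lastPivot b d' l
  | [], _ => rfl
  | x :: l, hd => by
    have ih := lastPivot_congr (l := l) (fun y hy => hd y (by simp [hy]))
    simp [lastPivot, ih, hd x (by simp)]

theorem marked_congr : ∀ {l : List ι}, (∀ x ∈ l, d x = d' x) →
    (Marked b M d l ↔ Marked b M d' l)
  | [], _ => Iff.rfl
  | x :: l, hd => by
    have ih := marked_congr (l := l) (fun y hy => hd y (by simp [hy]))
    simp [Marked, ih, hd x (by simp)]

theorem active_congr {l : List ι} (hd : ∀ x ∈ l, d x = d' x) :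
    Active b M m d h l ↔ Active b M m d' h l := by
  simp only [Active, marked_congr hd, lastPivot_congr hd]

open Classical in
theorem fwdCount_congr_dice : ∀ {l : List ι}, (∀ x ∈ l, d x = d' x) →
    fwdCount b M m d h l = fwdCount b M m d' h l
  | [], _ => rfl
  | x :: l, hd => by
    have ih := fwdCount_congr_dice (l := l)
      (fun y hy => hd y (by simp [hy]))
    rw [fwdCount, fwdCount, ih, if_congr (active_congr hd) rfl rfl]

theorem lastPivot_mem : ∀ l : List ι, lastPivot b d l = b ∨ lastPivot b d l ∈ l
  | [] => Or.inl rfl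
  | x :: l => by
    unfold lastPivot
    split_ifs
    · simp
    · rcases lastPivot_mem l with h | h
      · exact Or.inl h
      · exact Or.inr (List.mem_cons_of_mem _ h)

open Classical in
theorem fwdCount_congr_host : ∀ {l : List ι}, (∀ x ∈ l, h x = h' x) → h b = h' b →
    fwdCount b M m d h l = fwdCount b M m d h' l
  | [], _, hb => by
    have hA : Active b M m d h [] ↔ Active b M m d h' [] := by simp only [Active, lastPivot, hb]
    rw [fwdCount, fwdCount, if_congr hA rfl rfl]
  | x :: l, hh, hb => by
    have ih := fwdCount_congr_host (l := l)
      (fun y hy => hh y (by simp [hy])) hb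
    have : h (lastPivot b d (x :: l)) = h' (lastPivot b d (x :: l)) := by
      rcases lastPivot_mem (b := b) (d := d) (x :: l) with hp | hp
      · rw [hp, hb]
      · exact hh _ hp
    have hA : Active b M m d h (x :: l) ↔ Active b M m d h' (x :: l) := by
      simp only [Active, this]
    rw [fwdCount, fwdCount, ih, if_congr hA rfl rfl]

variable [DecidableEq ι]

/-- As long as the last gap contains no mark, its host has no influence. -/
theorem fwdCount_update_lastPivot (a : Fin P) : ∀ {l : List ι}, l.Nodup → b ∉ l →
    ¬ Marked b M d l → fwdCount b M m d (Function.update h (lastPivot b d l) a) l =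
      fwdCount b M m d h l
  | [], _, _, hM => by simp only [fwdCount, Active, hM, false_and]
  | x :: l, hl, hb, hM => by
    simp only [fwdCount, Active, hM, false_and, if_false, add_zero]
    obtain ⟨hxl, hl⟩ := List.nodup_cons.1 hl
    obtain ⟨hxb, hbl⟩ := not_or.1 (mt List.mem_cons.2 hb)
    unfold lastPivot
    split_ifs with hx
    · refine fwdCount_congr_host (fun y hy => ?_) ?_
      · rw [Function.update_of_ne]; rintro rfl; exact hxl hy
      · rw [Function.update_of_ne hxb]
    · exact fwdCount_update_lastPivot a hl hbl (fun h' => hM (Or.inr ⟨hx, h'⟩))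

variable [Fintype ι]

open Classical in
/-- The hosts of gaps are drawn when the first mark of the gap is met. -/
theorem sum_host_fwd_step [NeZero P] (hB : 1 ≤ B) {x : ι} {l : List ι} (hl : (x :: l).Nodup)
    (hb : b ∉ x :: l) (d : ι → Fin B) :
    ∑ h : ι → Fin P, expBase B ^ fwdCount b M m d h (x :: l) *
        (if Active b M m d h (x :: l) then (2 : ℝ) else 1) ≤
      ∑ h : ι → Fin P, markFactor M P x * (expBase B ^ fwdCount b M m d h l *
        (if (d x).1 = 0 then 1 else if Active b M m d h l then 2 * expBase B else 1)) := by
  have hP : (0 : ℝ) < P := by exact_mod_cast Nat.pos_of_ne_zero (NeZero.ne P)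
  have hz := @one_le_expBase B
  obtain ⟨hxl, hl'⟩ := List.nodup_cons.1 hl
  obtain ⟨hxb, hbl⟩ := not_or.1 (mt List.mem_cons.2 hb)
  -- the term for a gap whose host is met for the first time
  have fresh : x ∈ M → ((d x).1 = 0 ∨ ¬ Marked b M d l) →
      ∑ h : ι → Fin P, expBase B ^ fwdCount b M m d h (x :: l) *
        (if Active b M m d h (x :: l) then (2 : ℝ) else 1) ≤
      ∑ h : ι → Fin P, markFactor M P x * (expBase B ^ fwdCount b M m d h l) := by
    intro hxM hcase
    have hk : ∀ (h : ι → Fin P) a,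
        fwdCount b M m d (Function.update h (lastPivot b d (x :: l)) a) l =
          fwdCount b M m d h l := by
      intro h a
      by_cases hx : (d x).1 = 0
      · rw [lastPivot, if_pos hx]
        refine fwdCount_congr_host (fun y hy => ?_) ?_
        · rw [Function.update_of_ne]; rintro rfl; exact hxl hy
        · rw [Function.update_of_ne hxb]
      · rw [lastPivot, if_neg hx]
        exact fwdCount_update_lastPivot a hl' hbl (hcase.resolve_left hx)
    have hA : ∀ h : ι → Fin P,
        Active b M m d h (x :: l) ↔ h (lastPivot b d (x :: l)) = m := fun h =>
      and_iff_right (Or.inl hxM)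
    refine sum_update_le (lastPivot b d (x :: l)) (fun h => ?_)
    have : ∀ a : Fin P, expBase B ^ fwdCount b M m d
          (Function.update h (lastPivot b d (x :: l)) a) (x :: l) *
        (if Active b M m d (Function.update h (lastPivot b d (x :: l)) a) (x :: l)
          then (2 : ℝ) else 1) =
        expBase B ^ fwdCount b M m d h l * (if a = m then 2 * expBase B else 1) := by
      intro a
      rw [fwdCount, hk, hA, Function.update_self]
      split_ifs <;> ring
    rw [Finset.sum_congr rfl (fun a _ => this a), ← Finset.mul_sum, sum_fin_ite_eq, markFactor,
      if_pos hxM, Fintype.card_fin]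
    have h2 : 2 * expBase B - 1 ≤ 2 := by
      have : (1 : ℝ) / (2 * B) ≤ 1 / 2 := by
        have : (1 : ℝ) ≤ B := by exact_mod_cast hB
        rw [div_le_div_iff₀ (by positivity) (by norm_num)]; linarith
      unfold expBase; linarith
    have h3 : (P : ℝ) * ((1 + 2 / (P : ℝ)) * expBase B ^ fwdCount b M m d h l) =
        expBase B ^ fwdCount b M m d h l * (P + 2) := by field_simp
    rw [h3]
    gcongr
    linarith
  by_cases hx : (d x).1 = 0
  · by_cases hxM : x ∈ M
    · simpa [hx] using fresh hxM (Or.inl hx)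
    · have hA : ∀ h : ι → Fin P, ¬ Active b M m d h (x :: l) := by
        intro h hA
        rcases hA.1 with h1 | h1
        · exact hxM h1
        · exact h1.1 hx
      simp [fwdCount, hA, hx, markFactor, hxM]
  · by_cases hM : Marked b M d l
    · refine Finset.sum_le_sum (fun h _ => ?_)
      have hA : Active b M m d h (x :: l) ↔ Active b M m d h l := by
        simp only [Active, Marked, hM, lastPivot, hx, if_false, ne_eq, not_false_eq_true,
          and_self, or_true]
      rw [fwdCount, hA, if_neg hx]
      have h1 := one_le_markFactor (P := P) M x
      have h2 : 0 ≤ expBase B ^ fwdCount b M m d h l *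
          (if Active b M m d h l then 2 * expBase B else 1) := by
        have : 0 ≤ expBase B := by linarith
        split_ifs <;> positivity
      refine le_trans (le_of_eq ?_) (le_mul_of_one_le_left h2 h1)
      split_ifs <;> ring
    · have hA : ∀ h : ι → Fin P, ¬ Active b M m d h l := fun h hA => hM hA.1
      simp only [hx, hA, if_false, mul_one]
      by_cases hxM : x ∈ M
      · exact fresh hxM (Or.inr hM)
      · have hA' : ∀ h : ι → Fin P, ¬ Active b M m d h (x :: l) := by
          intro h hA
          rcases hA.1 with h1 | h1
          · exact hxM h1
          · exact hM h1.2
        simp [fwdCount, hA', markFactor, hxM]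

open Classical in
theorem sum_fwd_step [NeZero P] (hB : 1 ≤ B) {x : ι} {l : List ι} (hl : (x :: l).Nodup)
    (hb : b ∉ x :: l) :
    ∑ d : ι → Fin B, ∑ h : ι → Fin P, expBase B ^ fwdCount b M m d h (x :: l) *
        (if Active b M m d h (x :: l) then (2 : ℝ) else 1) ≤
      markFactor M P x * ∑ d : ι → Fin B, ∑ h : ι → Fin P,
        expBase B ^ fwdCount b M m d h l * (if Active b M m d h l then (2 : ℝ) else 1) := by
  have : NeZero B := ⟨by omega⟩
  have hB' : (1 : ℝ) ≤ B := by exact_mod_cast hB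
  have hz := @one_le_expBase B
  refine (Finset.sum_le_sum (fun d _ => sum_host_fwd_step hB hl hb d)).trans ?_
  rw [Finset.mul_sum]
  refine sum_update_le x (fun d => ?_)
  have hd : ∀ a, ∀ y ∈ l, Function.update d x a y = d y := fun a y hy => by
    rw [Function.update_of_ne]
    rintro rfl
    exact (List.nodup_cons.1 hl).1 hy
  simp only [fwdCount_congr_dice (hd _), active_congr (hd _), Function.update_self]
  rw [Finset.sum_comm, Finset.mul_sum, Finset.mul_sum]
  refine Finset.sum_le_sum (fun h _ => ?_)
  rw [← Finset.mul_sum, ← Finset.mul_sum, sum_fin_ite_val_eq_zero hB, Fintype.card_fin]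
  have h1 := one_le_markFactor (P := P) M x
  have h2 : (B : ℝ) * (if Active b M m d h l then 2 * expBase B else 1) +
      (1 - (if Active b M m d h l then 2 * expBase B else 1)) ≤
      B * (if Active b M m d h l then (2 : ℝ) else 1) := by
    split_ifs
    · have h3 : (B : ℝ) * expBase B = B + 1 / 2 := by unfold expBase; field_simp
      nlinarith
    · linarith
  calc _ ≤ markFactor M P x * (expBase B ^ fwdCount b M m d h l *
        (B * (if Active b M m d h l then (2 : ℝ) else 1))) := by gcongr
    _ = _ := by ring

open Classical in
theorem sum_fwd_nil [NeZero P] (hB : 1 ≤ B) (d : ι → Fin B) :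
    ∑ h : ι → Fin P, expBase B ^ fwdCount b M m d h [] *
        (if Active b M m d h [] then (2 : ℝ) else 1) ≤
      ∑ _h : ι → Fin P, markFactor M P b := by
  have hP : (0 : ℝ) < P := by exact_mod_cast Nat.pos_of_ne_zero (NeZero.ne P)
  by_cases hbM : b ∈ M
  · refine sum_update_le b (fun h => ?_)
    have hA : ∀ a : Fin P, Active b M m d (Function.update h b a) [] ↔ a = m := fun a => by
      simp [Active, Marked, hbM, lastPivot]
    have : ∀ a : Fin P, expBase B ^ fwdCount b M m d (Function.update h b a) [] *
        (if Active b M m d (Function.update h b a) [] then (2 : ℝ) else 1) =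
        (if a = m then 2 * expBase B else 1) := by
      intro a
      rw [fwdCount, hA]
      split_ifs <;> ring
    rw [Finset.sum_congr rfl (fun a _ => this a), sum_fin_ite_eq, markFactor,
      if_pos hbM, Fintype.card_fin]
    have h2 : 2 * expBase B - 1 ≤ 2 := by
      have : (1 : ℝ) / (2 * B) ≤ 1 / 2 := by
        have : (1 : ℝ) ≤ B := by exact_mod_cast hB
        rw [div_le_div_iff₀ (by positivity) (by norm_num)]; linarith
      unfold expBase; linarith
    have h3 : (P : ℝ) * (1 + 2 / (P : ℝ)) = P + 2 := by field_simp
    rw [h3]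
    linarith
  · have hA : ∀ h : ι → Fin P, ¬ Active b M m d h [] := fun h hA => hbM hA.1
    simp [fwdCount, hA, markFactor, hbM]

open Classical in
theorem sum_fwd_le_prod [NeZero P] (hB : 1 ≤ B) : ∀ {l : List ι}, l.Nodup → b ∉ l →
    ∑ d : ι → Fin B, ∑ h : ι → Fin P, expBase B ^ fwdCount b M m d h l *
        (if Active b M m d h l then (2 : ℝ) else 1) ≤
      ((b :: l).map (markFactor M P)).prod *
        (Fintype.card (ι → Fin B) * Fintype.card (ι → Fin P))
  | [], _, _ => by
    refine (Finset.sum_le_sum (fun d _ => sum_fwd_nil hB d)).trans (le_of_eq ?_)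
    simp
    ring
  | x :: l, hl, hb => by
    refine (sum_fwd_step hB hl hb).trans ?_
    have h1 := one_le_markFactor (P := P) M x
    have ih := sum_fwd_le_prod hB (List.nodup_cons.1 hl).2
      (fun h => hb (List.mem_cons_of_mem _ h))
    refine (mul_le_mul_of_nonneg_left ih (by linarith)).trans (le_of_eq ?_)
    simp only [List.map_cons, List.prod_cons]
    ring

/-- The exponential moment of the forward count. -/
theorem sum_pow_fwdCount_le [NeZero P] (hB : 1 ≤ B) {l : List ι} (hl : (b :: l).Nodup) :
    ∑ d : ι → Fin B, ∑ h : ι → Fin P, expBase B ^ fwdCount b M m d h l ≤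
      (1 + 2 / (P : ℝ)) ^ M.card * (Fintype.card (ι → Fin B) * Fintype.card (ι → Fin P)) := by
  classical
  have hz := @one_le_expBase B
  refine le_trans (Finset.sum_le_sum (fun d _ => Finset.sum_le_sum (fun h _ => ?_)))
    ((sum_fwd_le_prod (M := M) (m := m) hB (List.nodup_cons.1 hl).2
      (List.nodup_cons.1 hl).1).trans ?_)
  · refine le_mul_of_one_le_right (by positivity) ?_
    split_ifs <;> norm_num
  · gcongr
    exact prod_markFactor_le M hl

end Forward

section Backward

variable {b : ι} {M : Finset ι} {m : Fin P} {d d' : ι → Fin B} {h h' : ι → Fin P}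

theorem pending_congr : ∀ {l : List ι}, (∀ x ∈ l, d x = d' x) → pending M d l = pending M d' l
  | [], _ => rfl
  | x :: l, hd => by
    have ih := pending_congr (l := l) (fun y hy => hd y (by simp [hy]))
    simp [pending, ih, hd x (by simp)]

theorem bwdCount_congr : ∀ {l : List ι}, (∀ x ∈ l, d x = d' x) → (∀ x ∈ l, h x = h' x) →
    bwdCount M m d h l = bwdCount M m d' h' l
  | [], _, _ => rfl
  | x :: l, hd, hh => by
    have ih := bwdCount_congr (l := l)
      (fun y hy => hd y (by simp [hy])) (fun y hy => hh y (by simp [hy]))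
    have hp := pending_congr (M := M) (l := l) (fun y hy => hd y (by simp [hy]))
    simp [bwdCount, ih, hp, hd x (by simp), hh x (by simp)]

/-- The excess of the exponential moment that is due to `c` pending elements. -/
noncomputable def pendingExcess (B P c : ℕ) : ℝ := if 0 < c then expBase B ^ c / P else 0

theorem pendingExcess_nonneg (c : ℕ) : 0 ≤ pendingExcess B P c := by
  have := @one_le_expBase B
  unfold pendingExcess
  split_ifs <;> positivity

/-- The expected growth factor when the host of a gap with `c` counted elements is drawn. -/
theorem sum_host_pow (hP : 0 < P) (c : ℕ) (m : Fin P) :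
    ∑ a : Fin P, expBase B ^ (if a = m then c else 0) ≤ P * (1 + pendingExcess B P c) := by
  have hP' : (0 : ℝ) < P := by exact_mod_cast hP
  have : ∀ a : Fin P, expBase B ^ (if a = m then c else 0) =
      if a = m then expBase B ^ c else 1 := by
    intro a; split_ifs <;> simp
  rw [Finset.sum_congr rfl (fun a _ => this a), sum_fin_ite_eq]
  rcases Nat.eq_zero_or_pos c with rfl | hc
  · simp [pendingExcess]
  · rw [pendingExcess, if_pos hc, mul_add, mul_div_cancel₀ _ hP'.ne']
    linarith

/-- The potential of the open gap decreases on average when an element is added. -/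
theorem pendingExcess_addPending_le (hB : 1 ≤ B) (x : ι) (c : ℕ) :
    (B : ℝ) + (2 * B - 1) * pendingExcess B P (addPending M x c) ≤
      B * (markFactor M P x * (1 + 2 * pendingExcess B P c)) := by
  have hB' : (1 : ℝ) ≤ B := by exact_mod_cast hB
  have hk := one_le_markFactor (P := P) M x
  have he := @pendingExcess_nonneg B P c
  have hz : (2 * B - 1) * expBase B ≤ 2 * B := by
    have h3 : (B : ℝ) * expBase B = B + 1 / 2 := by unfold expBase; field_simp
    have := @one_le_expBase B
    linarith
  by_cases h : x ∈ M ∨ 0 < c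
  · rw [addPending, if_pos h]
    by_cases hc : 0 < c
    · have h1 : pendingExcess B P (c + 1) = expBase B * pendingExcess B P c := by
        simp only [pendingExcess, hc, if_true, Nat.succ_pos, pow_succ]
        ring
      calc (B : ℝ) + (2 * B - 1) * pendingExcess B P (c + 1)
          = B + ((2 * B - 1) * expBase B) * pendingExcess B P c := by rw [h1]; ring
        _ ≤ B + (2 * B) * pendingExcess B P c := by gcongr
        _ = B * (1 * (1 + 2 * pendingExcess B P c)) := by ring
        _ ≤ _ := by gcongr
    · have hx := h.resolve_right hc
      obtain rfl : c = 0 := by omega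
      have h1 : pendingExcess B P (0 + 1) = expBase B / P := by simp [pendingExcess]
      have h0 : pendingExcess B P 0 = 0 := by simp [pendingExcess]
      rw [h1, h0, markFactor, if_pos hx]
      have : (2 * B - 1) * (expBase B / P) ≤ 2 * B / P := by
        rw [← mul_div_assoc]; gcongr
      calc (B : ℝ) + (2 * B - 1) * (expBase B / P) ≤ B + 2 * B / P := by linarith
        _ = _ := by ring
  · rw [addPending, if_neg h]
    have h0 : pendingExcess B P 0 = 0 := by simp [pendingExcess]
    rw [h0, mul_zero, add_zero]
    have : 1 * 1 ≤ markFactor M P x * (1 + 2 * pendingExcess B P c) :=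
      mul_le_mul hk (by linarith) zero_le_one (by linarith)
    nlinarith

variable [Fintype ι] [DecidableEq ι]

theorem sum_bwd_step [NeZero P] (hB : 1 ≤ B) {x : ι} {l : List ι} (hl : (x :: l).Nodup) :
    ∑ d : ι → Fin B, ∑ h : ι → Fin P, expBase B ^ bwdCount M m d h (x :: l) *
        (1 + 2 * pendingExcess B P (pending M d (x :: l))) ≤
      markFactor M P x * ∑ d : ι → Fin B, ∑ h : ι → Fin P,
        expBase B ^ bwdCount M m d h l * (1 + 2 * pendingExcess B P (pending M d l)) := by
  have : NeZero B := ⟨by omega⟩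
  have hz := @one_le_expBase B
  have hxl := (List.nodup_cons.1 hl).1
  have hd : ∀ (β : Type) (f : ι → β) (a : β), ∀ y ∈ l, Function.update f x a y = f y :=
    fun β f a y hy => by
      rw [Function.update_of_ne]
      rintro rfl
      exact hxl hy
  have step : ∀ d : ι → Fin B, ∑ h : ι → Fin P, expBase B ^ bwdCount M m d h (x :: l) *
        (1 + 2 * pendingExcess B P (pending M d (x :: l))) ≤
      ∑ h : ι → Fin P, expBase B ^ bwdCount M m d h l *
        (if (d x).1 = 0 then 1 + pendingExcess B P (addPending M x (pending M d l))
          else 1 + 2 * pendingExcess B P (addPending M x (pending M d l))) := by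
    intro d
    by_cases hx : (d x).1 = 0
    · refine sum_update_le x (fun h => ?_)
      simp only [bwdCount, bwdCount_congr (fun _ _ => rfl) (hd _ h _), hx, pending, if_true,
        true_and, Function.update_self, pow_add]
      have h0 : pendingExcess B P 0 = 0 := by simp [pendingExcess]
      rw [h0, mul_zero, add_zero]
      simp only [mul_one]
      rw [← Finset.mul_sum, Fintype.card_fin]
      have := sum_host_pow (B := B) (Nat.pos_of_ne_zero (NeZero.ne P))
        (addPending M x (pending M d l)) m
      calc _ ≤ expBase B ^ bwdCount M m d h l *
            (P * (1 + pendingExcess B P (addPending M x (pending M d l)))) := by gcongr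
        _ = _ := by ring
    · simp [bwdCount, pending, hx]
  refine (Finset.sum_le_sum (fun d _ => step d)).trans ?_
  rw [Finset.mul_sum]
  refine sum_update_le x (fun d => ?_)
  simp only [bwdCount_congr (hd _ d _) (fun _ _ => rfl), pending_congr (hd _ d _),
    Function.update_self]
  rw [Finset.sum_comm, Finset.mul_sum, Finset.mul_sum]
  refine Finset.sum_le_sum (fun h _ => ?_)
  rw [← Finset.mul_sum, sum_fin_ite_val_eq_zero hB, Fintype.card_fin]
  have key := pendingExcess_addPending_le (P := P) (M := M) hB x (pending M d l)
  calc _ = expBase B ^ bwdCount M m d h l *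
        ((B : ℝ) + (2 * B - 1) * pendingExcess B P (addPending M x (pending M d l))) := by ring
    _ ≤ expBase B ^ bwdCount M m d h l *
        (B * (markFactor M P x * (1 + 2 * pendingExcess B P (pending M d l)))) := by gcongr
    _ = _ := by ring

theorem sum_bwd_le_prod [NeZero P] (hB : 1 ≤ B) : ∀ {l : List ι}, l.Nodup →
    ∑ d : ι → Fin B, ∑ h : ι → Fin P, expBase B ^ bwdCount M m d h l *
        (1 + 2 * pendingExcess B P (pending M d l)) ≤
      (l.map (markFactor M P)).prod *
        (Fintype.card (ι → Fin B) * Fintype.card (ι → Fin P))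
  | [], _ => by simp [bwdCount, pending, pendingExcess]
  | x :: l, hl => by
    refine (sum_bwd_step hB hl).trans ?_
    have h1 := one_le_markFactor (P := P) M x
    refine (mul_le_mul_of_nonneg_left (sum_bwd_le_prod hB (List.nodup_cons.1 hl).2)
      (by linarith)).trans (le_of_eq ?_)
    simp only [List.map_cons, List.prod_cons]
    ring

/-- The exponential moment of the backward count, including the first gap with pivot `b`. -/
theorem sum_pow_bwdCount_le [NeZero P] (hB : 1 ≤ B) {l : List ι} (hl : (b :: l).Nodup) :
    ∑ d : ι → Fin B, ∑ h : ι → Fin P, expBase B ^ (bwdCount M m d h l +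
        if h b = m then addPending M b (pending M d l) else 0) ≤
      (1 + 2 / (P : ℝ)) ^ M.card * (Fintype.card (ι → Fin B) * Fintype.card (ι → Fin P)) := by
  have hz := @one_le_expBase B
  have hB' : (1 : ℝ) ≤ B := by exact_mod_cast hB
  obtain ⟨hbl, hl'⟩ := List.nodup_cons.1 hl
  have hk := one_le_markFactor (P := P) M b
  calc ∑ d : ι → Fin B, ∑ h : ι → Fin P, expBase B ^ (bwdCount M m d h l +
        if h b = m then addPending M b (pending M d l) else 0)
      ≤ ∑ d : ι → Fin B, ∑ h : ι → Fin P, markFactor M P b * (expBase B ^ bwdCount M m d h l *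
        (1 + 2 * pendingExcess B P (pending M d l))) := by
        refine Finset.sum_le_sum (fun d _ => sum_update_le b (fun h => ?_))
        have hd : ∀ a : Fin P, ∀ y ∈ l, Function.update h b a y = h y := fun a y hy => by
          rw [Function.update_of_ne]
          rintro rfl
          exact hbl hy
        simp only [bwdCount_congr (fun _ _ => rfl) (hd _), Function.update_self, pow_add]
        rw [← Finset.mul_sum, Fintype.card_fin]
        have h1 := sum_host_pow (B := B) (Nat.pos_of_ne_zero (NeZero.ne P))
          (addPending M b (pending M d l)) m
        have h2 : 1 + pendingExcess B P (addPending M b (pending M d l)) ≤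
            markFactor M P b * (1 + 2 * pendingExcess B P (pending M d l)) := by
          have key := pendingExcess_addPending_le (P := P) (M := M) hB b (pending M d l)
          have h3 := @pendingExcess_nonneg B P (addPending M b (pending M d l))
          nlinarith
        calc _ ≤ expBase B ^ bwdCount M m d h l *
              (P * (1 + pendingExcess B P (addPending M b (pending M d l)))) := by gcongr
          _ ≤ expBase B ^ bwdCount M m d h l *
              (P * (markFactor M P b * (1 + 2 * pendingExcess B P (pending M d l)))) := by gcongr
          _ = _ := by ring
    _ = markFactor M P b * ∑ d : ι → Fin B, ∑ h : ι → Fin P, (expBase B ^ bwdCount M m d h l *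
        (1 + 2 * pendingExcess B P (pending M d l))) := by
        simp only [Finset.mul_sum]
    _ ≤ markFactor M P b * ((l.map (markFactor M P)).prod *
        (Fintype.card (ι → Fin B) * Fintype.card (ι → Fin P))) :=
        mul_le_mul_of_nonneg_left (sum_bwd_le_prod hB hl') (by linarith)
    _ = ((b :: l).map (markFactor M P)).prod *
        (Fintype.card (ι → Fin B) * Fintype.card (ι → Fin P)) := by
        simp only [List.map_cons, List.prod_cons]
        ring
    _ ≤ _ := by
        gcongr
        exact prod_markFactor_le M hl

end Backward

end Gaps
/-! ### The counts cover the marked gaps -/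

section Cover

variable {ι : Type*} [LinearOrder ι] {B P : ℕ} {b : ι} {M : Finset ι} {m : Fin P}
  {d : ι → Fin B} {h : ι → Fin P}

theorem lastPivot_eq_and_marked {p : ι} : ∀ {l : List ι}, l.Pairwise (· > ·) → (∀ y ∈ l, b < y) →
    (p = b ∨ p ∈ l ∧ (d p).1 = 0) → (∀ y ∈ l, (d y).1 = 0 → y ≤ p) →
    lastPivot b d l = p ∧ ((∃ y ∈ M, p ≤ y ∧ y ∈ b :: l) → Marked b M d l)
  | [], _, _, hp, _ => by
    have hp : p = b := by simpa using hp
    exact ⟨hp.symm, fun ⟨y, hy, _, hyb⟩ => by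
      have : y = b := by simpa using hyb
      exact this ▸ hy⟩
  | x :: l, hl, hb, hp, hmax => by
    obtain ⟨hx, hl'⟩ := List.pairwise_cons.1 hl
    have hbx := hb x (by simp)
    by_cases hd : (d x).1 = 0
    · have hxp := hmax x (by simp) hd
      have hpx : p = x := by
        rcases hp with rfl | ⟨hp, -⟩
        · exact absurd hxp (not_le.2 hbx)
        · rcases List.mem_cons.1 hp with h | h
          · exact h
          · exact absurd hxp (not_le.2 (hx p h))
      refine ⟨by rw [lastPivot, if_pos hd, hpx], ?_⟩
      rintro ⟨y, hyM, hpy, hy⟩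
      rw [hpx] at hpy
      rcases List.mem_cons.1 hy with rfl | hy
      · exact absurd hpy (not_le.2 hbx)
      rcases List.mem_cons.1 hy with rfl | hy
      · exact Or.inl hyM
      · exact absurd hpy (not_le.2 (hx y hy))
    · have hp' : p = b ∨ p ∈ l ∧ (d p).1 = 0 := by
        rcases hp with hp | ⟨hp, hp0⟩
        · exact Or.inl hp
        · rcases List.mem_cons.1 hp with rfl | h
          · exact absurd hp0 hd
          · exact Or.inr ⟨h, hp0⟩
      have ih := lastPivot_eq_and_marked (l := l) hl' (fun y hy => hb y (by simp [hy])) hp'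
        (fun y hy => hmax y (by simp [hy]))
      refine ⟨by rw [lastPivot, if_neg hd, ih.1], ?_⟩
      rintro ⟨y, hyM, hpy, hy⟩
      by_cases hyx : y = x
      · exact Or.inl (hyx ▸ hyM)
      · refine Or.inr ⟨hd, ih.2 ⟨y, hyM, hpy, ?_⟩⟩
        simpa [hyx] using hy

open Classical in
theorem card_le_fwdCount : ∀ {l : List ι}, l.Pairwise (· > ·) → (∀ y ∈ l, b < y) →
    ∀ s : Finset ι, (∀ x ∈ s, x ∈ b :: l ∧ ∃ p, (p = b ∨ p ∈ l ∧ (d p).1 = 0) ∧ p ≤ x ∧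
      (∀ y ∈ l, (d y).1 = 0 → y ≤ x → y ≤ p) ∧ h p = m ∧ ∃ y ∈ M, p ≤ y ∧ y ≤ x ∧ y ∈ b :: l) →
    s.card ≤ fwdCount b M m d h l
  | [], _, _, s, hs => by
    rcases s.eq_empty_or_nonempty with rfl | ⟨x, hx⟩
    · simp
    have hsb : s ⊆ {b} := fun u hu => by simpa using (hs u hu).1
    obtain ⟨-, p, hp, -, -, hm, y, hyM, -, -, hy⟩ := hs x hx
    have hp : p = b := by simpa using hp
    have hy : y = b := by simpa using hy
    have hA : Active b M m d h [] := ⟨hy ▸ hyM, by rw [lastPivot, ← hp, hm]⟩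
    rw [fwdCount, if_pos hA]
    simpa using Finset.card_le_card hsb
  | x :: l, hl, hb, s, hs => by
    obtain ⟨hx, hl'⟩ := List.pairwise_cons.1 hl
    have hb' : ∀ y ∈ l, b < y := fun y hy => hb y (by simp [hy])
    have ih := card_le_fwdCount hl' hb' (s.erase x) (fun u hu => by
      obtain ⟨hux, hus⟩ := Finset.mem_erase.1 hu
      obtain ⟨hu1, p, hp, hpu, hmax, hm, y, hyM, hpy, hyu, hy⟩ := hs u hus
      have hu2 : u ∈ b :: l := by simpa [hux] using hu1
      have hltx : u < x := by
        rcases List.mem_cons.1 hu2 with rfl | hu2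
        · exact hb x (by simp)
        · exact hx u hu2
      refine ⟨hu2, p, ?_, hpu, fun y hy => hmax y (by simp [hy]), hm, y, hyM, hpy, hyu, ?_⟩
      · have : p ≠ x := (hpu.trans_lt hltx).ne
        simpa [this] using hp
      · have : y ≠ x := (hyu.trans_lt hltx).ne
        simpa [this] using hy)
    rw [fwdCount]
    by_cases hxs : x ∈ s
    · obtain ⟨-, p, hp, -, hmax, hm, y, hyM, hpy, -, hy⟩ := hs x hxs
      have hle : ∀ y ∈ x :: l, y ≤ x := by
        intro y hy
        rcases List.mem_cons.1 hy with rfl | hy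
        · exact le_rfl
        · exact (hx y hy).le
      obtain ⟨h1, h2⟩ := lastPivot_eq_and_marked (M := M) hl hb hp
        (fun y hy h0 => hmax y hy h0 (hle y hy))
      rw [if_pos ⟨h2 ⟨y, hyM, hpy, hy⟩, by rw [h1, hm]⟩]
      rw [Finset.card_erase_of_mem hxs] at ih
      omega
    · rw [Finset.erase_eq_of_notMem hxs] at ih
      omega

/-- The elements of a set that lie below a mark in the open gap of `x :: l`, where `x` is added
below `l`. -/
theorem card_le_addPending {x : ι} {l : List ι} {c : ℕ} (hx : ∀ y ∈ l, x < y)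
    (ih : ∀ s : Finset ι, (∀ u ∈ s, u ∈ l ∧ ∃ y ∈ M, y ∈ l ∧ u ≤ y ∧
      ∀ v ∈ l, (d v).1 = 0 → y < v) → s.card ≤ c)
    (s : Finset ι) (hs : ∀ u ∈ s, u ∈ x :: l ∧ ∃ y ∈ M, y ∈ x :: l ∧ u ≤ y ∧
      ∀ v ∈ l, (d v).1 = 0 → y < v) : s.card ≤ addPending M x c := by
  have h1 := ih (s.erase x) (fun u hu => by
    obtain ⟨hux, hus⟩ := Finset.mem_erase.1 hu
    obtain ⟨hu, y, hyM, hy, huy, hv⟩ := hs u hus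
    have hu' : u ∈ l := by simpa [hux] using hu
    have hyx : y ≠ x := ((hx u hu').trans_le huy).ne'
    exact ⟨hu', y, hyM, by simpa [hyx] using hy, huy, hv⟩)
  unfold addPending
  by_cases hxs : x ∈ s
  · obtain ⟨-, y, hyM, hy, -, hv⟩ := hs x hxs
    have hcond : x ∈ M ∨ 0 < c := by
      rcases List.mem_cons.1 hy with rfl | hy
      · exact Or.inl hyM
      · right
        have := ih {y} (fun u hu => by
          rw [Finset.mem_singleton] at hu
          subst hu
          exact ⟨hy, u, hyM, hy, le_rfl, hv⟩)
        exact Nat.lt_of_lt_of_le Nat.one_pos (by simpa using this)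
    rw [if_pos hcond]
    rw [Finset.card_erase_of_mem hxs] at h1
    omega
  · rw [Finset.erase_eq_of_notMem hxs] at h1
    split_ifs <;> omega

theorem card_le_pending : ∀ {l : List ι}, l.Pairwise (· < ·) →
    ∀ s : Finset ι, (∀ u ∈ s, u ∈ l ∧ ∃ y ∈ M, y ∈ l ∧ u ≤ y ∧
      ∀ v ∈ l, (d v).1 = 0 → y < v) → s.card ≤ pending M d l
  | [], _, s, hs => by
    have : s = ∅ := Finset.eq_empty_of_forall_notMem (fun u hu => by simpa using (hs u hu).1)
    simp [this]
  | x :: l, hl, s, hs => by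
    obtain ⟨hx, hl'⟩ := List.pairwise_cons.1 hl
    rw [pending]
    split_ifs with hd
    · have : s = ∅ := Finset.eq_empty_of_forall_notMem (fun u hu => by
        obtain ⟨hu, y, -, -, huy, hv⟩ := hs u hu
        have h1 := huy.trans_lt (hv x (by simp) hd)
        rcases List.mem_cons.1 hu with rfl | hu
        · exact lt_irrefl _ h1
        · exact lt_asymm h1 (hx u hu))
      simp [this]
    · exact card_le_addPending hx (card_le_pending hl') s (fun u hu => by
        obtain ⟨hu, y, hyM, hy, huy, hv⟩ := hs u hu
        exact ⟨hu, y, hyM, hy, huy, fun v hv' => hv v (by simp [hv'])⟩)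

open Classical in
/-- One more element `x`, a pivot if `σ` holds, is added below an increasing list. -/
theorem card_le_bwd_cons {x : ι} {l : List ι} {n : ℕ} {σ : Prop} (hl : l.Pairwise (· < ·))
    (hx : ∀ y ∈ l, x < y)
    (ih : ∀ s : Finset ι, (∀ u ∈ s, u ∈ l ∧ ∃ p, p ≤ u ∧ h p = m ∧ p ∈ l ∧ (d p).1 = 0 ∧
      ∃ y ∈ M, y ∈ l ∧ u ≤ y ∧ ∀ v ∈ l, (d v).1 = 0 → v ≤ y → v ≤ p) → s.card ≤ n)
    (s : Finset ι) (hs : ∀ u ∈ s, u ∈ x :: l ∧ ∃ p, p ≤ u ∧ h p = m ∧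
      (p = x ∧ σ ∨ p ∈ l ∧ (d p).1 = 0) ∧
      ∃ y ∈ M, y ∈ x :: l ∧ u ≤ y ∧ ∀ v ∈ l, (d v).1 = 0 → v ≤ y → v ≤ p) :
    s.card ≤ n + if σ ∧ h x = m then addPending M x (pending M d l) else 0 := by
  let c : ι → Prop := fun u => ∃ p, p ≤ u ∧ h p = m ∧ p ∈ l ∧ (d p).1 = 0 ∧
      ∃ y ∈ M, y ∈ l ∧ u ≤ y ∧ ∀ v ∈ l, (d v).1 = 0 → v ≤ y → v ≤ p
  rw [← Finset.card_filter_add_card_filter_not c]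
  refine add_le_add (ih _ (fun u hu => ?_)) ?_
  · obtain ⟨hus, hc⟩ := Finset.mem_filter.1 hu
    refine ⟨?_, hc⟩
    obtain ⟨p, hpu, -, hp, -⟩ := hc
    have : u ≠ x := ((hx p hp).trans_le hpu).ne'
    simpa [this] using (hs u hus).1
  · -- the remaining elements belong to the gap with pivot `x`
    have key : ∀ u ∈ s.filter (fun u => ¬ c u), (σ ∧ h x = m) ∧
        ∃ y ∈ M, y ∈ x :: l ∧ u ≤ y ∧ ∀ v ∈ l, (d v).1 = 0 → y < v := by
      intro u hu
      obtain ⟨hus, hc⟩ := Finset.mem_filter.1 hu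
      obtain ⟨-, p, hpu, hm, hp, y, hyM, hy, huy, hv⟩ := hs u hus
      rcases hp with ⟨rfl, hσ⟩ | ⟨hp, hp0⟩
      · refine ⟨⟨hσ, hm⟩, y, hyM, hy, huy, fun v hvl h0 => ?_⟩
        by_contra hvy
        exact absurd (hv v hvl h0 (not_lt.1 hvy)) (not_le.2 (hx v hvl))
      · refine absurd ⟨p, hpu, hm, hp, hp0, y, hyM, ?_, huy, hv⟩ hc
        have : y ≠ x := ((hx p hp).trans_le (hpu.trans huy)).ne'
        simpa [this] using hy
    split_ifs with hcond
    · exact card_le_addPending hx (card_le_pending hl) _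
        (fun u hu => ⟨(hs u (Finset.mem_filter.1 hu).1).1, (key u hu).2⟩)
    · rw [Finset.card_eq_zero.2]
      exact Finset.eq_empty_of_forall_notMem (fun u hu => hcond (key u hu).1)

theorem card_le_bwdCount : ∀ {l : List ι}, l.Pairwise (· < ·) →
    ∀ s : Finset ι, (∀ u ∈ s, u ∈ l ∧ ∃ p, p ≤ u ∧ h p = m ∧ p ∈ l ∧ (d p).1 = 0 ∧
      ∃ y ∈ M, y ∈ l ∧ u ≤ y ∧ ∀ v ∈ l, (d v).1 = 0 → v ≤ y → v ≤ p) →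
    s.card ≤ bwdCount M m d h l
  | [], _, s, hs => by
    have : s = ∅ := Finset.eq_empty_of_forall_notMem (fun u hu => by simpa using (hs u hu).1)
    simp [this]
  | x :: l, hl, s, hs => by
    obtain ⟨hx, hl'⟩ := List.pairwise_cons.1 hl
    have := card_le_bwd_cons (σ := (d x).1 = 0) hl' hx (card_le_bwdCount hl') s (fun u hu => by
      obtain ⟨hu, p, hpu, hm, hp, hp0, y, hyM, hy, huy, hv⟩ := hs u hu
      refine ⟨hu, p, hpu, hm, ?_, y, hyM, hy, huy, fun v hv' => hv v (by simp [hv'])⟩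
      rcases List.mem_cons.1 hp with rfl | hp
      · exact Or.inl ⟨rfl, hp0⟩
      · exact Or.inr ⟨hp, hp0⟩)
    refine this.trans (le_of_eq ?_)
    rw [bwdCount]
    congr 1
    split_ifs <;> rfl

/-- The elements of the marked gaps that are hosted by `m` are covered by the two counts. -/
theorem card_le_fwdCount_add_bwdCount {l : List ι} (hl : l.Pairwise (· < ·))
    (hb : ∀ y ∈ l, b < y) (s : Finset ι) (hs : ∀ x ∈ s, x ∈ b :: l ∧
      ∃ p, (p = b ∨ p ∈ l ∧ (d p).1 = 0) ∧ p ≤ x ∧ h p = m ∧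
        (∀ v ∈ l, (d v).1 = 0 → v ≤ x → v ≤ p) ∧
        ∃ y ∈ M, y ∈ b :: l ∧ p ≤ y ∧ ∀ v ∈ l, (d v).1 = 0 → v ≤ y → v ≤ p) :
    s.card ≤ fwdCount b M m d h l.reverse +
      (bwdCount M m d h l + if h b = m then addPending M b (pending M d l) else 0) := by
  classical
  let c : ι → Prop := fun x => ∃ p, (p = b ∨ p ∈ l ∧ (d p).1 = 0) ∧ p ≤ x ∧
      (∀ y ∈ l, (d y).1 = 0 → y ≤ x → y ≤ p) ∧ h p = m ∧ ∃ y ∈ M, p ≤ y ∧ y ≤ x ∧ y ∈ b :: l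
  rw [← Finset.card_filter_add_card_filter_not c]
  refine add_le_add ?_ ?_
  · refine card_le_fwdCount (List.pairwise_reverse.2 hl) (by simpa using hb) _ (fun x hx => ?_)
    obtain ⟨hxs, hc⟩ := Finset.mem_filter.1 hx
    simp only [List.mem_reverse, List.mem_cons] at hc ⊢
    exact ⟨by simpa using (hs x hxs).1, by simpa [c] using hc⟩
  · have := card_le_bwd_cons (σ := True) (x := b) (M := M) (h := h) (m := m) hl hb
      (card_le_bwdCount hl) (s.filter (fun u => ¬ c u)) (fun u hu => by
        obtain ⟨hus, hc⟩ := Finset.mem_filter.1 hu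
        obtain ⟨hu1, p, hp, hpu, hm, hvu, y, hyM, hy, hpy, hv⟩ := hs u hus
        refine ⟨hu1, p, hpu, hm, hp.imp (fun h => ⟨h, trivial⟩) id, y, hyM, hy, ?_, hv⟩
        by_contra huy
        exact hc ⟨p, hp, hpu, hvu, hm, y, hyM, hpy, (not_le.1 huy).le, hy⟩)
    simpa using this

end Cover

/-! ### Marked queries -/

section Marks

variable {K : Type*} [LinearOrder K] {S : ℕ}

/-- Mark every `θ`-th query in sorted order. Then every interval of at least `θ` queries contains
a mark. -/
theorem exists_marks (Q : Fin S → K) {θ : ℕ} (hθ : 1 ≤ θ) :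
    ∃ M : Finset (Fin S), M.card * θ ≤ S ∧ ∀ s : Finset (Fin S),
      (∀ i ∈ s, ∀ k ∈ s, ∀ j, Q i ≤ Q j → Q j ≤ Q k → j ∈ s) → θ ≤ s.card → ∃ j ∈ s, j ∈ M := by
  let σ := Tuple.sort Q
  have hσ : Monotone (Q ∘ σ) := Tuple.monotone_sort Q
  refine ⟨Finset.univ.filter (fun j => θ ∣ (σ.symm j).1 + 1), ?_, ?_⟩
  · refine (Nat.le_div_iff_mul_le (by omega)).1 ?_
    have : (Finset.Icc 1 (S / θ)).card = S / θ := by simp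
    rw [← this]
    refine Finset.card_le_card_of_injOn (fun j => ((σ.symm j).1 + 1) / θ) ?_ ?_
    · intro j hj
      have hj : θ ∣ (σ.symm j).1 + 1 := by simpa using hj
      rw [Finset.mem_coe, Finset.mem_Icc]
      refine ⟨Nat.div_pos (Nat.le_of_dvd (by omega) hj) (by omega), Nat.div_le_div_right ?_⟩
      exact (σ.symm j).2
    · intro i hi j hj hij
      have hi : θ ∣ (σ.symm i).1 + 1 := by simpa using hi
      have hj : θ ∣ (σ.symm j).1 + 1 := by simpa using hj
      have h1 := (Nat.div_left_inj hi hj).1 hij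
      exact σ.symm.injective (Fin.ext (by omega))
  · intro s hs hcard
    have hne : (s.image σ.symm).Nonempty := by
      rw [Finset.image_nonempty, ← Finset.card_pos]; omega
    set a := (s.image σ.symm).min' hne with ha
    set c := (s.image σ.symm).max' hne with hc
    have hac : θ ≤ c.1 + 1 - a.1 := by
      refine hcard.trans ?_
      rw [← Finset.card_image_of_injective s σ.symm.injective, ← Fin.card_Icc]
      refine Finset.card_le_card (fun j hj => Finset.mem_Icc.2 ⟨?_, ?_⟩)
      · exact Finset.min'_le _ _ hj
      · exact Finset.le_max' _ _ hj
    have h1 := Nat.div_mul_le_self (a.1 + θ) θ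
    have h2 := Nat.lt_div_mul_add (a := a.1 + θ) (b := θ) (by omega)
    have hr : (a.1 + θ) / θ * θ - 1 < S := by have := c.2; omega
    refine ⟨σ ⟨(a.1 + θ) / θ * θ - 1, hr⟩, ?_, ?_⟩
    · have ha' := Finset.min'_mem _ hne
      have hc' := Finset.max'_mem _ hne
      rw [← ha] at ha'
      rw [← hc] at hc'
      obtain ⟨i, hi, hia⟩ := Finset.mem_image.1 ha'
      obtain ⟨k, hk, hkc⟩ := Finset.mem_image.1 hc'
      rw [Equiv.symm_apply_eq] at hia hkc
      refine hs i hi k hk _ ?_ ?_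
      · rw [hia]; exact hσ (Fin.le_def.2 (by simp only; omega))
      · rw [hkc]; exact hσ (Fin.le_def.2 (by simp only; omega))
    · simp only [Finset.mem_filter, Finset.mem_univ, true_and, Equiv.symm_apply_apply]
      rw [Nat.sub_add_cancel (by omega)]
      exact dvd_mul_left _ _

end Marks
/-! ### Tail bounds for the loads of the modules -/

section Tails

variable {K : Type*} [LinearOrder K] {D : Finset K} {P B S : ℕ}

theorem pos_congr {ω ω' : Sample D P B} {t : ℕ} (h : ∀ x, Reaches ω t x ↔ Reaches ω' t x)
    (q : K) : pos ω t q = pos ω' t q := by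
  simp only [pos, h]

/-- The pivots of the level `t` with more than `θ` queries. -/
def hotSlots (ω : Sample D P B) (Q : Fin S → K) (θ t : ℕ) : Finset (Slot D) :=
  Finset.univ.filter (fun x => θ < (Finset.univ.filter (fun i => pos ω t (Q i) = x)).card)

/-- The total length of the chunks of level `t` that have more than `θ` queries and are hosted by
the module `m`. -/
def pulledLength (ω : Sample D P B) (Q : Fin S → K) (θ : ℕ) (t : Fin (height B P + 1))
    (m : Fin P) : ℕ :=
  ∑ p ∈ (hotSlots ω Q θ t).filter (fun p => ω.2 t p = m), (chunk ω (t, p)).length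

/-- The dice that decide which of the keys on the level below `t` are pivots of the level `t`. -/
def levelDice (ω : Sample D P B) {t : Fin (height B P + 1)} (ht : 1 ≤ t.1) (x : Slot D) : Fin B :=
  ω.1 x ⟨t.1 - 1, by omega⟩

/-- The keys (without the sentinel) that go up all levels below `t`. -/
def lowerKeys (ω : Sample D P B) (t : Fin (height B P + 1)) : List (Slot D) :=
  ((Finset.univ.filter (fun x : Slot D => Reaches ω (t.1 - 1) x)).erase (botSlot D)).sort (· ≤ ·)

theorem mem_lowerKeys {ω : Sample D P B} {t : Fin (height B P + 1)} {x : Slot D} :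
    x ∈ lowerKeys ω t ↔ x ≠ botSlot D ∧ Reaches ω (t.1 - 1) x := by
  simp [lowerKeys]

theorem mem_botSlot_cons_lowerKeys {ω : Sample D P B} {t : Fin (height B P + 1)} {x : Slot D} :
    x ∈ botSlot D :: lowerKeys ω t ↔ Reaches ω (t.1 - 1) x := by
  rw [List.mem_cons, mem_lowerKeys]
  by_cases h : x = botSlot D
  · subst h
    simp [reaches_botSlot]
  · simp [h]

theorem lowerKeys_pairwise (ω : Sample D P B) (t : Fin (height B P + 1)) :
    (lowerKeys ω t).Pairwise (· < ·) := (Finset.sortedLT_sort _).pairwise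

theorem botSlot_lt_of_mem_lowerKeys {ω : Sample D P B} {t : Fin (height B P + 1)} {x : Slot D}
    (h : x ∈ lowerKeys ω t) : botSlot D < x :=
  lt_of_le_of_ne (botSlot_le x) (mem_lowerKeys.1 h).1.symm

theorem nodup_botSlot_cons_lowerKeys (ω : Sample D P B) (t : Fin (height B P + 1)) :
    (botSlot D :: lowerKeys ω t).Nodup :=
  List.nodup_cons.2 ⟨fun h => (mem_lowerKeys.1 h).1 rfl, Finset.sort_nodup _ _⟩

theorem reaches_iff_levelDice (ω : Sample D P B) {t : Fin (height B P + 1)} (ht : 1 ≤ t.1)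
    (x : Slot D) : Reaches ω t.1 x ↔
      x = botSlot D ∨ x ∈ lowerKeys ω t ∧ (levelDice ω ht x).1 = 0 := by
  rw [mem_lowerKeys]
  by_cases hx : x = botSlot D
  · subst hx
    simp [reaches_botSlot]
  have hx' : x.1 ≠ ⊥ := fun h => hx (Subtype.ext h)
  simp only [Reaches, hx, hx', false_or, ne_eq, not_false_eq_true, true_and, levelDice]
  constructor
  · intro h
    exact ⟨fun i hi => h i (by omega), h _ (by simp only; omega)⟩
  · rintro ⟨h1, h2⟩ i hi
    rcases Nat.lt_or_ge i.1 (t.1 - 1) with h | h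
    · exact h1 i h
    · have : i = ⟨t.1 - 1, by omega⟩ := Fin.ext (by simp only; omega)
      rw [this]; exact h2

/-- The marks on the level below `t`: the pivots of the nodes of the marked queries. -/
def marks (ω : Sample D P B) (Q : Fin S → K) (Mq : Finset (Fin S)) (t : Fin (height B P + 1)) :
    Finset (Slot D) := Mq.image (fun i => pos ω (t.1 - 1) (Q i))

/-- The number of elements of marked gaps at or above the first mark. -/
noncomputable def fwdPart (ω : Sample D P B) (Q : Fin S → K) (Mq : Finset (Fin S))
    {t : Fin (height B P + 1)} (ht : 1 ≤ t.1) (m : Fin P) : ℕ :=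
  fwdCount (botSlot D) (marks ω Q Mq t) m (levelDice ω ht) (ω.2 t) (lowerKeys ω t).reverse

/-- The number of elements of marked gaps at or below the last mark. -/
noncomputable def bwdPart (ω : Sample D P B) (Q : Fin S → K) (Mq : Finset (Fin S))
    {t : Fin (height B P + 1)} (ht : 1 ≤ t.1) (m : Fin P) : ℕ :=
  bwdCount (marks ω Q Mq t) m (levelDice ω ht) (ω.2 t) (lowerKeys ω t) +
    if ω.2 t (botSlot D) = m then addPending (marks ω Q Mq t) (botSlot D)
      (pending (marks ω Q Mq t) (levelDice ω ht) (lowerKeys ω t)) else 0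

theorem length_chunk (ω : Sample D P B) (a : Addr D P B) : (chunk ω a).length =
    (Finset.univ.filter (fun x : Slot D => Reaches ω (a.1.1 - 1) x ∧ InRange ω a x)).card := by
  simp only [chunk, List.length_map, Finset.length_sort]

theorem exists_query_of_mem_hotSlots {ω : Sample D P B} {Q : Fin S → K} {θ t : ℕ} {p : Slot D}
    (h : p ∈ hotSlots ω Q θ t) : ∃ i, pos ω t (Q i) = p := by
  have h1 := (Finset.mem_filter.1 h).2
  obtain ⟨i, hi⟩ := Finset.card_pos.1 ((Nat.zero_le θ).trans_lt h1)
  exact ⟨i, by simpa using hi⟩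

/-- Every chunk with more than `θ` queries contains a mark, so that the lengths of these chunks are
covered by the two counts. -/
theorem pulledLength_le (ω : Sample D P B) (Q : Fin S → K) {θ : ℕ} {Mq : Finset (Fin S)}
    (hMq : ∀ s : Finset (Fin S),
      (∀ i ∈ s, ∀ k ∈ s, ∀ j, Q i ≤ Q j → Q j ≤ Q k → j ∈ s) → θ ≤ s.card → ∃ j ∈ s, j ∈ Mq)
    {t : Fin (height B P + 1)} (ht : 1 ≤ t.1) (m : Fin P) :
    pulledLength ω Q θ t m ≤ fwdPart ω Q Mq ht m + bwdPart ω Q Mq ht m := by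
  have hdisj : ∀ p ∈ (hotSlots ω Q θ t).filter (fun p => ω.2 t p = m),
      ∀ p' ∈ (hotSlots ω Q θ t).filter (fun p => ω.2 t p = m), p ≠ p' →
      Disjoint
        (Finset.univ.filter (fun x : Slot D => Reaches ω (t.1 - 1) x ∧ InRange ω (t, p) x))
        (Finset.univ.filter (fun x : Slot D => Reaches ω (t.1 - 1) x ∧ InRange ω (t, p') x)) := by
    intro p hp p' hp' hne
    obtain ⟨i, rfl⟩ := exists_query_of_mem_hotSlots (Finset.mem_filter.1 hp).1
    obtain ⟨k, rfl⟩ := exists_query_of_mem_hotSlots (Finset.mem_filter.1 hp').1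
    rw [Finset.disjoint_left]
    intro x hx hx'
    obtain ⟨-, h1, h2⟩ := (Finset.mem_filter.1 hx).2
    obtain ⟨-, h3, h4⟩ := (Finset.mem_filter.1 hx').2
    rcases lt_or_gt_of_ne hne with h | h
    · exact h2 _ h h3 (pos_reaches ω t (Q k))
    · exact h4 _ h h1 (pos_reaches ω t (Q i))
  unfold pulledLength
  simp only [length_chunk]
  rw [← Finset.card_biUnion hdisj]
  refine card_le_fwdCount_add_bwdCount (lowerKeys_pairwise ω t)
    (fun y hy => botSlot_lt_of_mem_lowerKeys hy) _ (fun x hx => ?_)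
  obtain ⟨p, hp, hx⟩ := Finset.mem_biUnion.1 hx
  obtain ⟨hx1, hpx, hrange⟩ := (Finset.mem_filter.1 hx).2
  obtain ⟨hhot, hm⟩ := Finset.mem_filter.1 hp
  refine ⟨mem_botSlot_cons_lowerKeys.2 hx1, p, ?_, hpx, hm, ?_, ?_⟩
  · obtain ⟨i, rfl⟩ := exists_query_of_mem_hotSlots hhot
    exact (reaches_iff_levelDice ω ht _).1 (pos_reaches ω t (Q i))
  · intro v hv h0 hvx
    by_contra hvp
    exact hrange v (not_le.1 hvp) hvx ((reaches_iff_levelDice ω ht v).2 (Or.inr ⟨hv, h0⟩))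
  · obtain ⟨j, hj, hjM⟩ := hMq (Finset.univ.filter (fun i => pos ω t (Q i) = p)) (by
      intro i hi k hk j hij hjk
      simp only [Finset.mem_filter, Finset.mem_univ, true_and] at hi hk ⊢
      exact le_antisymm (hk ▸ pos_monotone ω t hjk) (hi ▸ pos_monotone ω t hij))
      (Finset.mem_filter.1 hhot).2.le
    have hj : pos ω t (Q j) = p := by simpa using hj
    refine ⟨pos ω (t.1 - 1) (Q j), Finset.mem_image_of_mem _ hjM,
      mem_botSlot_cons_lowerKeys.2 (pos_reaches ω _ _), ?_, ?_⟩
    · rw [← hj]; exact pos_antitone (Nat.sub_le _ _) _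
    · intro v hv h0 hvy
      rw [← hj]
      exact le_pos ((reaches_iff_levelDice ω ht v).2 (Or.inr ⟨hv, h0⟩))
        (le_trans (Subtype.coe_le_coe.2 hvy) (pos_le ω _ _))

/-- Redraw the dice that decide the pivots of the level `t`, and the hosts of this level. -/
def redraw (t : Fin (height B P + 1)) (ht : 1 ≤ t.1) (ω : Sample D P B)
    (θ : (Slot D → Fin B) × (Slot D → Fin P)) : Sample D P B :=
  (fun x => Function.update (ω.1 x) ⟨t.1 - 1, by omega⟩ (θ.1 x), Function.update ω.2 t θ.2)

theorem reaches_redraw {t : Fin (height B P + 1)} (ht : 1 ≤ t.1) (ω : Sample D P B)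
    (θ : (Slot D → Fin B) × (Slot D → Fin P)) (x : Slot D) :
    Reaches (redraw t ht ω θ) (t.1 - 1) x ↔ Reaches ω (t.1 - 1) x := by
  unfold Reaches redraw
  refine or_congr Iff.rfl (forall_congr' fun i => forall_congr' fun hi => ?_)
  have hne : i ≠ ⟨t.1 - 1, by omega⟩ := by
    intro h
    have h1 := congrArg Fin.val h
    simp only at h1
    omega
  simp only [Function.update_of_ne hne]

theorem lowerKeys_redraw {t : Fin (height B P + 1)} (ht : 1 ≤ t.1) (ω : Sample D P B)
    (θ : (Slot D → Fin B) × (Slot D → Fin P)) : lowerKeys (redraw t ht ω θ) t = lowerKeys ω t := by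
  simp only [lowerKeys, reaches_redraw]

theorem marks_redraw {t : Fin (height B P + 1)} (ht : 1 ≤ t.1) (ω : Sample D P B)
    (θ : (Slot D → Fin B) × (Slot D → Fin P)) (Q : Fin S → K) (Mq : Finset (Fin S)) :
    marks (redraw t ht ω θ) Q Mq t = marks ω Q Mq t := by
  simp only [marks, pos_congr (reaches_redraw ht ω θ)]

theorem levelDice_redraw {t : Fin (height B P + 1)} (ht : 1 ≤ t.1) (ω : Sample D P B)
    (θ : (Slot D → Fin B) × (Slot D → Fin P)) : levelDice (redraw t ht ω θ) ht = θ.1 := by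
  funext x
  simp [levelDice, redraw]

theorem hosts_redraw {t : Fin (height B P + 1)} (ht : 1 ≤ t.1) (ω : Sample D P B)
    (θ : (Slot D → Fin B) × (Slot D → Fin P)) : (redraw t ht ω θ).2 t = θ.2 := by
  simp [redraw]

theorem redraw_redraw {t : Fin (height B P + 1)} (ht : 1 ≤ t.1) (ω : Sample D P B)
    (θ : (Slot D → Fin B) × (Slot D → Fin P)) :
    redraw t ht (redraw t ht ω θ) (levelDice ω ht, ω.2 t) = ω := by
  simp [redraw, levelDice]

/-- It suffices to bound a moment for given dice of the lower levels. -/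
theorem sum_le_of_redraw [NeZero P] (hB : 1 ≤ B) {t : Fin (height B P + 1)} (ht : 1 ≤ t.1)
    {g : Sample D P B → ℝ} {C : ℝ}
    (hg : ∀ ω, ∑ d : Slot D → Fin B, ∑ h : Slot D → Fin P, g (redraw t ht ω (d, h)) ≤
      C * (Fintype.card (Slot D → Fin B) * Fintype.card (Slot D → Fin P))) :
    ∑ ω, g ω ≤ C * Fintype.card (Sample D P B) := by
  have : NeZero B := ⟨by omega⟩
  have h := sum_le_of_resample (redraw (D := D) t ht) (fun ω => (levelDice ω ht, ω.2 t))
    (fun ω θ => redraw_redraw ht ω θ)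
    (fun ω θ => Prod.ext (levelDice_redraw ht ω θ) (hosts_redraw ht ω θ)) (g := g)
    (f := fun _ => C) (fun ω => by
      rw [Fintype.sum_prod_type, Fintype.card_prod]
      refine (hg ω).trans (le_of_eq ?_)
      push_cast
      ring)
  refine h.trans (le_of_eq ?_)
  rw [Finset.sum_const, Finset.card_univ, nsmul_eq_mul, mul_comm]

theorem card_marks_le (ω : Sample D P B) (Q : Fin S → K) (Mq : Finset (Fin S))
    (t : Fin (height B P + 1)) : (marks ω Q Mq t).card ≤ Mq.card := Finset.card_image_le

theorem sum_pow_fwdPart_le [NeZero P] (hB : 1 ≤ B) (Q : Fin S → K) (Mq : Finset (Fin S))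
    {t : Fin (height B P + 1)} (ht : 1 ≤ t.1) (m : Fin P) :
    ∑ ω : Sample D P B, expBase B ^ fwdPart ω Q Mq ht m ≤
      (1 + 2 / (P : ℝ)) ^ Mq.card * Fintype.card (Sample D P B) := by
  refine sum_le_of_redraw hB ht (fun ω => ?_)
  simp only [fwdPart, lowerKeys_redraw, marks_redraw, levelDice_redraw, hosts_redraw]
  refine (sum_pow_fwdCount_le hB ?_).trans ?_
  · have := nodup_botSlot_cons_lowerKeys ω t
    simpa using this
  · have : (0 : ℝ) ≤ 2 / P := by positivity
    refine mul_le_mul_of_nonneg_right ?_ (by positivity)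
    exact pow_le_pow_right₀ (by linarith) (card_marks_le _ _ _ _)

theorem sum_pow_bwdPart_le [NeZero P] (hB : 1 ≤ B) (Q : Fin S → K) (Mq : Finset (Fin S))
    {t : Fin (height B P + 1)} (ht : 1 ≤ t.1) (m : Fin P) :
    ∑ ω : Sample D P B, expBase B ^ bwdPart ω Q Mq ht m ≤
      (1 + 2 / (P : ℝ)) ^ Mq.card * Fintype.card (Sample D P B) := by
  refine sum_le_of_redraw hB ht (fun ω => ?_)
  simp only [bwdPart, lowerKeys_redraw, marks_redraw, levelDice_redraw, hosts_redraw]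
  refine (sum_pow_bwdCount_le hB (nodup_botSlot_cons_lowerKeys ω t)).trans ?_
  have : (0 : ℝ) ≤ 2 / P := by positivity
  refine mul_le_mul_of_nonneg_right ?_ (by positivity)
  exact pow_le_pow_right₀ (by linarith) (card_marks_le _ _ _ _)

theorem exp_le_expBase_pow (hB : 1 ≤ B) (n : ℕ) :
    Real.exp (n / (4 * B)) ≤ expBase B ^ n := by
  have hB' : (1 : ℝ) ≤ B := by exact_mod_cast hB
  have h0 : (0 : ℝ) ≤ 1 / (4 * B) := by positivity
  have h1 : (1 : ℝ) / (4 * B) ≤ 1 := by rw [div_le_one (by positivity)]; linarith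
  have h2 := (abs_le.1 (Real.abs_exp_sub_one_le (x := (1 : ℝ) / (4 * B))
    (by rwa [abs_of_nonneg h0]))).2
  rw [abs_of_nonneg h0] at h2
  have h3 : Real.exp (1 / (4 * B)) ≤ expBase B := by
    have : (2 : ℝ) * (1 / (4 * B)) = 1 / (2 * B) := by field_simp; norm_num
    unfold expBase
    linarith
  calc Real.exp (n / (4 * B)) = Real.exp (1 / (4 * B)) ^ n := by
        rw [← Real.exp_nat_mul]; congr 1; ring
    _ ≤ expBase B ^ n := pow_le_pow_left₀ (Real.exp_nonneg _) h3 n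

theorem nonempty_sample [NeZero P] (hB : 1 ≤ B) : Nonempty (Sample D P B) := by
  have : NeZero B := ⟨by omega⟩
  infer_instance

theorem one_add_pow_le_exp {θ n : ℕ} (hθ : 1 ≤ θ) (hn : n * θ ≤ S) :
    (1 + 2 / (P : ℝ)) ^ n ≤ Real.exp (2 * S / (θ * P)) := by
  have hθ' : (0 : ℝ) < θ := by exact_mod_cast hθ
  have h1 : 1 + 2 / (P : ℝ) ≤ Real.exp (2 / P) := by
    rw [add_comm]; exact Real.add_one_le_exp _
  have h0 : (0 : ℝ) ≤ 2 / P := by positivity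
  have h2 : (n : ℝ) ≤ S / θ := by
    rw [le_div_iff₀ hθ']; exact_mod_cast hn
  calc (1 + 2 / (P : ℝ)) ^ n ≤ Real.exp (2 / P) ^ n := pow_le_pow_left₀ (by linarith) h1 n
    _ = Real.exp (n * (2 / P)) := by rw [← Real.exp_nat_mul]
    _ ≤ Real.exp (S / θ * (2 / P)) := by gcongr
    _ = _ := by congr 1; rw [div_mul_div_comm]; ring

theorem prob_lt_le_of_pow [NeZero P] (hB : 1 ≤ B) {f : Sample D P B → ℕ} {C T : ℝ}
    (hf : ∑ ω, expBase B ^ f ω ≤ C * Fintype.card (Sample D P B)) :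
    prob {ω | T < f ω} ≤ C / Real.exp (T / (4 * B)) := by
  have := nonempty_sample (D := D) (P := P) hB
  have hz := @one_le_expBase B
  refine prob_le_of_sum_le (fun ω => by positivity) (Real.exp_pos _) (fun ω hω => ?_) hf
  refine le_trans (Real.exp_le_exp.2 ?_) (exp_le_expBase_pow hB (f ω))
  have : T < f ω := hω
  gcongr

/-- The chunks with more than `θ` queries are balanced over the modules. -/
theorem prob_pulledLength_le [NeZero P] (hB : 1 ≤ B) (Q : Fin S → K) {θ : ℕ} (hθ : 1 ≤ θ)
    {t : Fin (height B P + 1)} (ht : 1 ≤ t.1) (m : Fin P) (T : ℝ) :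
    prob {ω : Sample D P B | 2 * T < pulledLength ω Q θ t m} ≤
      2 * Real.exp (2 * S / (θ * P) - T / (4 * B)) := by
  obtain ⟨Mq, hcard, hMq⟩ := exists_marks Q hθ
  have := nonempty_sample (D := D) (P := P) hB
  have hsub : {ω : Sample D P B | 2 * T < pulledLength ω Q θ t m} ⊆
      ⋃ i ∈ (Finset.univ : Finset Bool), (if i then {ω | T < fwdPart ω Q Mq ht m}
        else {ω | T < bwdPart ω Q Mq ht m} : Set (Sample D P B)) := by
    intro ω hω
    have h1 : ((pulledLength ω Q θ t m : ℕ) : ℝ) ≤ fwdPart ω Q Mq ht m + bwdPart ω Q Mq ht m := by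
      exact_mod_cast pulledLength_le ω Q hMq ht m
    have h2 : 2 * T < pulledLength ω Q θ t m := hω
    simp only [Set.mem_iUnion]
    by_cases h : T < fwdPart ω Q Mq ht m
    · exact ⟨true, Finset.mem_univ _, by simpa using h⟩
    · refine ⟨false, Finset.mem_univ _, ?_⟩
      change T < bwdPart ω Q Mq ht m
      linarith
  refine (prob_mono hsub).trans ((prob_biUnion_le _ _).trans ?_)
  have h1 := prob_lt_le_of_pow (T := T) hB (sum_pow_fwdPart_le (D := D) hB Q Mq ht m)
  have h2 := prob_lt_le_of_pow (T := T) hB (sum_pow_bwdPart_le (D := D) hB Q Mq ht m)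
  have h3 : (1 + 2 / (P : ℝ)) ^ Mq.card / Real.exp (T / (4 * B)) ≤
      Real.exp (2 * S / (θ * P) - T / (4 * B)) := by
    rw [Real.exp_sub]
    gcongr
    exact one_add_pow_le_exp hθ hcard
  simp only [Fintype.sum_bool, if_true, Bool.false_eq_true, if_false]
  linarith

/-- The total weight of the nodes that are hosted by the module `m`. -/
def hostedWeight (w : Sample D P B → Addr D P B → ℕ) (ω : Sample D P B) (m : Fin P) : ℕ :=
  ∑ a, if ω.2 a.1 a.2 = m then w ω a else 0

/-- Nodes of weight at most `θ` are balanced over the modules, if the weights depend only on the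
dice. -/
theorem prob_hostedWeight_le [NeZero P] (hB : 1 ≤ B) (w : Sample D P B → Addr D P B → ℕ)
    {θ : ℕ} (hθ : 1 ≤ θ) (hw : ∀ ω a, w ω a ≤ θ) (hsum : ∀ ω, ∑ a, w ω a ≤ S)
    (hdice : ∀ ω ω' : Sample D P B, ω.1 = ω'.1 → w ω = w ω') (m : Fin P) (T : ℝ) :
    prob {ω : Sample D P B | T < hostedWeight w ω m} ≤
      Real.exp (2 * S / (θ * P) - T / θ) := by
  have := nonempty_sample (D := D) (P := P) hB
  have hθ' : (0 : ℝ) < θ := by exact_mod_cast hθ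
  rw [Real.exp_sub]
  refine prob_le_of_sum_le (f := fun ω => Real.exp ((hostedWeight w ω m : ℝ) / θ))
    (fun ω => Real.exp_nonneg _) (Real.exp_pos _) (fun ω hω => ?_) ?_
  · have : T < hostedWeight w ω m := hω
    refine Real.exp_le_exp.2 ?_
    gcongr
  let e : Sample D P B ≃ (Slot D → Fin (height B P) → Fin B) × (Addr D P B → Fin P) :=
    Equiv.prodCongr (Equiv.refl _) (Equiv.curry _ _ _).symm
  rw [← Equiv.sum_comp e.symm, Fintype.sum_prod_type, Fintype.card_congr e, Fintype.card_prod]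
  have key : ∀ d : Slot D → Fin (height B P) → Fin B, ∑ h : Addr D P B → Fin P,
      Real.exp ((hostedWeight w (e.symm (d, h)) m : ℝ) / θ) ≤
      Real.exp (2 * S / (θ * P)) * Fintype.card (Addr D P B → Fin P) := by
    intro d
    let ω₀ : Sample D P B := (d, fun _ _ => 0)
    have e1 : ∀ h : Addr D P B → Fin P, (hostedWeight w (e.symm (d, h)) m : ℝ) =
        ∑ a, if h a = m then (w ω₀ a : ℝ) else 0 := by
      intro h
      rw [hostedWeight, hdice (e.symm (d, h)) ω₀ rfl]
      push_cast
      rfl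
    simp only [e1]
    refine (sum_exp_load_le m (w ω₀) hθ (hw ω₀)).trans ?_
    have : (∑ a, (w ω₀ a : ℝ)) ≤ S := by exact_mod_cast hsum ω₀
    gcongr
  refine (Finset.sum_le_sum (fun d _ => key d)).trans (le_of_eq ?_)
  rw [Finset.sum_const, Finset.card_univ, nsmul_eq_mul]
  push_cast
  ring

end Tails
/-! ### The loads of the rounds -/

section Loads

variable {K V : Type*} [LinearOrder K] {D : Finset K} {P B S : ℕ}

/-- The number of queries at the node `a`. -/
def queriesAt (node : Fin S → Addr D P B) (a : Addr D P B) : ℕ :=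
  (Finset.univ.filter (fun i => node i = a)).card

theorem sum_queriesAt (node : Fin S → Addr D P B) : ∑ a, queriesAt node a = S := by
  have := Finset.card_eq_sum_card_fiberwise (f := node) (s := Finset.univ) (t := Finset.univ)
    (fun _ _ => Finset.mem_univ _)
  rw [Finset.card_univ, Fintype.card_fin] at this
  exact this.symm

/-- The nodes of the queries after `k` Pull rounds in L2. -/
def pullNode (ω : Sample D P B) (Q : Fin S → K) (k : ℕ) (i : Fin S) : Addr D P B :=
  (pullLevel ω Q k i, pos ω (pullLevel ω Q k i) (Q i))

/-- The nodes of the queries on the level `t`. -/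
def levelNode (ω : Sample D P B) (Q : Fin S → K) (t : Fin (height B P + 1)) (i : Fin S) :
    Addr D P B := (t, pos ω t (Q i))

/-- The number of queries at the node `a`, if there are at most `θ` of them. -/
def lightWeight (θ : ℕ) (node : Fin S → Addr D P B) (a : Addr D P B) : ℕ :=
  if queriesAt node a ≤ θ then queriesAt node a else 0

theorem lightWeight_le (θ : ℕ) (node : Fin S → Addr D P B) (a : Addr D P B) :
    lightWeight θ node a ≤ θ := by
  unfold lightWeight; split_ifs <;> omega

theorem sum_lightWeight_le (θ : ℕ) (node : Fin S → Addr D P B) :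
    ∑ a, lightWeight θ node a ≤ S := by
  refine le_trans (Finset.sum_le_sum (fun a _ => ?_)) (sum_queriesAt node).le
  unfold lightWeight; split_ifs <;> omega

/-- The weight of a data node: one, if it is reached by a query. -/
def dataWeight (node : Fin S → Addr D P B) (a : Addr D P B) : ℕ := min 1 (queriesAt node a)

theorem sum_dataWeight_le (node : Fin S → Addr D P B) : ∑ a, dataWeight node a ≤ S :=
  le_trans (Finset.sum_le_sum (fun _ _ => min_le_right _ _)) (sum_queriesAt node).le

theorem card_light_le (ω : Sample D P B) (θ : ℕ) (node : Sample D P B → Fin S → Addr D P B)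
    (m : Fin P) (s : Finset (Fin S)) (hs : ∀ i ∈ s, queriesAt (node ω) (node ω i) ≤ θ ∧
      ω.2 (node ω i).1 (node ω i).2 = m) :
    s.card ≤ hostedWeight (fun ω => lightWeight θ (node ω)) ω m := by
  rw [Finset.card_eq_sum_card_fiberwise (f := node ω) (t := Finset.univ)
    (fun _ _ => Finset.mem_univ _)]
  refine Finset.sum_le_sum (fun a _ => ?_)
  rcases (s.filter (fun i => node ω i = a)).eq_empty_or_nonempty with h | ⟨i, hi⟩
  · simp [h]
  · obtain ⟨his, rfl⟩ := Finset.mem_filter.1 hi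
    obtain ⟨h1, h2⟩ := hs i his
    rw [if_pos h2]
    change _ ≤ lightWeight θ (node ω) (node ω i)
    rw [lightWeight, if_pos h1]
    exact Finset.card_le_card (Finset.filter_subset_filter _ (Finset.subset_univ s))

theorem reaches_congr {ω ω' : Sample D P B} (h : ω.1 = ω'.1) (t : ℕ) (x : Slot D) :
    Reaches ω t x ↔ Reaches ω' t x := by
  simp only [Reaches, h]

theorem levelNode_congr {ω ω' : Sample D P B} (h : ω.1 = ω'.1) (Q : Fin S → K)
    (t : Fin (height B P + 1)) : levelNode ω Q t = levelNode ω' Q t := by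
  funext i
  simp only [levelNode, pos_congr (reaches_congr h t.1)]

theorem pullLevel_congr {ω ω' : Sample D P B} (h : ω.1 = ω'.1) (Q : Fin S → K) (k : ℕ) :
    pullLevel ω Q k = pullLevel ω' Q k := by
  induction k with
  | zero => rfl
  | succ k ih =>
    funext i
    simp only [pullLevel, ih, pos_congr (reaches_congr h _)]

theorem pullNode_congr {ω ω' : Sample D P B} (h : ω.1 = ω'.1) (Q : Fin S → K) (k : ℕ) :
    pullNode ω Q k = pullNode ω' Q k := by
  funext i
  simp only [pullNode, pullLevel_congr h, pos_congr (reaches_congr h _)]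

/-- The random choices put balanced loads on the module `m`: the chunks pulled on the level `t`,
the queries pushed after `t` Pull rounds in L2 and on the level `t` of L1, and the data nodes. -/
structure Balanced (κ : ℝ) (Q : Fin S → K) (ω : Sample D P B) (m : Fin P)
    (t : Fin (height B P + 1)) : Prop where
  pullL2 : 1 ≤ t.1 →
    (pulledLength ω Q (B * l2Height B P) t m : ℝ) ≤ κ * (S / l2Height B P / P)
  pullL1 : 1 ≤ t.1 → (pulledLength ω Q B t m : ℝ) ≤ κ * (S / P)
  pushL2 : (hostedWeight (fun ω => lightWeight (B * l2Height B P) (pullNode ω Q t.1)) ω m : ℝ) ≤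
    κ * (S / P)
  pushL1 : (hostedWeight (fun ω => lightWeight B (levelNode ω Q t)) ω m : ℝ) ≤ κ * (S / P)
  data : (hostedWeight (fun ω => dataWeight (levelNode ω Q 0)) ω m : ℝ) ≤ κ * (S / P)

/-- The sum of `g` over the tasks sent to the module `m`. -/
def taskSum (cs : Multiset (Fin P × Task D P B)) (m : Fin P) (g : Fin P × Task D P B → ℕ) : ℕ :=
  ((cs.filter (fun c => c.1 = m)).map g).sum

theorem taskSum_map {ι : Type*} (s : Finset ι) (f : ι → Fin P × Task D P B) (m : Fin P)
    (g : Fin P × Task D P B → ℕ) :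
    taskSum (s.val.map f) m g = ∑ x ∈ s.filter (fun x => (f x).1 = m), g (f x) := by
  rw [taskSum, Multiset.filter_map, Multiset.map_map]
  rfl

theorem taskSum_map_le {ι : Type*} {s : Finset ι} {f : ι → Fin P × Task D P B} {m : Fin P}
    {g : Fin P × Task D P B → ℕ} {n : ℕ} (h : ∀ x ∈ s, (f x).1 = m → g (f x) ≤ n) :
    taskSum (s.val.map f) m g ≤ (s.filter (fun x => (f x).1 = m)).card * n := by
  rw [taskSum_map, ← smul_eq_mul]
  refine Finset.sum_le_card_nsmul _ _ _ (fun x hx => ?_)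
  obtain ⟨h1, h2⟩ := Finset.mem_filter.1 hx
  exact h x h1 h2

theorem taskSum_add (cs cs' : Multiset (Fin P × Task D P B)) (m : Fin P)
    (g : Fin P × Task D P B → ℕ) : taskSum (cs + cs') m g = taskSum cs m g + taskSum cs' m g := by
  simp [taskSum]

/-- The words exchanged with a module for a task. -/
def taskComm (val : K → V) (ω : Sample D P B) (T : L3Tree D P B) (c : Fin P × Task D P B) : ℕ :=
  (moduleCode V D P B).taskWords c.2 + (moduleCode V D P B).replyWords
    ((moduleCode V D P B).reply (pimMemory val ω T c.1) c.2)

/-- The steps of a module for a task. -/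
def taskWork (val : K → V) (ω : Sample D P B) (T : L3Tree D P B) (c : Fin P × Task D P B) : ℕ :=
  (moduleCode V D P B).steps (pimMemory val ω T c.1) c.2

theorem comm_eq_taskSum [NeZero P] (val : K → V) (ω : Sample D P B) (T : L3Tree D P B)
    (Q : Fin S → K) (k : ℕ) (m : Fin P) :
    comm (predecessor V D B Q) (moduleCode V D P B) (pimMemory val ω T) k m =
      taskSum ((predCalls Q (stateAfter (predecessor V D B Q) (moduleCode V D P B)
        (pimMemory val ω T) k)).getD 0) m (taskComm val ω T) := by
  unfold comm taskSum
  congr 1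
  refine Multiset.map_congr rfl (fun c hc => ?_)
  rw [taskComm, (Multiset.mem_filter.1 hc).2]

theorem work_eq_taskSum [NeZero P] (val : K → V) (ω : Sample D P B) (T : L3Tree D P B)
    (Q : Fin S → K) (k : ℕ) (m : Fin P) :
    work (predecessor V D B Q) (moduleCode V D P B) (pimMemory val ω T) k m =
      taskSum ((predCalls Q (stateAfter (predecessor V D B Q) (moduleCode V D P B)
        (pimMemory val ω T) k)).getD 0) m (taskWork val ω T) := by
  unfold work taskSum
  congr 1
  refine Multiset.map_congr rfl (fun c hc => ?_)
  rw [taskWork, (Multiset.mem_filter.1 hc).2]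

section Tasks

variable (val : K → V) (ω : Sample D P B) (T : L3Tree D P B)

theorem length_chunk_pos (t : Fin (height B P + 1)) (q : K) :
    1 ≤ (chunk ω (t, pos ω t q)).length := by
  rw [Nat.one_le_iff_ne_zero]
  intro h
  have := lookup_chunk ω t q
  rw [List.eq_nil_of_length_eq_zero h] at this
  simp [lookup] at this

theorem taskComm_pull {t : Fin (height B P + 1)} (ht : 1 ≤ t.1) (q : K) :
    taskComm val ω T (pullCall (cursor ω t q)) ≤ 8 * (chunk ω (t, pos ω t q)).length := by
  have h1 := reply_pull val ω T ht q
  have h2 := length_chunk_pos ω t q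
  simp only [taskComm, pullCall, h1]
  simp only [moduleCode]
  omega

theorem taskWork_pull {t : Fin (height B P + 1)} (ht : 1 ≤ t.1) (q : K) :
    taskWork val ω T (pullCall (cursor ω t q)) ≤ 8 * (chunk ω (t, pos ω t q)).length := by
  have h1 := memory_chunk val ω T ht q
  have h2 := length_chunk_pos ω t q
  simp only [taskWork, pullCall, moduleCode, pimMemory, cursor_snd, h1, Option.map_some,
    Option.getD_some]
  omega

theorem taskComm_push {t : Fin (height B P + 1)} (ht : 1 ≤ t.1) (q : K) :
    taskComm val ω T ((cursor ω t q).1, .push q (cursor ω t q).2) ≤ 7 := by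
  have h1 := reply_push val ω T ht q
  simp only [taskComm, h1]
  simp [moduleCode]

theorem taskComm_searchL2 {t : Fin (height B P + 1)} (ht : l1Height B P < t.1) (q : K) :
    taskComm val ω T ((cursor ω t q).1, .searchL2 q (cursor ω t q).2) ≤ 7 := by
  have h1 := reply_searchL2 val ω T ht q
  simp only [taskComm, h1]
  simp [moduleCode]

theorem taskWork_searchL2 {t : Fin (height B P + 1)} (ht : l1Height B P < t.1) (q : K) :
    taskWork val ω T ((cursor ω t q).1, .searchL2 q (cursor ω t q).2) ≤ 2 * l2Height B P := by
  have h1 := walk_cursor val ω T ht q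
  have h2 := @one_le_l2Height P B
  have h3 : t.1 ≤ l1Height B P + l2Height B P := Nat.lt_succ_iff.1 t.2
  simp only [taskWork, moduleCode, pimMemory, cursor_snd, h1]
  omega

theorem taskComm_fetch (q : K) :
    taskComm val ω T ((cursor ω 0 q).1, .fetch (cursor ω 0 q).2) ≤ 5 := by
  simp [taskComm, moduleCode, pimMemory, memory, cursor, pointer]

theorem taskComm_searchL3 {T : L3Tree D P B} (hT : IsL3 ω T) (m : Fin P) (q : K) :
    taskComm val ω T (m, .searchL3 q) ≤ 5 := by
  simp [taskComm, moduleCode, pimMemory, memory, search_l3 hT, Reply.ofPtr]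

/-- The pulled chunks of the level `t` contribute at most their total length. -/
theorem taskSum_pull_le (Q : Fin S → K) {θ : ℕ} {t : Fin (height B P + 1)}
    {s : Finset (Ptr D P B)}
    (hs : ∀ p ∈ s, ∃ i, p = cursor ω t (Q i) ∧ pos ω t (Q i) ∈ hotSlots ω Q θ t) (m : Fin P)
    {g : Fin P × Task D P B → ℕ}
    (hg : ∀ q, g (pullCall (cursor ω t q)) ≤ 8 * (chunk ω (t, pos ω t q)).length) :
    taskSum (s.val.map pullCall) m g ≤ 8 * pulledLength ω Q θ t m := by
  rw [taskSum_map, pulledLength, Finset.mul_sum]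
  calc ∑ p ∈ s.filter (fun p => (pullCall p).1 = m), g (pullCall p)
      ≤ ∑ p ∈ s.filter (fun p => (pullCall p).1 = m), 8 * (chunk ω (t, p.2.2)).length := by
        refine Finset.sum_le_sum (fun p hp => ?_)
        obtain ⟨i, rfl, -⟩ := hs p (Finset.mem_filter.1 hp).1
        exact hg (Q i)
    _ = ∑ x ∈ (s.filter (fun p => (pullCall p).1 = m)).image (fun p => p.2.2),
          8 * (chunk ω (t, x)).length := by
        rw [Finset.sum_image]
        intro p hp p' hp' h
        obtain ⟨i, rfl, -⟩ := hs p (Finset.mem_filter.1 hp).1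
        obtain ⟨j, rfl, -⟩ := hs p' (Finset.mem_filter.1 hp').1
        exact cursor_inj.2 ⟨rfl, h⟩
    _ ≤ _ := by
        refine Finset.sum_le_sum_of_subset (fun x hx => ?_)
        obtain ⟨p, hp, rfl⟩ := Finset.mem_image.1 hx
        obtain ⟨hps, hpm⟩ := Finset.mem_filter.1 hp
        obtain ⟨i, rfl, hi⟩ := hs p hps
        exact Finset.mem_filter.2 ⟨hi, hpm⟩

end Tasks

section Rounds

variable (val : K → V) (ω : Sample D P B) {T : L3Tree D P B} (Q : Fin S → K)

/-- A node pulled in L2 has many queries on its level. -/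
theorem hotL2_pullState_subset {k : ℕ} (hk : k ≤ l2Height B P) {t : Fin (height B P + 1)}
    (ht : t.1 + k = height B P) (p : Ptr D P B) (hp : p ∈ hotL2 (pullState ω Q k)) :
    ∃ i, p = cursor ω t (Q i) ∧ pos ω t (Q i) ∈ hotSlots ω Q (B * l2Height B P) t := by
  obtain ⟨i, rfl, hi⟩ := level_of_mem_hotL2 hk hp
  have hti : pullLevel ω Q k i = t := Fin.ext (by omega)
  refine ⟨i, by rw [pullState, hti], ?_⟩
  have h1 := (mem_hotL2_pullState.1 hp).1
  refine Finset.mem_filter.2 ⟨Finset.mem_univ _, h1.trans_le (Finset.card_le_card ?_)⟩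
  intro j hj
  obtain ⟨h2, h3⟩ := (Finset.mem_filter.1 hj).2
  rw [h2, hti] at h3
  exact Finset.mem_filter.2 ⟨Finset.mem_univ _, h3⟩

theorem sum_load_le (cur : Fin S → Ptr D P B) : ∑ j, load cur j ≤ S := by
  have h : ∑ j, load cur j = (Finset.univ.filter (fun i => InL2 (cur i).2)).card := by
    rw [Finset.card_eq_sum_card_fiberwise (f := fun i => (cur i).1) (t := Finset.univ)
      (fun _ _ => Finset.mem_univ _)]
    simp only [load, Finset.filter_filter]
  rw [h]
  exact (Finset.card_filter_le _ _).trans (by simp)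

theorem queriesAt_levelNode (t : Fin (height B P + 1)) (i : Fin S) :
    queriesAt (levelNode ω Q t) (levelNode ω Q t i) =
      (Finset.univ.filter (fun j => pos ω t (Q j) = pos ω t (Q i))).card := by
  simp only [queriesAt, levelNode, Prod.mk.injEq, true_and]

theorem mem_hot_levelState {t : Fin (height B P + 1)} {i : Fin S} {θ : ℕ} :
    levelState ω Q t i ∈ hot θ (levelState ω Q t) ↔
      θ < (Finset.univ.filter (fun j => pos ω t (Q j) = pos ω t (Q i))).card := by
  have := mem_hot_cursor (ω := ω) (Q := Q) (lev := fun _ => t) (θ := θ) (i := i)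
  simp only [true_and] at this
  exact this

theorem card_image_levelState_le (m : Fin P) :
    ((Finset.univ.image (levelState ω Q 0)).filter (fun p => p.1 = m)).card ≤
      hostedWeight (fun ω => dataWeight (levelNode ω Q 0)) ω m := by
  have key : ∀ p ∈ (Finset.univ.image (levelState ω Q 0)).filter (fun p => p.1 = m),
      ∃ i, p = cursor ω 0 (Q i) ∧ ω.2 0 (pos ω 0 (Q i)) = m := by
    intro p hp
    obtain ⟨h1, h2⟩ := Finset.mem_filter.1 hp
    obtain ⟨i, -, rfl⟩ := Finset.mem_image.1 h1
    exact ⟨i, rfl, h2⟩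
  have hinj : Set.InjOn (fun p : Ptr D P B => p.2)
      ((Finset.univ.image (levelState ω Q 0)).filter (fun p => p.1 = m)) := by
    intro p hp p' hp' h
    obtain ⟨i, rfl, -⟩ := key p hp
    obtain ⟨j, rfl, -⟩ := key p' hp'
    have h : ((0 : Fin (height B P + 1)), pos ω 0 (Q i)) = (0, pos ω 0 (Q j)) := h
    exact cursor_inj.2 ⟨rfl, (Prod.mk.inj h).2⟩
  rw [← Finset.card_image_of_injOn hinj, Finset.card_eq_sum_ones, hostedWeight,
    ← Finset.sum_filter]
  refine le_trans (Finset.sum_le_sum (g := dataWeight (levelNode ω Q 0)) (fun a ha => ?_))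
    (Finset.sum_le_sum_of_subset (fun a ha => ?_))
  · obtain ⟨p, hp, rfl⟩ := Finset.mem_image.1 ha
    obtain ⟨i, rfl, -⟩ := key p hp
    refine le_min le_rfl (Finset.card_pos.2 ⟨i, ?_⟩)
    exact Finset.mem_filter.2 ⟨Finset.mem_univ _, rfl⟩
  · obtain ⟨p, hp, rfl⟩ := Finset.mem_image.1 ha
    obtain ⟨i, rfl, hm⟩ := key p hp
    exact Finset.mem_filter.2 ⟨Finset.mem_univ _, hm⟩

variable [NeZero P]

/-- The bounds for communication and work of the module `m` in a round that starts in state `s`. -/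
def RoundBound (h3 : ℕ) (C : ℝ) (T : L3Tree D P B) (m : Fin P) (s : HostState V D P B S) : Prop :=
  (taskSum ((predCalls Q s).getD 0) m (taskComm val ω T) : ℝ) ≤ C * (commBudget s / P) ∧
    (taskSum ((predCalls Q s).getD 0) m (taskWork val ω T) : ℝ) ≤ C * (workBudget h3 s / P)

theorem card_filter_ofNat_le (m : Fin P) :
    (Finset.univ.filter (fun i : Fin S => Fin.ofNat P i.1 = m)).card ≤ S / P + 1 := by
  have hP : 0 < P := Nat.pos_of_ne_zero (NeZero.ne P)
  have h1 : ((Finset.univ.filter (fun i : Fin S => Fin.ofNat P i.1 = m)).image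
      (fun i => i.1 / P)) ⊆ Finset.range (S / P + 1) := by
    intro x hx
    obtain ⟨i, -, rfl⟩ := Finset.mem_image.1 hx
    rw [Finset.mem_range]
    exact Nat.lt_succ_of_le (Nat.div_le_div_right i.2.le)
  rw [← Finset.card_range (S / P + 1)]
  refine le_trans (le_of_eq (Finset.card_image_of_injOn ?_).symm) (Finset.card_le_card h1)
  intro i hi j hj hij
  have hi : i.1 % P = m.1 := congrArg Fin.val (Finset.mem_filter.1 hi).2
  have hj : j.1 % P = m.1 := congrArg Fin.val (Finset.mem_filter.1 hj).2
  have hij : i.1 / P = j.1 / P := hij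
  refine Fin.ext ?_
  rw [← Nat.div_add_mod i.1 P, ← Nat.div_add_mod j.1 P, hi, hj, hij]

theorem roundBound_start (hT : IsL3 ω T) {a : ℝ} (ha : 0 < a) (hS : a * P ≤ S) (m : Fin P) :
    RoundBound val ω Q (T.1 + 1) (5 * (1 + 1 / a)) T m .start := by
  have hP : (0 : ℝ) < P := by exact_mod_cast Nat.pos_of_ne_zero (NeZero.ne P)
  have h1 : ((Finset.univ.filter (fun i : Fin S => Fin.ofNat P i.1 = m)).card : ℝ) ≤
      (1 + 1 / a) * (S / P) := by
    have h2 : ((Finset.univ.filter (fun i : Fin S => Fin.ofNat P i.1 = m)).card : ℝ) ≤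
        ((S / P : ℕ) : ℝ) + 1 := by exact_mod_cast card_filter_ofNat_le m
    have h3 : ((S / P : ℕ) : ℝ) ≤ S / P := Nat.cast_div_le
    have h4 : 1 ≤ 1 / a * (S / P) := by
      rw [div_mul_div_comm, one_mul, one_le_div (by positivity)]
      exact hS
    linarith
  constructor
  · have h2 := taskSum_map_le (s := (Finset.univ : Finset (Fin S)))
      (f := fun i => (Fin.ofNat P i.1, Task.searchL3 (Q i))) (m := m) (g := taskComm val ω T)
      (n := 5) (fun i _ _ => taskComm_searchL3 val ω hT _ _)
    have h3 : (taskSum ((predCalls (V := V) Q .start).getD 0) m (taskComm val ω T) : ℝ) ≤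
        (Finset.univ.filter (fun i : Fin S => Fin.ofNat P i.1 = m)).card * 5 := by
      exact_mod_cast h2
    refine h3.trans ?_
    simp only [commBudget]
    linarith
  · have h2 := taskSum_map_le (s := (Finset.univ : Finset (Fin S)))
      (f := fun i => (Fin.ofNat P i.1, Task.searchL3 (Q i))) (m := m) (g := taskWork val ω T)
      (n := 2 * (T.1 + 1)) (fun i _ _ => by
        simp only [taskWork, moduleCode, pimMemory, memory]
        omega)
    have h3 : (taskSum ((predCalls (V := V) Q .start).getD 0) m (taskWork val ω T) : ℝ) ≤
        (Finset.univ.filter (fun i : Fin S => Fin.ofNat P i.1 = m)).card *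
          ((2 * (T.1 + 1) : ℕ) : ℝ) := by
      exact_mod_cast h2
    refine h3.trans ((mul_le_mul_of_nonneg_right h1 (by positivity)).trans ?_)
    simp only [workBudget]
    push_cast
    have h4 : (0 : ℝ) ≤ (1 + 1 / a) * (S / P) * (T.1 + 1) := by positivity
    calc (1 + 1 / a) * (S / P) * (2 * ((T.1 : ℝ) + 1))
        = 2 * ((1 + 1 / a) * (S / P) * (T.1 + 1)) := by ring
      _ ≤ 5 * ((1 + 1 / a) * (S / P) * (T.1 + 1)) := by linarith
      _ = _ := by ring

theorem roundBound_pull {κ : ℝ} {k : ℕ} (hk : k < l2Height B P)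
    (hp : Pulling (pullState ω Q k)) (m : Fin P) (hbal : ∀ t, Balanced κ Q ω m t) (h3 : ℕ) :
    RoundBound val ω Q h3 (8 * κ) T m (.l2 (pullState ω Q k)) := by
  have hh : height B P = l1Height B P + l2Height B P := rfl
  let t : Fin (height B P + 1) := ⟨height B P - k, by omega⟩
  have ht : t.1 + k = height B P := by simp only [t]; omega
  have ht1 : 1 ≤ t.1 := by have := @one_le_l1Height P B; omega
  have hb := (hbal t).pullL2 ht1
  have hs := hotL2_pullState_subset ω Q hk.le ht
  have hcalls : (predCalls (V := V) Q (.l2 (pullState ω Q k))).getD 0 =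
      (hotL2 (pullState ω Q k)).val.map pullCall := by
    simp only [predCalls, if_pos hp, Option.getD_some]
  rw [RoundBound, hcalls]
  simp only [commBudget, workBudget, if_pos hp]
  have h1 : ((8 * pulledLength ω Q (B * l2Height B P) t m : ℕ) : ℝ) ≤
      8 * κ * (S / l2Height B P / P) := by push_cast; linarith
  exact ⟨le_trans (by exact_mod_cast taskSum_pull_le ω Q hs m (taskComm_pull val ω T ht1)) h1,
    le_trans (by exact_mod_cast taskSum_pull_le ω Q hs m (taskWork_pull val ω T ht1)) h1⟩

/-- When the Pull rounds in L2 end, the queries in L2 are balanced: either by the condition of the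
loop, or since no L2 node has many queries. -/
theorem load_le {κ : ℝ} (hκ : 3 ≤ κ) {k : ℕ} (hk : k ≤ l2Height B P)
    (hp : ¬ Pulling (pullState ω Q k)) (m : Fin P) (hbal : ∀ t, Balanced κ Q ω m t) :
    (load (pullState ω Q k) m : ℝ) ≤ κ * (S / P) := by
  have hP : (0 : ℝ) < P := by exact_mod_cast Nat.pos_of_ne_zero (NeZero.ne P)
  have hh : height B P = l1Height B P + l2Height B P := rfl
  by_cases hload : P * load (pullState ω Q k) m ≤ 3 * ∑ j, load (pullState ω Q k) j
  · have h1 : ((P * load (pullState ω Q k) m : ℕ) : ℝ) ≤ ((3 * S : ℕ) : ℝ) := by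
      exact_mod_cast hload.trans (Nat.mul_le_mul_left 3 (sum_load_le _))
    push_cast at h1
    have h2 : (load (pullState ω Q k) m : ℝ) ≤ 3 * (S / P) := by
      rw [← mul_div_assoc, le_div_iff₀ hP]; linarith
    refine h2.trans ?_
    gcongr
  · have hempty : ¬ (hotL2 (pullState ω Q k)).Nonempty :=
      fun h => hp ⟨⟨m, not_le.1 hload⟩, h⟩
    have hb := (hbal ⟨k, by omega⟩).pushL2
    refine le_trans ?_ hb
    have := card_light_le ω (B * l2Height B P) (fun ω => pullNode ω Q k) m
      (Finset.univ.filter (fun i => InL2 (pullState ω Q k i).2 ∧ (pullState ω Q k i).1 = m))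
      (fun i hi => by
        obtain ⟨h1, h2⟩ := (Finset.mem_filter.1 hi).2
        refine ⟨?_, h2⟩
        by_contra hc
        refine hempty ⟨_, mem_hotL2_pullState.2 ⟨(not_le.1 hc).trans_le ?_, h1⟩⟩
        refine Finset.card_le_card (fun j hj => ?_)
        have hj := (Finset.mem_filter.1 hj).2
        simp only [pullNode, Prod.mk.injEq] at hj
        exact Finset.mem_filter.2 ⟨Finset.mem_univ _, hj⟩)
    exact_mod_cast this

theorem roundBound_pushL2 {κ : ℝ} (hκ : 3 ≤ κ) {k : ℕ} (hk : k ≤ l2Height B P)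
    (hp : ¬ Pulling (pullState ω Q k)) (m : Fin P) (hbal : ∀ t, Balanced κ Q ω m t) (h3 : ℕ) :
    RoundBound val ω Q h3 (7 * κ) T m (.l2 (pullState ω Q k)) := by
  have hl := load_le ω Q hκ hk hp m hbal
  have hcalls : (predCalls (V := V) Q (.l2 (pullState ω Q k))).getD 0 =
      (Finset.univ.filter (fun i => InL2 (pullState ω Q k i).2)).val.map
        (fun i => ((pullState ω Q k i).1, .searchL2 (Q i) (pullState ω Q k i).2)) := by
    simp only [predCalls, if_neg hp, Option.getD_some]
  have hcard : ((Finset.univ.filter (fun i => InL2 (pullState ω Q k i).2)).filter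
      (fun i => (pullState ω Q k i).1 = m)).card = load (pullState ω Q k) m := by
    rw [Finset.filter_filter]; rfl
  rw [RoundBound, hcalls]
  simp only [commBudget, workBudget, if_neg hp]
  constructor
  · have h1 := taskSum_map_le (m := m)
      (s := Finset.univ.filter (fun i => InL2 (pullState ω Q k i).2))
      (f := fun i => ((pullState ω Q k i).1, Task.searchL2 (Q i) (pullState ω Q k i).2))
      (g := taskComm val ω T) (n := 7)
      (fun i hi _ => taskComm_searchL2 val ω T (Finset.mem_filter.1 hi).2 (Q i))
    simp only [hcard] at h1
    refine le_trans (Nat.cast_le.2 h1) ?_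
    push_cast
    linarith
  · have h1 := taskSum_map_le (m := m)
      (s := Finset.univ.filter (fun i => InL2 (pullState ω Q k i).2))
      (f := fun i => ((pullState ω Q k i).1, Task.searchL2 (Q i) (pullState ω Q k i).2))
      (g := taskWork val ω T) (n := 2 * l2Height B P)
      (fun i hi _ => taskWork_searchL2 val ω T (Finset.mem_filter.1 hi).2 (Q i))
    simp only [hcard] at h1
    refine le_trans (Nat.cast_le.2 h1) ?_
    push_cast
    have h4 : (0 : ℝ) ≤ κ * (S / P) * l2Height B P := by positivity
    calc (load (pullState ω Q k) m : ℝ) * (2 * l2Height B P)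
        ≤ κ * (S / P) * (2 * l2Height B P) := by gcongr
      _ = 2 * (κ * (S / P) * l2Height B P) := by ring
      _ ≤ 7 * (κ * (S / P) * l2Height B P) := by linarith
      _ = _ := by ring

theorem roundBound_l1 {κ : ℝ} {r : ℕ} (hr : r < l1Height B P) (m : Fin P)
    (hbal : ∀ t, Balanced κ Q ω m t) (h3 : ℕ) :
    RoundBound val ω Q h3 (15 * κ) T m (.l1 r (levelState ω Q (l1Level B P r))) := by
  have ht1 : 1 ≤ (l1Level B P r).1 := by simp only [l1Level]; omega
  generalize l1Level B P r = t at ht1 ⊢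
  have hb := (hbal t).pullL1 ht1
  have hb' := (hbal t).pushL1
  have hs : ∀ p ∈ hot B (levelState ω Q t),
      ∃ i, p = cursor ω t (Q i) ∧ pos ω t (Q i) ∈ hotSlots ω Q B t := by
    intro p hp
    obtain ⟨i, -, rfl⟩ := Finset.mem_image.1 (Finset.mem_filter.1 hp).1
    exact ⟨i, rfl, Finset.mem_filter.2 ⟨Finset.mem_univ _, (mem_hot_levelState ω Q).1 hp⟩⟩
  have hcard : ((((Finset.univ.filter (fun i : Fin S =>
      levelState ω Q t i ∉ hot B (levelState ω Q t))).filter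
      (fun i => (levelState ω Q t i).1 = m)).card : ℕ) : ℝ) ≤ κ * (S / P) := by
    refine le_trans ?_ hb'
    refine Nat.cast_le.2 (card_light_le ω B (fun ω => levelNode ω Q t) m _ (fun i hi => ?_))
    obtain ⟨hi, hm⟩ := Finset.mem_filter.1 hi
    refine ⟨?_, hm⟩
    rw [queriesAt_levelNode]
    exact not_lt.1 (fun h => (Finset.mem_filter.1 hi).2 ((mem_hot_levelState ω Q).2 h))
  rw [RoundBound]
  simp only [commBudget, workBudget, predCalls, Option.getD_some, taskSum_add]
  constructor
  · have h1 := taskSum_pull_le ω Q hs m (taskComm_pull val ω T ht1)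
    have h2 := taskSum_map_le (m := m)
      (s := Finset.univ.filter (fun i : Fin S =>
        levelState ω Q t i ∉ hot B (levelState ω Q t)))
      (f := fun i => ((levelState ω Q t i).1, Task.push (Q i) (levelState ω Q t i).2))
      (g := taskComm val ω T) (n := 7) (fun i _ _ => taskComm_push val ω T ht1 (Q i))
    refine le_trans (Nat.cast_le.2 (add_le_add h1 h2)) ?_
    push_cast
    linarith
  · have h1 := taskSum_pull_le ω Q hs m (taskWork_pull val ω T ht1)
    have h2 := taskSum_map_le (m := m)
      (s := Finset.univ.filter (fun i : Fin S =>
        levelState ω Q t i ∉ hot B (levelState ω Q t)))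
      (f := fun i => ((levelState ω Q t i).1, Task.push (Q i) (levelState ω Q t i).2))
      (g := taskWork val ω T) (n := 7) (fun i _ _ => by simp [taskWork, moduleCode])
    refine le_trans (Nat.cast_le.2 (add_le_add h1 h2)) ?_
    push_cast
    linarith

theorem roundBound_data {κ : ℝ} (m : Fin P) (hbal : ∀ t, Balanced κ Q ω m t) (h3 : ℕ) :
    RoundBound val ω Q h3 (5 * κ) T m
      (.data (levelState ω Q (l1Level B P (l1Height B P)))) := by
  have h0 : l1Level B P (l1Height B P) = 0 := Fin.ext (by simp [l1Level])
  rw [h0, RoundBound]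
  have hb : ((((Finset.univ.image (levelState ω Q 0)).filter (fun p => p.1 = m)).card : ℕ) : ℝ) ≤
      κ * (S / P) :=
    le_trans (Nat.cast_le.2 (card_image_levelState_le ω Q m)) (hbal 0).data
  simp only [commBudget, workBudget, predCalls, Option.getD_some]
  constructor
  · have h1 := taskSum_map_le (m := m) (s := Finset.univ.image (levelState ω Q 0))
      (f := fun p => (p.1, Task.fetch p.2)) (g := taskComm val ω T) (n := 5) (fun p hp _ => by
        obtain ⟨i, -, rfl⟩ := Finset.mem_image.1 hp
        exact taskComm_fetch val ω T (Q i))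
    refine le_trans (Nat.cast_le.2 h1) ?_
    push_cast
    linarith
  · have h1 := taskSum_map_le (m := m) (s := Finset.univ.image (levelState ω Q 0))
      (f := fun p => (p.1, Task.fetch p.2)) (g := taskWork val ω T) (n := 5) (fun p hp _ => by
        simp [taskWork, moduleCode])
    refine le_trans (Nat.cast_le.2 h1) ?_
    push_cast
    linarith

end Rounds

end Loads
/-! ### The number of rounds and the probability of balanced loads -/

section Final

variable {K V : Type*} [LinearOrder K] {D : Finset K} {P B S : ℕ}

/-- The exponent in the tail bounds: a node with `θ = O(B log_B P)` queries is light compared to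
the share of a module. -/
theorem le_share [NeZero P] {a : ℝ} (ha : 0 < a)
    (hS : a * (P * Real.log P * B * logBP B P) ≤ S) {θ : ℕ} (hθ : 1 ≤ θ)
    (hθ' : (θ : ℝ) ≤ 2 * B * logBP B P) : a / 2 * Real.log P ≤ S / (θ * P) := by
  have hP : (0 : ℝ) < P := by exact_mod_cast Nat.pos_of_ne_zero (NeZero.ne P)
  have hlog : 0 ≤ Real.log P := Real.log_natCast_nonneg P
  have hθ0 : (0 : ℝ) < θ := by exact_mod_cast hθ
  rw [le_div_iff₀ (by positivity)]
  calc a / 2 * Real.log P * (θ * P) ≤ a / 2 * Real.log P * ((2 * B * logBP B P) * P) := by gcongr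
    _ = a * (P * Real.log P * B * logBP B P) := by ring
    _ ≤ S := hS

/-- The constant in the bound of the loads for which the exponential bounds beat the number of
events. -/
noncomputable def balanceConst (a c : ℝ) : ℝ := (16 + 128 / a) * c

theorem exp_tail_le {a c x l : ℝ} (ha : 0 < a) (hc : 1 ≤ c) (hl : 0 ≤ l) (hx : a / 2 * l ≤ x) :
    2 * x - balanceConst a c / 8 * x ≤ -(8 * c * l) := by
  have h1 : 16 * c / a * (a / 2 * l) = 8 * c * l := by field_simp; ring
  have h2 : 16 * c / a ≤ balanceConst a c / 8 - 2 := by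
    have : balanceConst a c / 8 - 2 = 16 * c / a + 2 * (c - 1) := by
      unfold balanceConst; field_simp; ring
    rw [this]; linarith
  have h3 : 16 * c / a * (a / 2 * l) ≤ 16 * c / a * x := by gcongr
  have hx0 : 0 ≤ x := le_trans (by positivity) hx
  have h4 : 16 * c / a * x ≤ (balanceConst a c / 8 - 2) * x := by gcongr
  linarith

theorem exp_neg_mul_log [NeZero P] (c : ℝ) : Real.exp (-(c * Real.log P)) = (P : ℝ) ^ (-c) := by
  have hP : (0 : ℝ) < P := by exact_mod_cast Nat.pos_of_ne_zero (NeZero.ne P)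
  rw [Real.rpow_def_of_pos hP]
  congr 1
  ring

theorem prob_pulledLength_le_rpow [NeZero P] (hP2 : 2 ≤ P) (hB : 1 ≤ B) {a c : ℝ} (ha : 0 < a)
    (hc : 1 ≤ c) (hS : a * (P * Real.log P * B * logBP B P) ≤ S) (Q : Fin S → K) {θ : ℕ}
    (hθ : 1 ≤ θ) (hθ' : (θ : ℝ) ≤ 2 * B * logBP B P) {t : Fin (height B P + 1)} (ht : 1 ≤ t.1)
    (m : Fin P) :
    prob {ω : Sample D P B | balanceConst a c * (S * B / θ / P) < pulledLength ω Q θ t m} ≤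
      (P : ℝ) ^ (-(7 * c)) := by
  have hP0 : (0 : ℝ) < P := by positivity
  have hθ0 : (0 : ℝ) < θ := by exact_mod_cast hθ
  have hB0 : (0 : ℝ) < B := by exact_mod_cast hB
  have hlog : 0 ≤ Real.log P := Real.log_natCast_nonneg P
  have h := prob_pulledLength_le (D := D) hB Q hθ ht m
    (balanceConst a c * (S * B / θ / P) / 2)
  rw [mul_div_cancel₀ _ two_ne_zero] at h
  refine h.trans ?_
  have hx := exp_tail_le ha hc hlog (le_share ha hS hθ hθ')
  have e : 2 * (S : ℝ) / (θ * P) - balanceConst a c * (S * B / θ / P) / 2 / (4 * B) =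
      2 * (S / (θ * P)) - balanceConst a c / 8 * (S / (θ * P)) := by
    field_simp
    ring
  rw [e, ← exp_neg_mul_log]
  have h2 : (2 : ℝ) ≤ Real.exp (Real.log P) := by
    rw [Real.exp_log hP0]; exact_mod_cast hP2
  calc 2 * Real.exp (2 * (S / (θ * P)) - balanceConst a c / 8 * (S / (θ * P)))
      ≤ Real.exp (Real.log P) * Real.exp (-(8 * c * Real.log P)) := by gcongr
    _ = Real.exp (Real.log P + -(8 * c * Real.log P)) := by rw [← Real.exp_add]
    _ ≤ _ := by
      refine Real.exp_le_exp.2 ?_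
      nlinarith

theorem prob_hostedWeight_le_rpow [NeZero P] (hB : 1 ≤ B) {a c : ℝ} (ha : 0 < a)
    (hc : 1 ≤ c) (hS : a * (P * Real.log P * B * logBP B P) ≤ S)
    (w : Sample D P B → Addr D P B → ℕ) {θ : ℕ}
    (hθ : 1 ≤ θ) (hθ' : (θ : ℝ) ≤ 2 * B * logBP B P) (hw : ∀ ω a, w ω a ≤ θ)
    (hsum : ∀ ω, ∑ a, w ω a ≤ S) (hdice : ∀ ω ω' : Sample D P B, ω.1 = ω'.1 → w ω = w ω')
    (m : Fin P) :
    prob {ω : Sample D P B | balanceConst a c * (S / P) < hostedWeight w ω m} ≤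
      (P : ℝ) ^ (-(7 * c)) := by
  have hP0 : (0 : ℝ) < P := by exact_mod_cast Nat.pos_of_ne_zero (NeZero.ne P)
  have hθ0 : (0 : ℝ) < θ := by exact_mod_cast hθ
  have hlog : 0 ≤ Real.log P := Real.log_natCast_nonneg P
  refine (prob_hostedWeight_le hB w hθ hw hsum hdice m _).trans ?_
  have hx := exp_tail_le ha hc hlog (le_share ha hS hθ hθ')
  rw [← exp_neg_mul_log]
  refine Real.exp_le_exp.2 ?_
  have e : 2 * (S : ℝ) / (θ * P) - balanceConst a c * (S / P) / θ =
      2 * (S / (θ * P)) - balanceConst a c * (S / (θ * P)) := by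
    field_simp
  have h0 : 0 ≤ balanceConst a c := by unfold balanceConst; positivity
  have h1 : (0 : ℝ) ≤ S / (θ * P) := by positivity
  have h2 : balanceConst a c / 8 * (S / (θ * P)) ≤ balanceConst a c * (S / (θ * P)) := by
    gcongr; linarith
  have h3 : 0 ≤ c * Real.log P := by positivity
  rw [e]
  linarith

/-- The loads of a given module are balanced with high probability. -/
theorem prob_not_balanced_le [NeZero P] (hP2 : 2 ≤ P) (hB : 2 ≤ B) {a c : ℝ} (ha : 0 < a)
    (hc : 1 ≤ c) (hS : a * (P * Real.log P * B * logBP B P) ≤ S) (Q : Fin S → K)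
    (m : Fin P) (t : Fin (height B P + 1)) :
    prob {ω : Sample D P B | ¬ Balanced (balanceConst a c) Q ω m t} ≤
      5 * (P : ℝ) ^ (-(7 * c)) := by
  have hP0 : (0 : ℝ) < P := by positivity
  have hB1 : 1 ≤ B := by omega
  have hB0 : (0 : ℝ) < B := by exact_mod_cast hB1
  have : NeZero B := ⟨by omega⟩
  have hL := @one_le_logBP B P
  have hH2 := @one_le_l2Height P B
  have hH20 : (0 : ℝ) < l2Height B P := by exact_mod_cast hH2
  have hδ : 0 ≤ (P : ℝ) ^ (-(7 * c)) := by positivity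
  -- the thresholds of L2 and of L1, and the weight of a data node
  have θ2 : ((B * l2Height B P : ℕ) : ℝ) ≤ 2 * B * logBP B P := by
    push_cast
    have := @l2Height_le B P hB (by omega)
    calc (B : ℝ) * l2Height B P ≤ B * (2 * logBP B P) := by gcongr
      _ = _ := by ring
  have θ1 : (B : ℝ) ≤ 2 * B * logBP B P := by nlinarith
  have θ0 : ((1 : ℕ) : ℝ) ≤ 2 * B * logBP B P := by
    have : (1 : ℝ) ≤ B := by exact_mod_cast hB1
    push_cast
    nlinarith
  have hθ2 : 1 ≤ B * l2Height B P := Nat.mul_pos hB1 hH2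
  have p2 : prob {ω : Sample D P B | 1 ≤ t.1 ∧ balanceConst a c * (S / l2Height B P / P) <
      pulledLength ω Q (B * l2Height B P) t m} ≤ (P : ℝ) ^ (-(7 * c)) := by
    by_cases ht : 1 ≤ t.1
    · refine le_trans (prob_mono (fun ω hω => ?_))
        (prob_pulledLength_le_rpow hP2 hB1 ha hc hS Q hθ2 θ2 ht m)
      have e : (S : ℝ) * B / ((B * l2Height B P : ℕ) : ℝ) / P = S / l2Height B P / P := by
        push_cast; field_simp
      rw [Set.mem_ofPred_eq, e]
      exact hω.2
    · simpa [ht, prob] using hδ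
  have p1 : prob {ω : Sample D P B | 1 ≤ t.1 ∧ balanceConst a c * (S / P) <
      pulledLength ω Q B t m} ≤ (P : ℝ) ^ (-(7 * c)) := by
    by_cases ht : 1 ≤ t.1
    · refine le_trans (prob_mono (fun ω hω => ?_))
        (prob_pulledLength_le_rpow hP2 hB1 ha hc hS Q hB1 θ1 ht m)
      have e : (S : ℝ) * B / B / P = S / P := by field_simp
      rw [Set.mem_ofPred_eq, e]
      exact hω.2
    · simpa [ht, prob] using hδ
  have q2 := prob_hostedWeight_le_rpow hB1 ha hc hS
    (fun ω : Sample D P B => lightWeight (B * l2Height B P) (pullNode ω Q t.1)) hθ2 θ2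
    (fun _ _ => lightWeight_le _ _ _) (fun _ => sum_lightWeight_le _ _)
    (fun ω ω' h => by rw [pullNode_congr h]) m
  have q1 := prob_hostedWeight_le_rpow hB1 ha hc hS
    (fun ω : Sample D P B => lightWeight B (levelNode ω Q t)) hB1 θ1
    (fun _ _ => lightWeight_le _ _ _) (fun _ => sum_lightWeight_le _ _)
    (fun ω ω' h => by rw [levelNode_congr h]) m
  have q0 := prob_hostedWeight_le_rpow hB1 ha hc hS
    (fun ω : Sample D P B => dataWeight (levelNode ω Q 0)) le_rfl θ0
    (fun _ _ => min_le_left _ _) (fun _ => sum_dataWeight_le _)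
    (fun ω ω' h => by rw [levelNode_congr h]) m
  refine (prob_mono (F := (((_ ∪ _) ∪ _) ∪ _) ∪ _) (fun ω hω => ?_)).trans
    ((prob_union_le _ _).trans (le_trans (add_le_add ((prob_union_le _ _).trans (add_le_add
      ((prob_union_le _ _).trans (add_le_add ((prob_union_le _ _).trans (add_le_add p2 p1)) q2))
      q1)) q0) (by linarith)))
  by_contra h
  simp only [Set.mem_union, Set.mem_ofPred_eq, not_or, not_and, not_lt] at h
  exact hω ⟨h.1.1.1.1, h.1.1.1.2, h.1.1.2, h.1.2, h.2⟩

theorem height_le (hP2 : 2 ≤ P) (hB : 2 ≤ B) : height B P ≤ 2 * P := by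
  have h1 := @l1Height_le_max B P hB
  have h2 := @l2Height_le_max B P
  have h3 := clog_le_self hB P
  unfold height
  omega

/-- The loads of all modules are balanced with high probability. -/
theorem prob_balanced_ge [NeZero P] (hP2 : 2 ≤ P) (hB : 2 ≤ B) {a c : ℝ} (ha : 0 < a)
    (hc : 1 ≤ c) (hS : a * (P * Real.log P * B * logBP B P) ≤ S) (Q : Fin S → K) :
    1 - (P : ℝ) ^ (-c) ≤
      prob {ω : Sample D P B | ∀ m t, Balanced (balanceConst a c) Q ω m t} := by
  have hP0 : (0 : ℝ) < P := by positivity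
  have hP2' : (2 : ℝ) ≤ P := by exact_mod_cast hP2
  have := nonempty_sample (D := D) (P := P) (B := B) (by omega)
  refine le_trans ?_ (one_sub_prob_compl_le _)
  refine sub_le_sub_left ?_ 1
  have hsub : {ω : Sample D P B | ∀ m t, Balanced (balanceConst a c) Q ω m t}ᶜ ⊆
      ⋃ x ∈ (Finset.univ : Finset (Fin P × Fin (height B P + 1))),
        {ω | ¬ Balanced (balanceConst a c) Q ω x.1 x.2} := by
    intro ω hω
    simp only [Set.mem_compl_iff, Set.mem_ofPred_eq, not_forall] at hω
    obtain ⟨m, t, h⟩ := hω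
    exact Set.mem_biUnion (x := (m, t)) (Finset.mem_univ _) h
  refine (prob_mono hsub).trans ((prob_biUnion_le _ _).trans ?_)
  refine (Finset.sum_le_card_nsmul _ _ _ (fun x _ =>
    prob_not_balanced_le hP2 hB ha hc hS Q x.1 x.2)).trans ?_
  rw [Finset.card_univ, Fintype.card_prod, Fintype.card_fin, Fintype.card_fin, nsmul_eq_mul]
  have hh : (height B P : ℝ) ≤ 2 * P := by exact_mod_cast height_le hP2 hB
  -- the number of events is at most `P ^ 6`
  have hcount : ((P * (height B P + 1) : ℕ) : ℝ) * 5 ≤ (P : ℝ) ^ (6 : ℝ) := by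
    have e : (P : ℝ) ^ (6 : ℝ) = (P : ℝ) ^ (6 : ℕ) := by
      rw [← Real.rpow_natCast]; norm_num
    rw [e]
    push_cast
    have h4 : (16 : ℝ) ≤ (P : ℝ) ^ 4 := by
      calc (16 : ℝ) = 2 ^ 4 := by norm_num
        _ ≤ (P : ℝ) ^ 4 := by gcongr
    calc (P : ℝ) * (height B P + 1) * 5 ≤ P * (2 * P + 1) * 5 := by gcongr
      _ ≤ P ^ 2 * 16 := by nlinarith
      _ ≤ P ^ 2 * P ^ 4 := by gcongr
      _ = P ^ 6 := by ring
  calc ((P * (height B P + 1) : ℕ) : ℝ) * (5 * (P : ℝ) ^ (-(7 * c)))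
      = ((P * (height B P + 1) : ℕ) : ℝ) * 5 * (P : ℝ) ^ (-(7 * c)) := by ring
    _ ≤ (P : ℝ) ^ (6 : ℝ) * (P : ℝ) ^ (-(7 * c)) := by gcongr
    _ = (P : ℝ) ^ (6 + -(7 * c)) := by rw [← Real.rpow_add hP0]
    _ ≤ (P : ℝ) ^ (-c) :=
      Real.rpow_le_rpow_of_exponent_le (by linarith) (by linarith)

/-! ### Consequences of balanced loads -/

section Consequences

theorem commBudget_nonneg (s : HostState V D P B S) : 0 ≤ commBudget s := by
  unfold commBudget
  split
  · split_ifs <;> positivity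
  · positivity

theorem commBudget_le (s : HostState V D P B S) : commBudget s ≤ S := by
  have h : (1 : ℝ) ≤ l2Height B P := by exact_mod_cast @one_le_l2Height P B
  unfold commBudget
  split
  · split_ifs
    · exact div_le_self (by positivity) h
    · exact le_rfl
  · exact le_rfl

theorem workBudget_nonneg (h3 : ℕ) (s : HostState V D P B S) : 0 ≤ workBudget h3 s := by
  unfold workBudget
  split
  · positivity
  · split_ifs <;> positivity
  · positivity

theorem card_image_cur_le (cur : Fin S → Ptr D P B) : (Finset.univ.image cur).card ≤ S :=
  Finset.card_image_le.trans (by simp)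

theorem predWords_le (s : HostState V D P B S) : predWords s ≤ 2 + 8 * S + P := by
  cases s with
  | start => simp only [predWords]; omega
  | l2 cur => have := card_image_cur_le cur; simp only [predWords]; omega
  | l1 r cur => have := card_image_cur_le cur; simp only [predWords]; omega
  | data cur => have := card_image_cur_le cur; simp only [predWords]; omega
  | done out => simp only [predWords]; omega

variable [NeZero P] {val : K → V} {ω : Sample D P B} {T : L3Tree D P B} {Q : Fin S → K}

theorem RoundBound.mono {h3 : ℕ} {C C' : ℝ} {m : Fin P} {s : HostState V D P B S}
    (h : RoundBound val ω Q h3 C T m s) (hC : C ≤ C') : RoundBound val ω Q h3 C' T m s := by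
  have h1 := commBudget_nonneg s
  have h2 := workBudget_nonneg h3 s
  exact ⟨h.1.trans (by gcongr), h.2.trans (by gcongr)⟩

theorem loadBalanced_of_balanced (hT : IsL3 ω T) {a κ : ℝ} (ha : 0 < a) (hS : a * P ≤ S)
    (hκ : 3 ≤ κ) (hbal : ∀ m t, Balanced κ Q ω m t) :
    LoadBalanced (predecessor V D B Q) (moduleCode V D P B) (pimMemory val ω T)
      commBudget (workBudget (T.1 + 1)) (3 + pullRounds ω Q + l1Height B P)
      (15 * κ + 5 * (1 + 1 / a)) := by
  intro k hk m
  rw [comm_eq_taskSum, work_eq_taskSum]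
  have h0 : 0 ≤ 5 * (1 + 1 / a) := by positivity
  refine forall_round val ω Q hT
    (p := fun _ s => RoundBound val ω Q (T.1 + 1) (15 * κ + 5 * (1 + 1 / a)) T m s)
    ?_ ?_ ?_ ?_ ?_ hk
  · exact (roundBound_start val ω Q hT ha hS m).mono (by linarith)
  · intro k hk
    exact (roundBound_pull val ω Q (hk.trans_le (pullRounds_le ω Q)) (pulling_of_lt hk) m
      (hbal m) _).mono (by linarith)
  · exact (roundBound_pushL2 val ω Q hκ (pullRounds_le ω Q) (not_pulling_pullRounds ω Q) m
      (hbal m) _).mono (by linarith)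
  · intro r hr
    exact (roundBound_l1 val ω Q hr m (hbal m) _).mono (by linarith)
  · exact (roundBound_data val ω Q m (hbal m) _).mono (by linarith)

theorem sum_comm_le {R k : ℕ} {C : ℝ} {h3 : ℕ}
    (h : LoadBalanced (predecessor V D B Q) (moduleCode V D P B) (pimMemory val ω T)
      commBudget (workBudget h3) R C) (hk : k < R) :
    ((∑ m, comm (predecessor V D B Q) (moduleCode V D P B) (pimMemory val ω T) k m : ℕ) : ℝ) ≤
      C * commBudget (stateAfter (predecessor V D B Q) (moduleCode V D P B)
        (pimMemory val ω T) k) := by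
  have hP : (P : ℝ) ≠ 0 := by exact_mod_cast NeZero.ne P
  push_cast
  refine (Finset.sum_le_card_nsmul _ _ _ (fun m _ => (h k hk m).1)).trans (le_of_eq ?_)
  rw [Finset.card_univ, Fintype.card_fin, nsmul_eq_mul]
  field_simp

/-- The budgets of all rounds together: the Pull rounds in L2 share the budget `S`. -/
theorem sum_commBudget_le (hT : IsL3 ω T) :
    ∑ k ∈ Finset.range (3 + pullRounds ω Q + l1Height B P),
      commBudget (stateAfter (predecessor V D B Q) (moduleCode V D P B) (pimMemory val ω T) k) ≤
      (S : ℝ) * (4 + l1Height B P) := by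
  have hH : (0 : ℝ) < l2Height B P := by exact_mod_cast @one_le_l2Height P B
  have e : 3 + pullRounds ω Q + l1Height B P = (1 + pullRounds ω Q) + (2 + l1Height B P) := by
    ring
  rw [e, Finset.sum_range_add, Finset.sum_range_add]
  have h1 : ∑ k ∈ Finset.range 1, commBudget (stateAfter (predecessor V D B Q)
      (moduleCode V D P B) (pimMemory val ω T) k) ≤ S := by
    rw [Finset.sum_range_one]
    exact commBudget_le _
  have h2 : ∑ k ∈ Finset.range (pullRounds ω Q), commBudget (stateAfter (predecessor V D B Q)
      (moduleCode V D P B) (pimMemory val ω T) (1 + k)) ≤ S := by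
    refine (Finset.sum_le_card_nsmul _ _ ((S : ℝ) / l2Height B P) (fun k hk => ?_)).trans ?_
    · have hk := Finset.mem_range.1 hk
      rw [stateAfter_l2 val ω Q hT hk.le]
      simp only [commBudget, if_pos (pulling_of_lt hk), le_refl]
    · rw [Finset.card_range, nsmul_eq_mul]
      have : (pullRounds ω Q : ℝ) ≤ l2Height B P := by exact_mod_cast pullRounds_le ω Q
      calc (pullRounds ω Q : ℝ) * (S / l2Height B P)
          ≤ l2Height B P * (S / l2Height B P) := by gcongr
        _ = S := by field_simp
  have h3 : ∑ k ∈ Finset.range (2 + l1Height B P), commBudget (stateAfter (predecessor V D B Q)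
      (moduleCode V D P B) (pimMemory val ω T) (1 + pullRounds ω Q + k)) ≤
      (2 + l1Height B P) * (S : ℝ) := by
    refine (Finset.sum_le_card_nsmul _ _ (S : ℝ) (fun k _ => commBudget_le _)).trans ?_
    rw [Finset.card_range, nsmul_eq_mul]
    push_cast
    exact le_rfl
  linarith

theorem footprint_le (hT : IsL3 ω T) {C : ℝ} {h3 : ℕ} (hC : 0 ≤ C)
    (h : LoadBalanced (predecessor V D B Q) (moduleCode V D P B) (pimMemory val ω T)
      commBudget (workBudget h3) (3 + pullRounds ω Q + l1Height B P) C)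
    {k : ℕ} (hk : k ≤ 3 + pullRounds ω Q + l1Height B P) :
    (footprint (predecessor V D B Q) (moduleCode V D P B) (pimMemory val ω T) k : ℝ) ≤
      2 + 8 * S + P + C * S := by
  have h1 : ((∑ m, comm (predecessor V D B Q) (moduleCode V D P B) (pimMemory val ω T) k m : ℕ)
      : ℝ) ≤ C * S := by
    rcases Nat.eq_or_lt_of_le hk with rfl | hk
    · simp only [comm_eq_taskSum, stateAfter_done val ω Q hT]
      have : (0 : ℝ) ≤ C * S := by positivity
      simpa [predCalls, taskSum] using this
    · exact (sum_comm_le h hk).trans (by gcongr; exact commBudget_le _)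
  have h2 : ((predWords (stateAfter (predecessor V D B Q) (moduleCode V D P B)
      (pimMemory val ω T) k) : ℕ) : ℝ) ≤ ((2 + 8 * S + P : ℕ) : ℝ) := by
    exact_mod_cast predWords_le _
  have e : footprint (predecessor V D B Q) (moduleCode V D P B) (pimMemory val ω T) k =
      predWords (stateAfter (predecessor V D B Q) (moduleCode V D P B) (pimMemory val ω T) k) +
      ∑ m, comm (predecessor V D B Q) (moduleCode V D P B) (pimMemory val ω T) k m := rfl
  rw [e, Nat.cast_add]
  push_cast at h1 h2 ⊢
  linarith

end Consequences

end Final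
end PimTree

open PimTree in
theorem mainTheorem1 :
    (∃ A : ℝ, 0 < A ∧
      ∀ (K V : Type*) [LinearOrder K] (P B S : ℕ) [NeZero P] (D : Finset K) (val : K → V)
        (Q : Fin S → K) (L3 : Sample D P B → L3Tree D P B),
        2 ≤ B → (∀ ω, IsL3 ω (L3 ω)) →
        ∀ ω : Sample D P B, ∃ R : ℕ,
          HaltsAfter (predecessor V D B Q) (moduleCode V D P B) (pimMemory val ω (L3 ω)) R ∧
          (R : ℝ) ≤ A * logBP B P ∧
          ∃ out : Fin S → Option (K × V),
            stateAfter (predecessor V D B Q) (moduleCode V D P B)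
              (pimMemory val ω (L3 ω)) R = .done out ∧
            ∀ i, IsPredecessor D val (Q i) (out i)) ∧
    (∀ a : ℝ, 0 < a → ∃ A : ℝ, 0 < A ∧
      ∀ (K V : Type*) [LinearOrder K] (P B S : ℕ) [NeZero P] (D : Finset K) (val : K → V)
        (Q : Fin S → K) (L3 : Sample D P B → L3Tree D P B),
        2 ≤ B → (∀ ω, IsL3 ω (L3 ω)) →
        a * (P * Real.log P * B * logBP B P) ≤ S →
        ∀ c : ℝ, 1 ≤ c →
          1 - (P : ℝ) ^ (-c) ≤ prob {ω : Sample D P B | ∃ R : ℕ,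
            HaltsAfter (predecessor V D B Q) (moduleCode V D P B) (pimMemory val ω (L3 ω)) R ∧
            ((∑ k ∈ Finset.range R, ∑ m, comm (predecessor V D B Q) (moduleCode V D P B)
                (pimMemory val ω (L3 ω)) k m : ℕ) : ℝ)
              ≤ A * c * (S * (1 + Real.logb B (logBP B P))) ∧
            LoadBalanced (predecessor V D B Q) (moduleCode V D P B) (pimMemory val ω (L3 ω))
              commBudget (workBudget ((L3 ω).1 + 1)) R (A * c) ∧
            ∀ k ≤ R, (footprint (predecessor V D B Q) (moduleCode V D P B)
              (pimMemory val ω (L3 ω)) k : ℝ) ≤ A * c * S}) := by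
  refine ⟨⟨7, by norm_num, ?_⟩, fun a ha => ?_⟩
  · intro K V _ P B S _ D val Q L3 hB hL3 ω
    refine ⟨_, haltsAfter val ω Q (hL3 ω), ?_, _, stateAfter_done val ω Q (hL3 ω),
      fun i => isPredecessor_entry val ω (Q i)⟩
    have hP : 1 ≤ P := Nat.one_le_iff_ne_zero.2 (NeZero.ne P)
    have h1 := l1Height_le hB hP
    have h2 := l2Height_le hB hP
    have h3 : (pullRounds ω Q : ℝ) ≤ l2Height B P := by exact_mod_cast pullRounds_le ω Q
    have h4 := @one_le_logBP B P
    push_cast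
    linarith
  · -- the constant for the loads; the factor `6` pays for the sum of all budgets
    set A₁ : ℝ := 15 * (16 + 128 / a) + 5 * (1 + 1 / a) with hA₁
    have hA₁0 : 0 < A₁ := by positivity
    refine ⟨6 * A₁ + 8 + 2 / a, by positivity, ?_⟩
    intro K V _ P B S _ D val Q L3 hB hL3 hS c hc
    rcases Nat.lt_or_ge P 2 with hP | hP
    · have hP1 : P = 1 := by have := NeZero.ne P; omega
      subst hP1
      simpa using prob_nonneg _
    have hP' : (2 : ℝ) ≤ P := by exact_mod_cast hP
    have hB' : (2 : ℝ) ≤ B := by exact_mod_cast hB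
    have hL := @one_le_logBP B P
    have haS : a * P ≤ S := by
      refine le_trans ?_ hS
      have h1 : Real.log 2 ≤ Real.log P := Real.log_le_log (by norm_num) hP'
      have h2 := Real.log_two_gt_d9
      have h3 : 1 ≤ Real.log P * B := by nlinarith
      have h4 : 1 ≤ Real.log P * B * logBP B P := by nlinarith
      calc a * P = a * (P * 1) := by ring
        _ ≤ a * (P * (Real.log P * B * logBP B P)) := by gcongr
        _ = _ := by ring
    refine (prob_balanced_ge hP hB ha hc hS Q).trans (prob_mono (fun ω hω => ?_))
    have hκ : 3 ≤ balanceConst a c := by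
      have : 0 ≤ 128 / a := by positivity
      unfold balanceConst
      nlinarith
    have hlb := loadBalanced_of_balanced (val := val) (hL3 ω) ha haS hκ hω
    set C := 15 * balanceConst a c + 5 * (1 + 1 / a) with hC
    have hCA : C ≤ A₁ * c := by
      have : 0 ≤ 5 * (1 + 1 / a) := by positivity
      rw [hC, hA₁, balanceConst]
      nlinarith
    have hC0 : 0 ≤ C := by
      have : 0 ≤ 5 * (1 + 1 / a) := by positivity
      linarith
    have h2a : 0 ≤ 2 / a := by positivity
    have hlog := @logb_logBP_nonneg B P hB
    refine ⟨_, haltsAfter val ω Q (hL3 ω), ?_, ?_, ?_⟩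
    · have h1 : ((∑ k ∈ Finset.range (3 + pullRounds ω Q + l1Height B P), ∑ m,
          comm (predecessor V D B Q) (moduleCode V D P B) (pimMemory val ω (L3 ω)) k m : ℕ) : ℝ)
          ≤ C * (S * (4 + l1Height B P)) := by
        rw [Nat.cast_sum]
        refine (Finset.sum_le_sum
          (fun k hk => sum_comm_le hlb (Finset.mem_range.1 hk))).trans ?_
        rw [← Finset.mul_sum]
        exact mul_le_mul_of_nonneg_left (sum_commBudget_le (hL3 ω)) hC0
      have h2 := @l1Height_le_logb B P hB (by omega)
      have h3 : (4 : ℝ) + l1Height B P ≤ 6 * (1 + Real.logb B (logBP B P)) := by linarith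
      refine h1.trans ?_
      calc C * (S * (4 + l1Height B P))
          ≤ (A₁ * c) * (S * (6 * (1 + Real.logb B (logBP B P)))) := by gcongr
        _ = 6 * A₁ * c * (S * (1 + Real.logb B (logBP B P))) := by ring
        _ ≤ _ := by gcongr; linarith
    · intro k hk m
      have h1 := hlb k hk m
      have h2 : C ≤ (6 * A₁ + 8 + 2 / a) * c := hCA.trans (by gcongr; linarith)
      have h3 := commBudget_nonneg (stateAfter (predecessor V D B Q) (moduleCode V D P B)
        (pimMemory val ω (L3 ω)) k)
      have h4 := workBudget_nonneg ((L3 ω).1 + 1) (stateAfter (predecessor V D B Q)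
        (moduleCode V D P B) (pimMemory val ω (L3 ω)) k)
      exact ⟨h1.1.trans (by gcongr), h1.2.trans (by gcongr)⟩
    · intro k hk
      refine (footprint_le (hL3 ω) hC0 hlb hk).trans ?_
      have hPS : (P : ℝ) ≤ 1 / a * S := by
        rw [one_div, ← div_eq_inv_mul, le_div_iff₀ ha]; linarith
      have hS0 : (0 : ℝ) ≤ S := by positivity
      have e : 2 / a = 2 * (1 / a) := by ring
      calc 2 + 8 * (S : ℝ) + P + C * S ≤ 8 * S + 2 * (1 / a * S) + A₁ * c * S := by
            have : C * S ≤ A₁ * c * S := by gcongr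
            linarith
        _ = (8 + 2 / a) * 1 * S + A₁ * c * S := by rw [e]; ring
        _ ≤ (8 + 2 / a) * c * S + (6 * A₁) * c * S := by gcongr; linarith
        _ = _ := by ring
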